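/- Let $f:\mathbb R^n\to\mathbb R^n$ be $C^1$, $c\in\mathbb R$, and let $\bar u$ be a non-constant $1$-periodic $C^2$ solution of $\bar u''+c\bar u'+f(\bar u)=0$. Put $L=\partial_x^2+c\partial_x+df(\bar u)$ on $L^2(\mathbb R)$ (domain $H^2(\mathbb R)$) and, for $\xi\in[-\pi,\pi)$, $L_\xi=(\partial_x+i\xi)^2+c(\partial_x+i\xi)+df(\bar u)$ on $L^2_{per}([0,1])$ (domain $H^2_{per}([0,1])$), and assume: (D1) $\sigma_{L^2(\mathbb R)}(L)\subset\{\operatorname{Re}\lambda<0\}\cup\{0\}$; (D2) $0$ is a simple eigenvalue of $L_0$; (D3) there is $\theta>0$ with $\operatorname{Re}\sigma(L_\xi)\le-\theta|\xi|^2$ for all $\xi\in[-\pi,\pi)$. Then for some $\varepsilon_0\in(0,\pi]$ and all $|\xi|<\varepsilon_0$ there are an eigenvalue $\lambda(\xi)$ of $L_\xi$, with $\lambda(0)=0$, and right and left eigenfunctions $q(\xi,\cdot)$, $\tilde q(\xi,\cdot)$ depending analytically on $\xi$ (as elements of $L^2_{per}([0,1])$), with $q(0,\cdot)=\bar u'$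 and $\langle\tilde q(\xi),q(\xi)\rangle_{L^2([0,1])}=1$. For every such choice there are $a\in\mathbb R$, $b>0$ with $\lambda(\xi)=-ia\xi-b\xi^2+O(|\xi|^3)$ as $\xi\to0$, and the following holds. Let $\alpha$ be a smooth cutoff function with support in $(-\varepsilon_0,\varepsilon_0)$ and $\alpha=1$ near $0$. For $h_0:\mathbb R\to\mathbb R$, let $\hat h_0$ be its Fourier transform (formally $\int e^{-i\xi y}h_0(y)\,dy$, in the sense of tempered distributions), and set $$\tilde S_1(t)(\bar u'h_0)(x)=\sum_{j\in\mathbb Z}\int_{-\pi}^{\pi}e^{i\xi x}e^{\lambda(\xi)t}\alpha(\xi)\,\langle\tilde q(\xi,\cdot),\bar u'e^{2\pi ij\,\cdot}\rangle_{L^2([0,1])}\,\hat h_0(\xi+2\pi j)\,d\xi-\int_{-\infty}^{\infty}e^{i\xi x}e^{(-ia\xi-b\xi^2)t}\hat h_0(\xi)\,d\xi .$$ The sum is the Bloch critical-mode part $\int_{-\pi}^{\pi}e^{i\xi x}e^{\lambda(\xi)t}\alpha(\xi)\langle\tilde q(\xi,\cdot),\bar u'\check h_0(\xi,\cdot)\rangle_{L^2([0,1])}\,d\xi$,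 where $\check h_0(\xi,x)=\sum_j e^{2\pi ijx}\hat h_0(\xi+2\pi j)$. For every $r>1$ and $C>0$ there are constants $M'>M>0$ and $K>0$ such that, for every $E_0>0$, every differentiable $h_0:\mathbb R\to\mathbb R$ with $|\partial_xh_0(x)|\le E_0(1+|x|)^{-r}$, every $t>0$ and every $x$ with $|x|\le Ct$, the sum over $j$ converges absolutely and, with $$B=\int_{-\infty}^{\infty}\Big[(1+|x-y-at|+\sqrt t)^{-2}+t^{-1/2}e^{-\frac{|x-y-at|^2}{Mt}}\Big]|\partial_yh_0(y)|\,dy,\qquad P=(1+|x-at|+\sqrt t)^{-r}+(1+t)^{-1/2}e^{-\frac{|x-at|^2}{M't}},$$ one has $|\tilde S_1(t)(\bar u'h_0)(x)|\le K\,B$ and $|\tilde S_1(t)(\bar u'h_0)(x)|\le K\,E_0\,P$; if moreover $r\le2$, then also $B\le K\,E_0\,P$. -/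

import Mathlib

open MeasureTheory Filter Topology
open scoped ContDiff

noncomputable section

namespace PeriodicRD

/-- The state space `ℝⁿ`. -/
abbrev RVec (n : ℕ) : Type := EuclideanSpace ℝ (Fin n)

/-- Its complexification `ℂⁿ`. -/
abbrev CVec (n : ℕ) : Type := EuclideanSpace ℂ (Fin n)

/-- `L²(ℝ; ℂⁿ)`. -/
abbrev L2Line (n : ℕ) : Type := Lp (CVec n) 2 (volume : Measure ℝ)

/-- `L²_per([0,1]; ℂⁿ)`, realised on the circle `ℝ/ℤ` of total length one.  An element `w` is
viewed as a `1`-periodic function on the line through `fun x : ℝ => w x`. -/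
abbrev L2Per (n : ℕ) : Type := Lp (CVec n) 2 (volume : Measure UnitAddCircle)

/-- The inclusion `ℝⁿ ⊆ ℂⁿ`. -/
def cvec {n : ℕ} (v : RVec n) : CVec n := WithLp.toLp 2 (fun i => ((v i : ℝ) : ℂ))

/-- The complex-linear extension to `ℂⁿ` of the Jacobian `df(p)` of `f : ℝⁿ → ℝⁿ`. -/
def jacobian {n : ℕ} (f : RVec n → RVec n) (p : RVec n) (v : CVec n) : CVec n :=
  WithLp.toLp 2 (fun i => ∑ j, (((fderiv ℝ f p (EuclideanSpace.single j 1)) i : ℝ) : ℂ) * v j)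

/-- `v` is the distributional derivative of `u` on the real line. -/
def HasWeakDeriv {n : ℕ} (u v : ℝ → CVec n) : Prop :=
  ∀ φ : ℝ → ℝ, ContDiff ℝ ∞ φ → HasCompactSupport φ →
    ∫ x, deriv φ x • u x = - ∫ x, φ x • v x

/-- `u` is a non-constant, `1`-periodic, stationary solution of `u_t = u_xx + c u_x + f(u)`. -/
structure IsPeriodicProfile {n : ℕ} (f : RVec n → RVec n) (c : ℝ) (u : ℝ → RVec n) : Prop where
  contDiff : ContDiff ℝ 2 u
  periodic : ∀ x, u (x + 1) = u x
  stationary : ∀ x, deriv (deriv u) x + c • deriv u x + f (u x) = 0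
  nonconstant : ∃ x, deriv u x ≠ 0

/-- The graph of `L = ∂ₓ² + c ∂ₓ + df(u)` on `L²(ℝ)` with domain `H²(ℝ)`:
`v ∈ H²(ℝ)` and `L v = g`. -/
def LineGraph {n : ℕ} (f : RVec n → RVec n) (c : ℝ) (u : ℝ → RVec n) (v g : L2Line n) : Prop :=
  ∃ v₁ v₂ : L2Line n, HasWeakDeriv v v₁ ∧ HasWeakDeriv v₁ v₂ ∧
    ∀ᵐ x : ℝ, g x = v₂ x + (c : ℂ) • v₁ x + jacobian f (u x) (v x)

/-- The graph of the Bloch operator `L_ξ = (∂ₓ + iξ)² + c (∂ₓ + iξ) + df(u)` on `L²_per([0,1])`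
with domain `H²_per([0,1])`: `w ∈ H²_per([0,1])` and `L_ξ w = g`. -/
def BlochGraph {n : ℕ} (f : RVec n → RVec n) (c : ℝ) (u : ℝ → RVec n) (ξ : ℝ)
    (w g : L2Per n) : Prop :=
  ∃ w₁ w₂ : L2Per n,
    HasWeakDeriv (fun x : ℝ => w x) (fun x : ℝ => w₁ x) ∧
    HasWeakDeriv (fun x : ℝ => w₁ x) (fun x : ℝ => w₂ x) ∧
    ∀ᵐ x : ℝ, g x =
      (w₂ x + (2 * Complex.I * ξ) • w₁ x + (Complex.I * ξ) ^ 2 • w x)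
        + (c : ℂ) • (w₁ x + (Complex.I * ξ) • w x) + jacobian f (u x) (w x)

/-- The spectrum of an operator given by its graph `G`: the complement of the set of `μ` for which
`G - μ` is a bijection of the domain onto the whole space.  (The operators above are closed, so
that the inverse is then automatically bounded.) -/
def graphSpectrum {H : Type*} [AddCommGroup H] [Module ℂ H] (G : H → H → Prop) : Set ℂ :=
  {μ | ¬ ∀ g : H, ∃! w : H, G w (μ • w + g)}

/-- `μ` is an (algebraically) simple eigenvalue of the operator with graph `G`:
the kernels of `G - μ` and of `(G - μ)²` coincide and are one-dimensional. -/
def IsSimpleEigenvalue {H : Type*} [AddCommGroup H] [Module ℂ H] (G : H → H → Prop)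
    (μ : ℂ) : Prop :=
  ∃ w : H, w ≠ 0 ∧ G w (μ • w) ∧
    ∀ v z : H, G v (μ • v + z) → G z (μ • z) → ∃ k : ℂ, v = k • w

/-- The diffusive spectral stability conditions (D1), (D2), (D3). -/
structure DiffusivelyStable {n : ℕ} (f : RVec n → RVec n) (c : ℝ) (u : ℝ → RVec n) : Prop where
  D1 : graphSpectrum (LineGraph f c u) ⊆ {μ : ℂ | μ.re < 0} ∪ {0}
  D2 : IsSimpleEigenvalue (BlochGraph f c u 0) 0
  D3 : ∃ θ : ℝ, 0 < θ ∧ ∀ ξ ∈ Set.Ico (-Real.pi) Real.pi,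
    ∀ μ ∈ graphSpectrum (BlochGraph f c u ξ), μ.re ≤ -θ * |ξ| ^ 2

/-- `lam ξ` is the eigenvalue of `L_ξ` bifurcating from `0` at `ξ = 0`, for `|ξ| < ε₀`, and
`q ξ`, `qt ξ` are corresponding right and left eigenfunctions which depend analytically on `ξ` and
are normalised by `⟨qt ξ, q ξ⟩ = 1` and `q 0 = u'`.  (`qt ξ` is an eigenfunction of the Hilbert
space adjoint of `L_ξ`, and `q ξ ⟨qt ξ, ·⟩` is the eigenprojection.) -/
structure IsCriticalMode {n : ℕ} (f : RVec n → RVec n) (c : ℝ) (u : ℝ → RVec n)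
    (ε₀ : ℝ) (lam : ℝ → ℂ) (q qt : ℝ → L2Per n) : Prop where
  pos : 0 < ε₀
  le_pi : ε₀ ≤ Real.pi
  lam_zero : lam 0 = 0
  q_zero : ∀ᵐ x : ℝ, q 0 x = cvec (deriv u x)
  analytic_q : AnalyticOnNhd ℝ q (Set.Ioo (-ε₀) ε₀)
  analytic_qt : AnalyticOnNhd ℝ qt (Set.Ioo (-ε₀) ε₀)
  right_eigen : ∀ ξ ∈ Set.Ioo (-ε₀) ε₀, BlochGraph f c u ξ (q ξ) (lam ξ • q ξ)
  left_eigen : ∀ ξ ∈ Set.Ioo (-ε₀) ε₀, ∀ w g : L2Per n, BlochGraph f c u ξ w g →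
    inner ℂ (qt ξ) g = lam ξ * inner ℂ (qt ξ) w
  normalized : ∀ ξ ∈ Set.Ioo (-ε₀) ε₀, inner ℂ (qt ξ) (q ξ) = 1

/-- A smooth cutoff function in frequency, equal to `1` near `0`, supported in `|ξ| < ε₀`. -/
structure IsCutoff (ε₀ : ℝ) (α : ℝ → ℝ) : Prop where
  contDiff : ContDiff ℝ ∞ α
  support : tsupport α ⊆ Set.Ioo (-ε₀) ε₀
  eq_one : ∀ᶠ ξ in 𝓝 (0 : ℝ), α ξ = 1

/-- The integral `∫ Ψ(ξ) ĥ(ξ + s) dξ`, where `ĥ(ξ) = ∫ e^{-iξy} h(y) dy`, for a function `h` which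
need not decay: `ĥ` is the Fourier transform of the tempered distribution `h`, whose value at a
test function is the integral of `h` against the Fourier transform of the test function. -/
def fourierPairing (h : ℝ → ℝ) (s : ℝ) (Ψ : ℝ → ℂ) : ℂ :=
  ∫ y : ℝ, (h y : ℂ) * ∫ ξ : ℝ, Complex.exp (-Complex.I * (ξ + s) * y) * Ψ ξ

/-- `⟨qt(ξ,·), u' e^{2πij·}⟩` in `L²([0,1])` (conjugate-linear in the first argument). -/
def modeCoeff {n : ℕ} (u : ℝ → RVec n) (qt : ℝ → L2Per n) (j : ℤ) (ξ : ℝ) : ℂ :=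
  ∫ x in (0 : ℝ)..1,
    inner ℂ (qt ξ x) (Complex.exp (2 * Real.pi * Complex.I * j * x) • cvec (deriv u x))

/-- The `j`-th term of the critical-mode part of the Bloch solution formula,
`∫_{-π}^{π} e^{iξx} e^{λ(ξ)t} α(ξ) ⟨qt(ξ,·), u' e^{2πij·}⟩ ĥ(ξ + 2πj) dξ`
(the cutoff `α` is supported inside `(-π,π)`). -/
def criticalTerm {n : ℕ} (u : ℝ → RVec n) (lam : ℝ → ℂ) (qt : ℝ → L2Per n) (α : ℝ → ℝ)
    (h : ℝ → ℝ) (t x : ℝ) (j : ℤ) : ℂ :=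
  fourierPairing h (2 * Real.pi * j) (fun ξ =>
    Complex.exp (Complex.I * ξ * x) * Complex.exp (lam ξ * t) * (α ξ : ℂ) * modeCoeff u qt j ξ)

/-- The Gaussian principal part `∫ e^{iξx} e^{(-iaξ - bξ²)t} ĥ(ξ) dξ`. -/
def gaussianPart (a b : ℝ) (h : ℝ → ℝ) (t x : ℝ) : ℂ :=
  fourierPairing h 0 (fun ξ =>
    Complex.exp (Complex.I * ξ * x) * Complex.exp ((-Complex.I * a * ξ - b * ξ ^ 2) * t))

/-- `S̃₁(t)(u'h)(x)`: the critical-mode part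
`∫_{-π}^{π} e^{iξx} e^{λ(ξ)t} α(ξ) ⟨qt(ξ,·), u' ȟ(ξ,·)⟩ dξ`, with the Bloch transform
`ȟ(ξ,x) = ∑_j e^{2πijx} ĥ(ξ + 2πj)`, minus the Gaussian principal part. -/
def sTildeOne {n : ℕ} (u : ℝ → RVec n) (lam : ℝ → ℂ) (qt : ℝ → L2Per n) (α : ℝ → ℝ) (a b : ℝ)
    (h : ℝ → ℝ) (t x : ℝ) : ℂ :=
  (∑' j : ℤ, criticalTerm u lam qt α h t x j) - gaussianPart a b h t x

/-- The convolution
`∫ [(1+|x-y-at|+√t)^{-2} + t^{-1/2} e^{-|x-y-at|²/(Mt)}] |∂_y h(y)| dy`. -/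
def convolutionBound (a M : ℝ) (h : ℝ → ℝ) (t x : ℝ) : ℝ :=
  ∫ y : ℝ, ((1 + |x - y - a * t| + √t) ^ (-2 : ℝ)
    + t ^ (-(1 / 2) : ℝ) * Real.exp (-(|x - y - a * t| ^ 2 / (M * t)))) * |deriv h y|

/-- The profile `(1+|x-at|+√t)^{-r} + (1+t)^{-1/2} e^{-|x-at|²/(M't)}`. -/
def decayProfile (a M' r t x : ℝ) : ℝ :=
  (1 + |x - a * t| + √t) ^ (-r)
    + (1 + t) ^ (-(1 / 2) : ℝ) * Real.exp (-(|x - a * t| ^ 2 / (M' * t)))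

end PeriodicRD

end

/-!
The critical mode exists because, after the substitution `w = (1 + ∂ₓ)⁻² p`, the Bloch operator
`L_ξ` becomes the bounded operator `blochOp`, a compact perturbation of the identity that is
polynomial in `ξ`. Bordering it by `(1 + ∂ₓ)⁻² p₀`, where `u' = (1 + ∂ₓ)⁻² p₀`, and by a functional
`φ` with `φ p₀ = 1` gives an operator that is injective at `ξ = 0`, since `0` is a simple eigenvalue,
and hence invertible (`isUnit_bordered_blochOp`). The last component `κ(ξ, λ)` of the preimage of
`(0, 1)` satisfies `κ(0, λ) = λ`, so `κ = 0` can be solved for an analytic `λ(ξ)`, and the inverse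
contains a right and a left null vector (`exists_analytic_eigenvalue_branch`).

For any critical mode, testing `L_ξ q(ξ₀)` with the left eigenfunction shows that `λ` is analytic.
Complex conjugation gives `λ(-ξ) = conj λ(ξ)`, and together with (D3) this yields
`λ(ξ) = -iaξ + ξ² s(ξ)` with `s(0) = -b` real and `Re s ≤ -θ`
(`IsCriticalMode.exists_expansion`).

In the estimate each frequency `ξ + 2πj` contributes the convolution of `h₀` with an oscillatory
kernel `∫ e^{iξw} e^{tξ²m(ξ)} A(ξ) dξ` at `w = x - at - y`. Only `h₀'` decays, so one derivative has
to be moved onto `h₀` by an integration by parts in `y`. For `j ≠ 0` this divides the amplitude by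
`ξ + 2πj ≠ 0`; the quotients form an analytic function of `ξ` with values in `ℓ¹`, by the
Cauchy–Schwarz inequality, and the kernel bounds for vector-valued amplitudes sum over all `j` at
once (`IsCriticalMode.exists_isCriticalSymbol`). For `j = 0` the division is singular at `ξ = 0`, but
the difference of the kernel and the Gaussian one has integral zero, because the two symbols agree
at `ξ = 0`, so its primitive is again controlled by its tails
(`exists_primitive_oscKernel_sub_gaussKernel`).

The kernel bounds come from the diffusive scaling `ξ = t^{-1/2} η`, under which the kernel is a moment
`∫ e^{iηv} ηᵏ e^{η² m(sη)} A(sη) dη` with `s = t^{-1/2}`. At `s = 0` this is a derivative of the Gaussian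
`e^{-v²/(4b)}`; integration by parts in `η` gives arbitrary algebraic decay in `v`, and repeated use
of the mean value inequality in `s` gives a Gaussian plus a remainder `s^N (1 + |v|)^{-n}`
(`exists_norm_oscMoment_le_gaussian_add`). In the original variables the remainder is
`(1 + |w| + √t)^{-n}`, so that the kernels obey `kernelProfile`. Convolving this profile with
`|h₀'| ≤ E₀ (1 + |y|)^{-r}` gives the stated decay (`exists_integral_kernelProfile_mul_le`).
-/

noncomputable section

namespace PeriodicRD

/-! ### Oscillatory integrals with a diffusive phase -/

section Oscillatory

variable {E : Type*} [NormedAddCommGroup E] [NormedSpace ℂ E]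

/-- The integrand of `oscMoment`. -/
def oscIntegrand (m : ℝ → ℂ) (A : ℝ → E) (k : ℕ) (s v η : ℝ) : E :=
  (Complex.exp (Complex.I * η * v) * (η : ℂ) ^ k * Complex.exp ((η : ℂ) ^ 2 * m (s * η))) • A (s * η)

/-- The moment `∫ e^{iηv} ηᵏ e^{η² m(sη)} A(sη) dη`.  With `s = t^{-1/2}` this is the kernel with
symbol `e^{t ξ² m(ξ)} A(ξ)` in diffusively rescaled variables. -/
def oscMoment (m : ℝ → ℂ) (A : ℝ → E) (k : ℕ) (s v : ℝ) : E :=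
  ∫ η : ℝ, oscIntegrand m A k s v η

/-- A phase `ξ² m(ξ)` with smooth `m` and uniformly negative real part. -/
structure IsDiffusivePhase (m : ℝ → ℂ) (θ : ℝ) : Prop where
  contDiff : ContDiff ℝ ∞ m
  pos : 0 < θ
  re_le : ∀ ξ, (m ξ).re ≤ -θ

/-- Smooth compactly supported amplitudes. -/
structure IsAmplitude (A : ℝ → E) : Prop where
  contDiff : ContDiff ℝ ∞ A
  compact : HasCompactSupport A

theorem IsAmplitude.bounded {A : ℝ → E} (hA : IsAmplitude A) : ∃ C, 0 ≤ C ∧ ∀ x, ‖A x‖ ≤ C := by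
  obtain ⟨C, hC⟩ := hA.compact.exists_bound_of_continuous hA.contDiff.continuous
  exact ⟨C, (norm_nonneg _).trans (hC 0), hC⟩

theorem IsAmplitude.deriv {A : ℝ → E} (hA : IsAmplitude A) : IsAmplitude (deriv A) :=
  ⟨((contDiff_infty_iff_deriv (F := E)).1 hA.contDiff).2, hA.compact.deriv⟩

theorem IsAmplitude.smul {A : ℝ → E} (hA : IsAmplitude A) {g : ℝ → ℂ} (hg : ContDiff ℝ ∞ g) :
    IsAmplitude (fun x => g x • A x) :=
  ⟨hg.smul hA.contDiff, hA.compact.smul_left⟩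

theorem IsAmplitude.hasDerivAt {A : ℝ → E} (hA : IsAmplitude A) (x : ℝ) :
    HasDerivAt A (_root_.deriv A x) x :=
  (hA.contDiff.differentiable (by simp)).differentiableAt.hasDerivAt

theorem IsDiffusivePhase.contDiff_deriv {m : ℝ → ℂ} {θ : ℝ} (hm : IsDiffusivePhase m θ) :
    ContDiff ℝ ∞ (deriv m) :=
  ((contDiff_infty_iff_deriv (F := ℂ)).1 hm.contDiff).2

theorem IsDiffusivePhase.hasDerivAt {m : ℝ → ℂ} {θ : ℝ} (hm : IsDiffusivePhase m θ) (x : ℝ) :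
    HasDerivAt m (deriv m x) x :=
  (hm.contDiff.differentiable (by simp)).differentiableAt.hasDerivAt

theorem integrable_abs_pow_mul_exp_neg_mul_sq {θ : ℝ} (hθ : 0 < θ) (k : ℕ) :
    Integrable fun η : ℝ => |η| ^ k * Real.exp (-θ * η ^ 2) := by
  have h := (integrable_rpow_mul_exp_neg_mul_sq hθ (s := k) (by
    have : (0 : ℝ) ≤ k := k.cast_nonneg
    linarith)).norm
  refine h.congr (Eventually.of_forall fun η => ?_)
  simp [abs_of_pos (Real.exp_pos _)]

theorem norm_oscIntegrand_le {m : ℝ → ℂ} {θ : ℝ} (hm : IsDiffusivePhase m θ) {A : ℝ → E} {C : ℝ}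
    (hC : ∀ x, ‖A x‖ ≤ C) (k : ℕ) (s v η : ℝ) :
    ‖oscIntegrand m A k s v η‖ ≤ C * (|η| ^ k * Real.exp (-θ * η ^ 2)) := by
  have h1 : ‖Complex.exp (Complex.I * η * v)‖ = 1 := by
    rw [Complex.norm_exp]; simp
  have h2 : ‖Complex.exp ((η : ℂ) ^ 2 * m (s * η))‖ ≤ Real.exp (-θ * η ^ 2) := by
    rw [Complex.norm_exp]
    apply Real.exp_le_exp.2
    have : ((η : ℂ) ^ 2 * m (s * η)).re = η ^ 2 * (m (s * η)).re := by
      rw [← Complex.ofReal_pow, Complex.re_ofReal_mul]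
    rw [this]
    nlinarith [hm.re_le (s * η), sq_nonneg η]
  rw [oscIntegrand, norm_smul, norm_mul, norm_mul, h1, one_mul, norm_pow, Complex.norm_real,
    Real.norm_eq_abs, mul_comm]
  gcongr
  · exact (norm_nonneg _).trans (hC 0)
  · exact hC _

theorem continuous_oscIntegrand {m : ℝ → ℂ} {θ : ℝ} (hm : IsDiffusivePhase m θ) {A : ℝ → E}
    (hA : IsAmplitude A) (k : ℕ) (s v : ℝ) : Continuous (oscIntegrand m A k s v) := by
  have h1 := hm.contDiff.continuous
  have h2 := hA.contDiff.continuous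
  unfold oscIntegrand
  fun_prop

theorem integrable_oscIntegrand {m : ℝ → ℂ} {θ : ℝ} (hm : IsDiffusivePhase m θ) {A : ℝ → E}
    (hA : IsAmplitude A) (k : ℕ) (s v : ℝ) : Integrable (oscIntegrand m A k s v) := by
  obtain ⟨C, -, hC⟩ := hA.bounded
  exact ((integrable_abs_pow_mul_exp_neg_mul_sq hm.pos k).const_mul C).mono'
    (continuous_oscIntegrand hm hA k s v).aestronglyMeasurable
    (Eventually.of_forall (norm_oscIntegrand_le hm hC k s v))

theorem exists_norm_oscMoment_le {m : ℝ → ℂ} {θ : ℝ} (hm : IsDiffusivePhase m θ) {A : ℝ → E}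
    (hA : IsAmplitude A) (k : ℕ) : ∃ C, 0 ≤ C ∧ ∀ s v, ‖oscMoment m A k s v‖ ≤ C := by
  obtain ⟨C, hC0, hC⟩ := hA.bounded
  refine ⟨∫ η : ℝ, C * (|η| ^ k * Real.exp (-θ * η ^ 2)), integral_nonneg fun η => by positivity,
    fun s v => norm_integral_le_of_norm_le
      ((integrable_abs_pow_mul_exp_neg_mul_sq hm.pos k).const_mul C)
      (Eventually.of_forall (norm_oscIntegrand_le hm hC k s v))⟩

theorem hasDerivAt_oscIntegrand {m : ℝ → ℂ} {θ : ℝ} (hm : IsDiffusivePhase m θ) {A : ℝ → E}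
    (hA : IsAmplitude A) (k : ℕ) (s v η : ℝ) :
    HasDerivAt (oscIntegrand m A k s v)
      ((Complex.I * v) • oscIntegrand m A k s v η + (k : ℂ) • oscIntegrand m A (k - 1) s v η
        + (2 : ℂ) • oscIntegrand m (fun x => m x • A x) (k + 1) s v η
        + (s : ℂ) • oscIntegrand m (fun x => deriv m x • A x) (k + 2) s v η
        + (s : ℂ) • oscIntegrand m (deriv A) k s v η) η := by
  have hs : HasDerivAt (fun η : ℝ => s * η) s η := by simpa using (hasDerivAt_id η).const_mul s
  have hof : HasDerivAt (fun η : ℝ => (η : ℂ)) 1 η := Complex.ofRealCLM.hasDerivAt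
  have hA' : HasDerivAt (fun η => A (s * η)) (s • deriv A (s * η)) η :=
    (hA.hasDerivAt (s * η)).scomp η hs
  have hm' : HasDerivAt (fun η => m (s * η)) (s • deriv m (s * η)) η :=
    (hm.hasDerivAt (s * η)).scomp η hs
  have h1 : HasDerivAt (fun η : ℝ => Complex.exp (Complex.I * η * v)) _ η :=
    ((hof.const_mul Complex.I).mul_const (v : ℂ)).cexp
  have h2 : HasDerivAt (fun η : ℝ => Complex.exp ((η : ℂ) ^ 2 * m (s * η))) _ η :=
    ((hof.pow 2).mul hm').cexp
  have h := ((h1.mul (hof.pow k)).mul h2).smul hA'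
  refine h.congr_deriv ?_
  simp only [oscIntegrand, smul_smul, ← Complex.coe_smul (s)]
  simp only [Pi.mul_apply, Pi.pow_apply]
  module

/-- Integration by parts for the moments. -/
theorem I_mul_smul_oscMoment [CompleteSpace E] {m : ℝ → ℂ} {θ : ℝ} (hm : IsDiffusivePhase m θ)
    {A : ℝ → E} (hA : IsAmplitude A) (k : ℕ) (s v : ℝ) :
    (Complex.I * v) • oscMoment m A k s v + (k : ℂ) • oscMoment m A (k - 1) s v
        + (2 : ℂ) • oscMoment m (fun x => m x • A x) (k + 1) s v
        + (s : ℂ) • oscMoment m (fun x => deriv m x • A x) (k + 2) s v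
        + (s : ℂ) • oscMoment m (deriv A) k s v = 0 := by
  have i1 := (integrable_oscIntegrand hm hA k s v).smul (Complex.I * v)
  have i2 := (integrable_oscIntegrand hm hA (k - 1) s v).smul (k : ℂ)
  have i3 := (integrable_oscIntegrand hm (hA.smul hm.contDiff) (k + 1) s v).smul (2 : ℂ)
  have i4 := (integrable_oscIntegrand hm (hA.smul hm.contDiff_deriv) (k + 2) s v).smul (s : ℂ)
  have i5 := (integrable_oscIntegrand hm hA.deriv k s v).smul (s : ℂ)
  have h := integral_eq_zero_of_hasDerivAt_of_integrable (hasDerivAt_oscIntegrand hm hA k s v)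
    ((((i1.add i2).add i3).add i4).add i5) (integrable_oscIntegrand hm hA k s v)
  have h' : ∫ η, ((Complex.I * v) • oscIntegrand m A k s v + (k : ℂ) • oscIntegrand m A (k - 1) s v
        + (2 : ℂ) • oscIntegrand m (fun x => m x • A x) (k + 1) s v
        + (s : ℂ) • oscIntegrand m (fun x => deriv m x • A x) (k + 2) s v
        + (s : ℂ) • oscIntegrand m (deriv A) k s v) η = 0 := h
  rw [integral_add' (((i1.add i2).add i3).add i4) i5, integral_add' ((i1.add i2).add i3) i4,
    integral_add' (i1.add i2) i3, integral_add' i1 i2] at h'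
  simp only [Pi.smul_apply, integral_smul] at h'
  exact h'

/-- Each integration by parts gains a power of `v`, uniformly for `0 ≤ s ≤ 1`. -/
theorem exists_abs_pow_mul_norm_oscMoment_le [CompleteSpace E] {m : ℝ → ℂ} {θ : ℝ}
    (hm : IsDiffusivePhase m θ) (n : ℕ) : ∀ {A : ℝ → E} (_ : IsAmplitude A) (k : ℕ),
    ∃ C, 0 ≤ C ∧ ∀ s ∈ Set.Icc (0 : ℝ) 1, ∀ v, |v| ^ n * ‖oscMoment m A k s v‖ ≤ C := by
  induction n with
  | zero =>
    intro A hA k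
    obtain ⟨C, h0, hC⟩ := exists_norm_oscMoment_le hm hA k
    exact ⟨C, h0, fun s _ v => by simpa using hC s v⟩
  | succ n ih =>
    intro A hA k
    obtain ⟨C1, h1, H1⟩ := ih hA (k - 1)
    obtain ⟨C2, h2, H2⟩ := ih (hA.smul hm.contDiff) (k + 1)
    obtain ⟨C3, h3, H3⟩ := ih (hA.smul hm.contDiff_deriv) (k + 2)
    obtain ⟨C4, h4, H4⟩ := ih hA.deriv k
    refine ⟨k * C1 + 2 * C2 + C3 + C4, by positivity, fun s hs v => ?_⟩
    have key := I_mul_smul_oscMoment hm hA k s v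
    set a := oscMoment m A (k - 1) s v
    set b := oscMoment m (fun x => m x • A x) (k + 1) s v
    set c := oscMoment m (fun x => deriv m x • A x) (k + 2) s v
    set d := oscMoment m (deriv A) k s v
    have e : (Complex.I * v) • oscMoment m A k s v
        = -((k : ℂ) • a + (2 : ℂ) • b + (s : ℂ) • c + (s : ℂ) • d) := by
      rw [eq_neg_iff_add_eq_zero, ← key]; abel
    have e2 : |v| * ‖oscMoment m A k s v‖ ≤ k * ‖a‖ + 2 * ‖b‖ + ‖c‖ + ‖d‖ := by
      have : |v| * ‖oscMoment m A k s v‖ = ‖(Complex.I * v) • oscMoment m A k s v‖ := by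
        rw [norm_smul]; simp
      rw [this, e, norm_neg]
      have hs1 : ‖(s : ℂ)‖ ≤ 1 := by
        rw [Complex.norm_real, Real.norm_eq_abs, abs_of_nonneg hs.1]; exact hs.2
      refine (norm_add_le _ _).trans (add_le_add ((norm_add_le _ _).trans (add_le_add
        ((norm_add_le _ _).trans (add_le_add ?_ ?_)) ?_)) ?_)
      · rw [norm_smul]; simp
      · rw [norm_smul]; simp
      · rw [norm_smul]; exact mul_le_of_le_one_left (norm_nonneg _) hs1
      · rw [norm_smul]; exact mul_le_of_le_one_left (norm_nonneg _) hs1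
    calc |v| ^ (n + 1) * ‖oscMoment m A k s v‖ = |v| ^ n * (|v| * ‖oscMoment m A k s v‖) := by ring
      _ ≤ |v| ^ n * (k * ‖a‖ + 2 * ‖b‖ + ‖c‖ + ‖d‖) := by gcongr
      _ = k * (|v| ^ n * ‖a‖) + 2 * (|v| ^ n * ‖b‖) + |v| ^ n * ‖c‖ + |v| ^ n * ‖d‖ := by ring
      _ ≤ _ := by
        gcongr
        · exact H1 s hs v
        · exact H2 s hs v
        · exact H3 s hs v
        · exact H4 s hs v

/-- Differentiation in the rescaling parameter `s`: every factor `η` from the chain rule raises the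
order of the moment. -/
theorem hasDerivAt_oscMoment {m : ℝ → ℂ} {θ : ℝ} (hm : IsDiffusivePhase m θ)
    {A : ℝ → E} (hA : IsAmplitude A) (k : ℕ) (s v : ℝ) :
    HasDerivAt (fun s => oscMoment m A k s v)
      (oscMoment m (fun x => deriv m x • A x) (k + 3) s v + oscMoment m (deriv A) (k + 1) s v) s := by
  have hA1 := hA.smul hm.contDiff_deriv
  obtain ⟨C1, h1, H1⟩ := hA1.bounded
  obtain ⟨C2, h2, H2⟩ := hA.deriv.bounded
  have h := hasDerivAt_integral_of_dominated_loc_of_deriv_le (μ := volume) (𝕜 := ℝ)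
    (F := fun s η => oscIntegrand m A k s v η) (x₀ := s) (s := Set.univ)
    (F' := fun s η => oscIntegrand m (fun x => deriv m x • A x) (k + 3) s v η
      + oscIntegrand m (deriv A) (k + 1) s v η)
    (bound := fun η => C1 * (|η| ^ (k + 3) * Real.exp (-θ * η ^ 2))
      + C2 * (|η| ^ (k + 1) * Real.exp (-θ * η ^ 2)))
    univ_mem
    (Eventually.of_forall fun s => (continuous_oscIntegrand hm hA k s v).aestronglyMeasurable)
    (integrable_oscIntegrand hm hA k s v)
    ((continuous_oscIntegrand hm hA1 (k + 3) s v).add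
      (continuous_oscIntegrand hm hA.deriv (k + 1) s v)).aestronglyMeasurable
    (Eventually.of_forall fun η s _ => (norm_add_le _ _).trans (add_le_add
      (norm_oscIntegrand_le hm H1 _ s v η) (norm_oscIntegrand_le hm H2 _ s v η)))
    (((integrable_abs_pow_mul_exp_neg_mul_sq hm.pos _).const_mul C1).add
      ((integrable_abs_pow_mul_exp_neg_mul_sq hm.pos _).const_mul C2))
    (Eventually.of_forall fun η s _ => ?_)
  · have := h.2
    rwa [integral_add (integrable_oscIntegrand hm hA1 _ s v)
      (integrable_oscIntegrand hm hA.deriv _ s v)] at this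
  · have hs : HasDerivAt (fun s : ℝ => s * η) η s := by simpa using (hasDerivAt_id s).mul_const η
    have hA' : HasDerivAt (fun s => A (s * η)) (η • deriv A (s * η)) s :=
      (hA.hasDerivAt (s * η)).scomp s hs
    have hm' : HasDerivAt (fun s => m (s * η)) (η • deriv m (s * η)) s :=
      (hm.hasDerivAt (s * η)).scomp s hs
    have h2 : HasDerivAt (fun s : ℝ => Complex.exp ((η : ℂ) ^ 2 * m (s * η))) _ s :=
      (hm'.const_mul ((η : ℂ) ^ 2)).cexp
    have h := (h2.const_mul (Complex.exp (Complex.I * η * v) * (η : ℂ) ^ k)).smul hA'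
    refine h.congr_deriv ?_
    simp only [oscIntegrand, smul_smul, ← Complex.coe_smul (η)]
    module

/-- Mean value inequality in `s`: bounds for the two moments in `hasDerivAt_oscMoment` gain a factor
`s` for the difference to `s = 0`. -/
theorem norm_oscMoment_sub_le {m : ℝ → ℂ} {θ : ℝ} (hm : IsDiffusivePhase m θ) {A : ℝ → E}
    (hA : IsAmplitude A) (k : ℕ) {n N : ℕ} {C1 C2 g v : ℝ} (h1 : 0 ≤ C1) (h2 : 0 ≤ C2)
    (H1 : ∀ s ∈ Set.Icc (0 : ℝ) 1, ‖oscMoment m (fun x => deriv m x • A x) (k + 3) s v‖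
      ≤ C1 * (g + s ^ N / (1 + |v|) ^ n))
    (H2 : ∀ s ∈ Set.Icc (0 : ℝ) 1, ‖oscMoment m (deriv A) (k + 1) s v‖
      ≤ C2 * (g + s ^ N / (1 + |v|) ^ n)) {s : ℝ} (hs : s ∈ Set.Icc (0 : ℝ) 1) :
    ‖oscMoment m A k s v - oscMoment m A k 0 v‖
      ≤ (C1 + C2) * (g + s ^ N / (1 + |v|) ^ n) * s := by
  have h := norm_image_sub_le_of_norm_deriv_le_segment' (f := fun s => oscMoment m A k s v)
    (a := 0) (b := s) (C := (C1 + C2) * (g + s ^ N / (1 + |v|) ^ n))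
    (fun x _ => (hasDerivAt_oscMoment hm hA k x v).hasDerivWithinAt)
    (fun x hx => by
      have hx1 : x ∈ Set.Icc (0 : ℝ) 1 := ⟨hx.1, hx.2.le.trans hs.2⟩
      have hx2 : x ^ N ≤ s ^ N := pow_le_pow_left₀ hx.1 hx.2.le N
      refine (norm_add_le _ _).trans ?_
      rw [add_mul]
      refine add_le_add ((H1 x hx1).trans ?_) ((H2 x hx1).trans ?_)
      · gcongr
      · gcongr) s ⟨hs.1, le_rfl⟩
  rwa [sub_zero] at h

theorem oscMoment_zero_smul {m : ℝ → ℂ} (A : ℝ → E) (k : ℕ) (v : ℝ) :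
    oscMoment m (fun x => m x • A x) k 0 v = m 0 • oscMoment m A k 0 v := by
  simp only [oscMoment, oscIntegrand, zero_mul, ← integral_smul]
  congr 1; ext η
  rw [smul_comm]

/-- Powers are absorbed by halving the rate of the Gaussian `e^{-v²/(4b)}`. -/
theorem exists_abs_pow_mul_exp_le {b : ℝ} (hb : 0 < b) (n : ℕ) :
    ∃ C, 0 ≤ C ∧ ∀ v : ℝ, |v| ^ n * Real.exp (-v ^ 2 / (4 * b)) ≤ C * Real.exp (-v ^ 2 / (8 * b)) := by
  refine ⟨1 + (8 * b) ^ n * n.factorial, by positivity, fun v => ?_⟩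
  have h1 : |v| ^ n ≤ 1 + (v ^ 2) ^ n := by
    rcases le_total (|v|) 1 with h | h
    · have := pow_le_one₀ (n := n) (abs_nonneg v) h
      nlinarith [pow_nonneg (sq_nonneg v) n]
    · have : |v| ^ n ≤ (v ^ 2) ^ n := by
        rw [← sq_abs v]
        exact pow_le_pow_left₀ (abs_nonneg v) (by nlinarith) n
      linarith
  have h2 : (v ^ 2 / (8 * b)) ^ n / n.factorial ≤ Real.exp (v ^ 2 / (8 * b)) :=
    Real.pow_div_factorial_le_exp _ (by positivity) n
  have h3 : (v ^ 2) ^ n ≤ (8 * b) ^ n * n.factorial * Real.exp (v ^ 2 / (8 * b)) := by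
    rw [div_pow, div_div, div_le_iff₀ (by positivity)] at h2
    linarith
  have h4 : (1 : ℝ) ≤ Real.exp (v ^ 2 / (8 * b)) := Real.one_le_exp (by positivity)
  have h5 : Real.exp (-v ^ 2 / (8 * b)) = Real.exp (v ^ 2 / (8 * b)) * Real.exp (-v ^ 2 / (4 * b)) := by
    rw [← Real.exp_add]; congr 1; field_simp; ring
  rw [h5, ← mul_assoc]
  gcongr
  calc |v| ^ n ≤ 1 + (v ^ 2) ^ n := h1
    _ ≤ Real.exp (v ^ 2 / (8 * b)) + (8 * b) ^ n * n.factorial * Real.exp (v ^ 2 / (8 * b)) := by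
      gcongr
    _ = _ := by ring

theorem oscMoment_zero_zero {m : ℝ → ℂ} {b : ℝ} (hb : 0 < b) (hm0 : m 0 = -b) (A : ℝ → E)
    (v : ℝ) [CompleteSpace E] : oscMoment m A 0 0 v
      = ((Real.pi / b : ℂ) ^ (1 / 2 : ℂ) * Complex.exp (-v ^ 2 / (4 * b))) • A 0 := by
  have h := fourierIntegral_gaussian (b := (b : ℂ)) (by simpa using hb) v
  rw [← h, ← integral_smul_const]
  simp only [oscMoment, oscIntegrand, zero_mul, hm0]
  congr 1; ext η
  congr 1
  rw [pow_zero, mul_one]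
  congr 2 <;> ring

/-- At `s = 0` the moments are derivatives of a Gaussian. -/
theorem exists_abs_pow_mul_norm_oscMoment_zero_le [CompleteSpace E] {m : ℝ → ℂ} {θ b : ℝ}
    (hm : IsDiffusivePhase m θ) (hb : 0 < b) (hm0 : m 0 = -b) {A : ℝ → E} (hA : IsAmplitude A)
    (k : ℕ) : ∀ n : ℕ, ∃ C, 0 ≤ C ∧ ∀ v,
      |v| ^ n * ‖oscMoment m A k 0 v‖ ≤ C * Real.exp (-v ^ 2 / (8 * b)) := by
  induction k using Nat.strong_induction_on with
  | _ k ih =>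
    intro n
    rcases k with _ | k
    · obtain ⟨C, h0, hC⟩ := exists_abs_pow_mul_exp_le hb n
      refine ⟨‖(Real.pi / b : ℂ) ^ (1 / 2 : ℂ)‖ * ‖A 0‖ * C, by positivity, fun v => ?_⟩
      have hn : ‖Complex.exp (-(v : ℂ) ^ 2 / (4 * b))‖ = Real.exp (-v ^ 2 / (4 * b)) := by
        have : (-(v : ℂ) ^ 2 / (4 * b)) = ((-v ^ 2 / (4 * b) : ℝ) : ℂ) := by push_cast; ring
        rw [this, Complex.norm_exp, Complex.ofReal_re]
      rw [oscMoment_zero_zero hb hm0, norm_smul, norm_mul, hn]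
      calc _ = ‖(Real.pi / b : ℂ) ^ (1 / 2 : ℂ)‖ * ‖A 0‖ * (|v| ^ n * Real.exp (-v ^ 2 / (4 * b))) := by
            ring
        _ ≤ ‖(Real.pi / b : ℂ) ^ (1 / 2 : ℂ)‖ * ‖A 0‖ * (C * Real.exp (-v ^ 2 / (8 * b))) := by
            exact mul_le_mul_of_nonneg_left (hC v) (by positivity)
        _ = _ := by ring
    · obtain ⟨C1, h1, H1⟩ := ih k (by omega) (n + 1)
      obtain ⟨C2, h2, H2⟩ := ih (k - 1) (by omega) n
      refine ⟨(C1 + k * C2) / (2 * b), by positivity, fun v => ?_⟩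
      have key := I_mul_smul_oscMoment hm hA k 0 v
      simp only [Complex.ofReal_zero, zero_smul, add_zero, oscMoment_zero_smul, hm0, smul_smul] at key
      have e : (2 * b : ℂ) • oscMoment m A (k + 1) 0 v
          = (Complex.I * v) • oscMoment m A k 0 v + (k : ℂ) • oscMoment m A (k - 1) 0 v := by
        rw [← sub_eq_zero, ← neg_eq_zero, ← key]; module
      have e2 : 2 * b * ‖oscMoment m A (k + 1) 0 v‖
          ≤ |v| * ‖oscMoment m A k 0 v‖ + k * ‖oscMoment m A (k - 1) 0 v‖ := by
        have := congrArg norm e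
        rw [norm_smul] at this
        have h2b : ‖(2 * b : ℂ)‖ = 2 * b := by simp [abs_of_pos hb]
        rw [h2b] at this
        rw [this]
        refine (norm_add_le _ _).trans (le_of_eq ?_)
        rw [norm_smul, norm_smul]; simp
      rw [div_mul_eq_mul_div, le_div_iff₀ (by positivity)]
      calc |v| ^ n * ‖oscMoment m A (k + 1) 0 v‖ * (2 * b)
          = |v| ^ n * (2 * b * ‖oscMoment m A (k + 1) 0 v‖) := by ring
        _ ≤ |v| ^ n * (|v| * ‖oscMoment m A k 0 v‖ + k * ‖oscMoment m A (k - 1) 0 v‖) := by gcongr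
        _ = |v| ^ (n + 1) * ‖oscMoment m A k 0 v‖ + k * (|v| ^ n * ‖oscMoment m A (k - 1) 0 v‖) := by
            ring
        _ ≤ C1 * Real.exp (-v ^ 2 / (8 * b)) + k * (C2 * Real.exp (-v ^ 2 / (8 * b))) := by
            exact add_le_add (H1 v) (mul_le_mul_of_nonneg_left (H2 v) (by positivity))
        _ = _ := by ring

/-- The moments are Gaussian up to an error of arbitrary order in `s`: the value at `s = 0` is
Gaussian, and by the mean value inequality each step of the induction on `N` gains a factor `s` on
the remainder. -/
theorem exists_norm_oscMoment_le_gaussian_add [CompleteSpace E] {m : ℝ → ℂ} {θ b : ℝ}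
    (hm : IsDiffusivePhase m θ) (hb : 0 < b) (hm0 : m 0 = -b) (n N : ℕ) :
    ∀ {A : ℝ → E} (_ : IsAmplitude A) (k : ℕ), ∃ C, 0 ≤ C ∧ ∀ s ∈ Set.Icc (0 : ℝ) 1, ∀ v,
      ‖oscMoment m A k s v‖ ≤ C * (Real.exp (-v ^ 2 / (8 * b)) + s ^ N / (1 + |v|) ^ n) := by
  induction N with
  | zero =>
    intro A hA k
    obtain ⟨C1, h1, H1⟩ := exists_abs_pow_mul_norm_oscMoment_le hm 0 hA k
    obtain ⟨C2, h2, H2⟩ := exists_abs_pow_mul_norm_oscMoment_le hm n hA k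
    refine ⟨2 ^ (n - 1) * (C1 + C2), by positivity, fun s hs v => ?_⟩
    have h := add_pow_le zero_le_one (abs_nonneg v) n
    have h3 : (1 + |v|) ^ n * ‖oscMoment m A k s v‖ ≤ 2 ^ (n - 1) * (C1 + C2) := by
      calc (1 + |v|) ^ n * ‖oscMoment m A k s v‖
          ≤ 2 ^ (n - 1) * (1 ^ n + |v| ^ n) * ‖oscMoment m A k s v‖ := by gcongr
        _ = 2 ^ (n - 1) * (|v| ^ 0 * ‖oscMoment m A k s v‖ + |v| ^ n * ‖oscMoment m A k s v‖) := by
            ring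
        _ ≤ _ := by
          gcongr
          · exact H1 s hs v
          · exact H2 s hs v
    have h4 : ‖oscMoment m A k s v‖ ≤ 2 ^ (n - 1) * (C1 + C2) * (s ^ 0 / (1 + |v|) ^ n) := by
      rw [pow_zero, mul_one_div, le_div_iff₀ (by positivity), mul_comm]
      exact h3
    refine h4.trans ?_
    gcongr
    linarith [Real.exp_pos (-v ^ 2 / (8 * b))]
  | succ N ih =>
    intro A hA k
    obtain ⟨C0, h0, H0⟩ := exists_abs_pow_mul_norm_oscMoment_zero_le hm hb hm0 hA k 0
    obtain ⟨C1, h1, H1⟩ := ih (hA.smul hm.contDiff_deriv) (k + 3)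
    obtain ⟨C2, h2, H2⟩ := ih hA.deriv (k + 1)
    refine ⟨C0 + (C1 + C2), by positivity, fun s hs v => ?_⟩
    have h := norm_oscMoment_sub_le hm hA k h1 h2 (fun s hs => H1 s hs v) (fun s hs => H2 s hs v) hs
    have h0' := H0 v
    rw [pow_zero, one_mul] at h0'
    have h5 : ‖oscMoment m A k s v‖ ≤ ‖oscMoment m A k 0 v‖
        + ‖oscMoment m A k s v - oscMoment m A k 0 v‖ := by
      simpa using norm_add_le (oscMoment m A k 0 v) (oscMoment m A k s v - oscMoment m A k 0 v)
    have hq : 0 ≤ s ^ N / (1 + |v|) ^ n := div_nonneg (pow_nonneg hs.1 _) (by positivity)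
    have hq' : s ^ (N + 1) / (1 + |v|) ^ n = s ^ N / (1 + |v|) ^ n * s := by ring
    have he := Real.exp_pos (-v ^ 2 / (8 * b))
    rw [hq']
    set e := Real.exp (-v ^ 2 / (8 * b))
    set q := s ^ N / (1 + |v|) ^ n
    have h6 : (C1 + C2) * (e + q) * s ≤ (C1 + C2) * (e + q * s) := by
      rw [mul_assoc]
      gcongr
      nlinarith [hs.1, hs.2]
    calc _ ≤ C0 * e + (C1 + C2) * (e + q * s) := h5.trans (add_le_add h0' (h.trans h6))
      _ ≤ _ := by nlinarith [mul_nonneg h0 (mul_nonneg hq hs.1)]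

/-- The moments converge to their value at `s = 0`, a derivative of a Gaussian, with rate `s`. -/
theorem exists_norm_oscMoment_sub_le [CompleteSpace E] {m : ℝ → ℂ} {θ b : ℝ}
    (hm : IsDiffusivePhase m θ) (hb : 0 < b) (hm0 : m 0 = -b) (n N : ℕ)
    {A : ℝ → E} (hA : IsAmplitude A) (k : ℕ) : ∃ C, 0 ≤ C ∧ ∀ s ∈ Set.Icc (0 : ℝ) 1, ∀ v,
      ‖oscMoment m A k s v - oscMoment m A k 0 v‖
        ≤ C * (Real.exp (-v ^ 2 / (8 * b)) + s ^ N / (1 + |v|) ^ n) * s := by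
  obtain ⟨C1, h1, H1⟩ := exists_norm_oscMoment_le_gaussian_add hm hb hm0 n N
    (hA.smul hm.contDiff_deriv) (k + 3)
  obtain ⟨C2, h2, H2⟩ := exists_norm_oscMoment_le_gaussian_add hm hb hm0 n N hA.deriv (k + 1)
  refine ⟨C1 + C2, by positivity, fun s hs v => ?_⟩
  exact norm_oscMoment_sub_le hm hA k h1 h2 (fun s hs => H1 s hs v) (fun s hs => H2 s hs v) hs

end Oscillatory

/-! ### Kernels in the original variables -/

section Kernel

variable {E : Type*} [NormedAddCommGroup E] [NormedSpace ℂ E]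

/-- The kernel `∫ e^{iξw} e^{t ξ² m(ξ)} A(ξ) dξ`. -/
def oscKernel (m : ℝ → ℂ) (A : ℝ → E) (t w : ℝ) : E :=
  ∫ ξ : ℝ, (Complex.exp (Complex.I * ξ * w) * Complex.exp (t * ((ξ : ℂ) ^ 2 * m ξ))) • A ξ

theorem norm_exp_I_mul_mul (ξ w : ℝ) : ‖Complex.exp (Complex.I * ξ * w)‖ = 1 := by
  rw [Complex.norm_exp]; simp

theorem norm_exp_phase_le {m : ℝ → ℂ} {θ : ℝ} (hm : IsDiffusivePhase m θ) {t : ℝ} (ht : 0 ≤ t)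
    (ξ : ℝ) : ‖Complex.exp (t * ((ξ : ℂ) ^ 2 * m ξ))‖ ≤ 1 := by
  rw [Complex.norm_exp, Real.exp_le_one_iff, ← Complex.ofReal_pow, Complex.re_ofReal_mul,
    Complex.re_ofReal_mul]
  have h1 := hm.re_le ξ
  have h2 := hm.pos
  exact mul_nonpos_of_nonneg_of_nonpos ht
    (mul_nonpos_of_nonneg_of_nonpos (sq_nonneg ξ) (by linarith))

theorem integrable_oscKernel {m : ℝ → ℂ} {θ : ℝ} (hm : IsDiffusivePhase m θ) {A : ℝ → E}
    (hA : IsAmplitude A) (t w : ℝ) : Integrable fun ξ : ℝ =>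
      (Complex.exp (Complex.I * ξ * w) * Complex.exp (t * ((ξ : ℂ) ^ 2 * m ξ))) • A ξ := by
  have h1 := hm.contDiff.continuous
  have h2 := hA.contDiff.continuous
  refine Continuous.integrable_of_hasCompactSupport (by fun_prop) hA.compact.smul_left

theorem IsDiffusivePhase.contDiff_phase {m : ℝ → ℂ} {θ : ℝ} (hm : IsDiffusivePhase m θ) :
    ContDiff ℝ ∞ (fun ξ : ℝ => (ξ : ℂ) ^ 2 * m ξ) :=
  (Complex.ofRealCLM.contDiff.pow 2).mul hm.contDiff

/-- Integration by parts in `ξ`, without rescaling. -/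
theorem I_mul_smul_oscKernel [CompleteSpace E] {m : ℝ → ℂ} {θ : ℝ} (hm : IsDiffusivePhase m θ)
    {A : ℝ → E} (hA : IsAmplitude A) (t w : ℝ) :
    (Complex.I * w) • oscKernel m A t w
      + (t : ℂ) • oscKernel m (fun ξ => deriv (fun ξ : ℝ => (ξ : ℂ) ^ 2 * m ξ) ξ • A ξ) t w
      + oscKernel m (deriv A) t w = 0 := by
  have hp := hm.contDiff_phase
  have hp' : ContDiff ℝ ∞ (deriv (fun ξ : ℝ => (ξ : ℂ) ^ 2 * m ξ)) :=
    ((contDiff_infty_iff_deriv (F := ℂ)).1 hp).2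
  have i1 := (integrable_oscKernel hm hA t w).smul (Complex.I * w)
  have i2 := (integrable_oscKernel hm (hA.smul hp') t w).smul (t : ℂ)
  have i3 := integrable_oscKernel hm hA.deriv t w
  have h := integral_eq_zero_of_hasDerivAt_of_integrable (fun ξ => ?_)
    ((i1.add i2).add i3) (integrable_oscKernel hm hA t w)
  · rw [integral_add' (i1.add i2) i3, integral_add' i1 i2] at h
    simp only [Pi.smul_apply, integral_smul] at h
    exact h
  · have hof : HasDerivAt (fun η : ℝ => (η : ℂ)) 1 ξ := Complex.ofRealCLM.hasDerivAt
    have h1 : HasDerivAt (fun η : ℝ => Complex.exp (Complex.I * η * w)) _ ξ :=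
      ((hof.const_mul Complex.I).mul_const (w : ℂ)).cexp
    have h2 : HasDerivAt (fun η : ℝ => Complex.exp (t * ((η : ℂ) ^ 2 * m η))) _ ξ :=
      (((hp.differentiable (by simp)).differentiableAt.hasDerivAt (x := ξ)).const_mul (t : ℂ)).cexp
    have h := (h1.mul h2).smul (hA.hasDerivAt ξ)
    refine h.congr_deriv ?_
    simp only [Pi.add_apply, Pi.smul_apply, smul_smul]
    simp only [Pi.mul_apply]
    module

theorem exists_abs_pow_mul_norm_oscKernel_le [CompleteSpace E] {m : ℝ → ℂ} {θ : ℝ}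
    (hm : IsDiffusivePhase m θ) (n : ℕ) : ∀ {A : ℝ → E} (_ : IsAmplitude A),
    ∃ C, 0 ≤ C ∧ ∀ t ∈ Set.Icc (0 : ℝ) 1, ∀ w, |w| ^ n * ‖oscKernel m A t w‖ ≤ C := by
  induction n with
  | zero =>
    intro A hA
    refine ⟨∫ ξ, ‖A ξ‖, integral_nonneg fun _ => norm_nonneg _, fun t ht w => ?_⟩
    rw [pow_zero, one_mul]
    refine norm_integral_le_of_norm_le
      (hA.contDiff.continuous.integrable_of_hasCompactSupport hA.compact).norm
      (Eventually.of_forall fun ξ => ?_)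
    rw [norm_smul, norm_mul, norm_exp_I_mul_mul, one_mul]
    exact mul_le_of_le_one_left (norm_nonneg _) (norm_exp_phase_le hm ht.1 ξ)
  | succ n ih =>
    intro A hA
    have hp' : ContDiff ℝ ∞ (deriv (fun ξ : ℝ => (ξ : ℂ) ^ 2 * m ξ)) :=
      ((contDiff_infty_iff_deriv (F := ℂ)).1 hm.contDiff_phase).2
    obtain ⟨C1, h1, H1⟩ := ih (hA.smul hp')
    obtain ⟨C2, h2, H2⟩ := ih hA.deriv
    refine ⟨C1 + C2, by positivity, fun t ht w => ?_⟩
    have key := I_mul_smul_oscKernel hm hA t w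
    set a := oscKernel m (fun ξ => deriv (fun ξ : ℝ => (ξ : ℂ) ^ 2 * m ξ) ξ • A ξ) t w
    set b := oscKernel m (deriv A) t w
    have e : (Complex.I * w) • oscKernel m A t w = -((t : ℂ) • a + b) := by
      rw [eq_neg_iff_add_eq_zero, ← key]; abel
    have e2 : |w| * ‖oscKernel m A t w‖ ≤ ‖a‖ + ‖b‖ := by
      have : |w| * ‖oscKernel m A t w‖ = ‖(Complex.I * w) • oscKernel m A t w‖ := by
        rw [norm_smul]; simp
      rw [this, e, norm_neg]
      have hs1 : ‖(t : ℂ)‖ ≤ 1 := by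
        rw [Complex.norm_real, Real.norm_eq_abs, abs_of_nonneg ht.1]; exact ht.2
      refine (norm_add_le _ _).trans (add_le_add ?_ le_rfl)
      rw [norm_smul]; exact mul_le_of_le_one_left (norm_nonneg _) hs1
    calc |w| ^ (n + 1) * ‖oscKernel m A t w‖ = |w| ^ n * (|w| * ‖oscKernel m A t w‖) := by ring
      _ ≤ |w| ^ n * (‖a‖ + ‖b‖) := by gcongr
      _ = |w| ^ n * ‖a‖ + |w| ^ n * ‖b‖ := by ring
      _ ≤ _ := add_le_add (H1 t ht w) (H2 t ht w)

/-- For short times there is no diffusive scaling: the symbol `e^{tξ²m} A` is bounded in every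
`C^k` norm, so the kernel decays at every algebraic rate. -/
theorem exists_norm_oscKernel_le_of_le_one [CompleteSpace E] {m : ℝ → ℂ} {θ : ℝ}
    (hm : IsDiffusivePhase m θ) (n : ℕ) {A : ℝ → E} (hA : IsAmplitude A) :
    ∃ C, 0 ≤ C ∧ ∀ t ∈ Set.Icc (0 : ℝ) 1, ∀ w, ‖oscKernel m A t w‖ ≤ C / (1 + |w| + √t) ^ n := by
  obtain ⟨C1, h1, H1⟩ := exists_abs_pow_mul_norm_oscKernel_le hm 0 hA
  obtain ⟨C2, h2, H2⟩ := exists_abs_pow_mul_norm_oscKernel_le hm n hA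
  refine ⟨2 ^ (n - 1) * (2 ^ n * C1 + C2), by positivity, fun t ht w => ?_⟩
  have hst : √t ≤ 1 := Real.sqrt_le_one.2 ht.2
  rw [le_div_iff₀ (by positivity)]
  have h := add_pow_le zero_le_two (abs_nonneg w) n
  calc ‖oscKernel m A t w‖ * (1 + |w| + √t) ^ n
      ≤ ‖oscKernel m A t w‖ * (2 + |w|) ^ n :=
        mul_le_mul_of_nonneg_left (pow_le_pow_left₀ (by positivity) (by linarith) n)
          (norm_nonneg _)
    _ ≤ ‖oscKernel m A t w‖ * (2 ^ (n - 1) * (2 ^ n + |w| ^ n)) := by gcongr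
    _ = 2 ^ (n - 1) * (2 ^ n * (|w| ^ 0 * ‖oscKernel m A t w‖) + |w| ^ n * ‖oscKernel m A t w‖) := by
      ring
    _ ≤ _ := by
      gcongr
      · exact H1 t ht w
      · exact H2 t ht w

/-- The diffusive rescaling. -/
theorem oscKernel_eq_smul_oscMoment (m : ℝ → ℂ) (A : ℝ → E) {t : ℝ} (ht : 0 < t) (w : ℝ) :
    oscKernel m A t w = (√t)⁻¹ • oscMoment m A 0 (√t)⁻¹ ((√t)⁻¹ * w) := by
  have hst : 0 < √t := Real.sqrt_pos.2 ht
  have h := Measure.integral_comp_mul_left (fun ξ : ℝ =>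
    (Complex.exp (Complex.I * ξ * w) * Complex.exp (t * ((ξ : ℂ) ^ 2 * m ξ))) • A ξ) (√t)⁻¹
  rw [inv_inv, abs_of_pos hst] at h
  have h2 : oscKernel m A t w = (√t)⁻¹ • (√t • oscKernel m A t w) := by
    rw [smul_smul, inv_mul_cancel₀ hst.ne', one_smul]
  rw [h2, oscKernel, ← h, oscMoment]
  congr 2; ext η
  rw [oscIntegrand, pow_zero, mul_one]
  have hsq : (t : ℂ) * ((√t : ℝ) : ℂ)⁻¹ ^ 2 = 1 := by
    rw [← Complex.ofReal_inv, ← Complex.ofReal_pow, ← Complex.ofReal_mul]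
    norm_cast
    rw [inv_pow, Real.sq_sqrt ht.le, mul_inv_cancel₀ ht.ne']
  congr 3
  · push_cast; ring
  · push_cast
    linear_combination ((η : ℂ) ^ 2 * m ((√t)⁻¹ * η)) * hsq

/-- The bound `(1+|w|+√t)^{-n} + t^{-1/2} e^{-w²/(8bt)}`. -/
def kernelProfile (b : ℝ) (n : ℕ) (t w : ℝ) : ℝ :=
  1 / (1 + |w| + √t) ^ n + (√t)⁻¹ * Real.exp (-w ^ 2 / (8 * b * t))

theorem kernelProfile_nonneg (b : ℝ) (n : ℕ) (t w : ℝ) : 0 ≤ kernelProfile b n t w := by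
  unfold kernelProfile; positivity

/-- The factor gained by rescaling the algebraic remainder back to the original variables. -/
theorem rescaled_remainder_le {t : ℝ} (ht : 1 ≤ t) (n : ℕ) (w : ℝ) :
    (√t)⁻¹ ^ n / (1 + |(√t)⁻¹ * w|) ^ n ≤ 2 ^ n / (1 + |w| + √t) ^ n := by
  have hst : 1 ≤ √t := Real.one_le_sqrt.2 ht
  have hst0 : 0 < √t := by linarith
  rw [← div_pow, ← div_pow]
  refine pow_le_pow_left₀ (by positivity) ?_ n
  rw [abs_mul, abs_of_pos (inv_pos.2 hst0)]
  have : (√t)⁻¹ / (1 + (√t)⁻¹ * |w|) = 1 / (√t + |w|) := by field_simp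
  rw [this, div_le_div_iff₀ (by positivity) (by positivity)]
  linarith [abs_nonneg w]

theorem rescaled_gaussian {b t : ℝ} (ht : 0 < t) (w : ℝ) :
    Real.exp (-((√t)⁻¹ * w) ^ 2 / (8 * b)) = Real.exp (-w ^ 2 / (8 * b * t)) := by
  congr 1
  rw [mul_pow, inv_pow, Real.sq_sqrt ht.le, ← neg_div', ← neg_div', neg_inj]
  rw [inv_mul_eq_div, div_div, mul_comm t]

theorem inv_sqrt_mem {t : ℝ} (ht : 1 ≤ t) : (√t)⁻¹ ∈ Set.Icc (0 : ℝ) 1 :=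
  ⟨by positivity, inv_le_one_of_one_le₀ (Real.one_le_sqrt.2 ht)⟩

/-- Kernels with a smooth compactly supported amplitude decay like the heat kernel, up to an
algebraic error of arbitrarily high order. -/
theorem exists_norm_oscKernel_le [CompleteSpace E] {m : ℝ → ℂ} {θ b : ℝ}
    (hm : IsDiffusivePhase m θ) (hb : 0 < b) (hm0 : m 0 = -b) (n : ℕ)
    {A : ℝ → E} (hA : IsAmplitude A) : ∃ C, 0 ≤ C ∧ ∀ t, 0 < t → ∀ w,
      ‖oscKernel m A t w‖ ≤ C * kernelProfile b (n + 1) t w := by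
  obtain ⟨C1, h1, H1⟩ := exists_norm_oscKernel_le_of_le_one hm (n + 1) hA
  obtain ⟨C2, h2, H2⟩ := exists_norm_oscMoment_le_gaussian_add hm hb hm0 (n + 1) n hA 0
  refine ⟨C1 + 2 ^ (n + 1) * C2, by positivity, fun t ht w => ?_⟩
  rcases le_total t 1 with h | h
  · have h3 := H1 t ⟨ht.le, h⟩ w
    have h4 : C1 / (1 + |w| + √t) ^ (n + 1) ≤ C1 * kernelProfile b (n + 1) t w := by
      rw [kernelProfile, mul_add, mul_one_div]
      exact le_add_of_nonneg_right (by positivity)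
    have h5 := kernelProfile_nonneg b (n + 1) t w
    refine (h3.trans h4).trans ?_
    gcongr
    exact le_add_of_nonneg_right (by positivity)
  · have h3 := H2 _ (inv_sqrt_mem h) ((√t)⁻¹ * w)
    rw [rescaled_gaussian ht] at h3
    rw [oscKernel_eq_smul_oscMoment m A ht, norm_smul, Real.norm_eq_abs, abs_of_nonneg (by positivity)]
    have h4 := rescaled_remainder_le h (n + 1) w
    have h6 : (1 : ℝ) ≤ 2 ^ (n + 1) := one_le_pow₀ one_le_two
    set g := Real.exp (-w ^ 2 / (8 * b * t))
    have hg : 0 < g := Real.exp_pos _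
    have hst : 0 < (√t)⁻¹ := by positivity
    calc _ ≤ (√t)⁻¹ * (C2 * (g + (√t)⁻¹ ^ n / (1 + |(√t)⁻¹ * w|) ^ (n + 1))) := by gcongr
      _ = C2 * ((√t)⁻¹ ^ (n + 1) / (1 + |(√t)⁻¹ * w|) ^ (n + 1) + (√t)⁻¹ * g) := by ring
      _ ≤ C2 * (2 ^ (n + 1) / (1 + |w| + √t) ^ (n + 1) + 2 ^ (n + 1) * ((√t)⁻¹ * g)) := by
        exact mul_le_mul_of_nonneg_left (add_le_add h4
          (le_mul_of_one_le_left (by positivity) h6)) h2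
      _ = 2 ^ (n + 1) * C2 * kernelProfile b (n + 1) t w := by
        rw [kernelProfile]; ring
      _ ≤ _ := by
        gcongr
        · exact kernelProfile_nonneg ..
        · linarith

/-! ### Comparison with the Gaussian kernel -/

/-- The Gaussian kernel `∫ e^{iξw} e^{-btξ²} dξ`. -/
def gaussKernel (b t w : ℝ) : ℂ := oscKernel (fun _ => (-b : ℂ)) (fun _ => (1 : ℂ)) t w

theorem gaussKernel_eq_smul_oscMoment {m : ℝ → ℂ} {b : ℝ} (hm0 : m 0 = -b) {A : ℝ → ℂ}
    (hA0 : A 0 = 1) {t : ℝ} (ht : 0 < t) (w : ℝ) :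
    gaussKernel b t w = (√t)⁻¹ • oscMoment m A 0 0 ((√t)⁻¹ * w) := by
  rw [gaussKernel, oscKernel_eq_smul_oscMoment _ _ ht]
  simp only [oscMoment, oscIntegrand, zero_mul, hm0, hA0]

theorem integrable_gaussKernel_integrand {b t : ℝ} (hb : 0 < b) (ht : 0 < t) :
    Integrable fun ξ : ℝ => Complex.exp (t * ((ξ : ℂ) ^ 2 * (-b : ℂ))) • (1 : ℂ) := by
  have h := integrable_cexp_neg_mul_sq (b := ((b * t : ℝ) : ℂ)) (by
    rw [Complex.ofReal_re]; positivity)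
  refine h.congr (Eventually.of_forall fun ξ => ?_)
  simp only [smul_eq_mul, mul_one]
  congr 1; push_cast; ring

theorem continuous_integral_exp_smul {g : ℝ → E} (hg : Integrable g) :
    Continuous fun w : ℝ => ∫ ξ : ℝ, Complex.exp (Complex.I * ξ * w) • g ξ := by
  refine continuous_of_dominated (bound := fun ξ => ‖g ξ‖) (fun w => ?_) (fun w => ?_) hg.norm ?_
  · exact (Continuous.aestronglyMeasurable (by fun_prop)).smul hg.aestronglyMeasurable
  · exact Eventually.of_forall fun ξ => by rw [norm_smul, norm_exp_I_mul_mul, one_mul]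
  · exact Eventually.of_forall fun ξ => by fun_prop

/-- Fourier inversion at the origin. -/
theorem integral_integral_exp_smul {g : ℝ → ℂ} (hg : Integrable g) (hc : Continuous g)
    (hi : Integrable fun w : ℝ => ∫ ξ : ℝ, Complex.exp (Complex.I * ξ * w) • g ξ) :
    ∫ w : ℝ, ∫ ξ : ℝ, Complex.exp (Complex.I * ξ * w) • g ξ = (2 * Real.pi : ℝ) • g 0 := by
  have hpi : (0 : ℝ) < 2 * Real.pi := by positivity
  set k : ℝ → ℂ := fun w => ∫ ξ : ℝ, Complex.exp (Complex.I * ξ * w) • g ξ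
  have h1 : FourierTransformInv.fourierInv g = fun w => k (2 * Real.pi * w) := by
    ext w
    rw [Real.fourierInv_eq']
    simp only [k]
    congr 1; ext ξ
    congr 2
    simp only [RCLike.inner_apply, conj_trivial]
    push_cast; ring
  have h2 : Integrable (FourierTransformInv.fourierInv g) := by
    rw [h1]; exact hi.comp_mul_left' hpi.ne'
  have h2' : Integrable (FourierTransform.fourier g) := by
    have : FourierTransform.fourier g = fun w => FourierTransformInv.fourierInv g (-w) := by
      ext w; rw [Real.fourierInv_eq_fourier_neg, neg_neg]
    rw [this]; exact h2.comp_neg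
  have h3 := hc.fourier_fourierInv_eq hg h2'
  have h4 := congrFun h3 0
  rw [Real.fourier_eq'] at h4
  simp only [inner_zero_right, mul_zero, Complex.ofReal_zero, zero_mul, Complex.exp_zero,
    one_smul] at h4
  rw [h1, Measure.integral_comp_mul_left, abs_of_pos (inv_pos.2 hpi)] at h4
  rw [← h4, smul_smul, mul_inv_cancel₀ hpi.ne', one_smul]

/-- A continuous integrable function of total mass zero has a primitive that is bounded by its
tails. -/
theorem exists_primitive_le_tail {k : ℝ → ℂ} (hc : Continuous k) (hi : Integrable k)
    (h0 : ∫ w, k w = 0) {B : ℝ → ℝ} (hB : ∀ w, ‖k w‖ ≤ B |w|)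
    (hBi : ∀ w, 0 ≤ w → IntegrableOn B (Set.Ioi w)) :
    ∃ Γ : ℝ → ℂ, (∀ w, HasDerivAt Γ (k w) w) ∧ ∀ w, ‖Γ w‖ ≤ ∫ y in Set.Ioi |w|, B y := by
  refine ⟨fun w => ∫ y in Set.Iic w, k y, fun w => ?_, fun w => ?_⟩
  · have h1 : (fun w => ∫ y in Set.Iic w, k y)
        = fun w => (∫ y in (0 : ℝ)..w, k y) + ∫ y in Set.Iic 0, k y := by
      ext w
      rw [← intervalIntegral.integral_Iic_sub_Iic hi.integrableOn hi.integrableOn, sub_add_cancel]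
    rw [h1]
    exact (intervalIntegral.integral_hasDerivAt_right (hc.intervalIntegrable _ _)
      (hc.stronglyMeasurableAtFilter _ _) hc.continuousAt).add_const _
  · rcases le_total w 0 with h | h
    · have e : ∫ y in Set.Iic w, k y = ∫ y in Set.Ioi (-w), k (-y) := by
        rw [integral_comp_neg_Ioi, neg_neg]
      dsimp only
      rw [e, abs_of_nonpos h]
      refine norm_integral_le_of_norm_le (hBi _ (by linarith)) ?_
      refine (ae_restrict_mem measurableSet_Ioi).mono fun y hy => ?_
      have := hB (-y)
      rwa [abs_neg, abs_of_pos (lt_of_le_of_lt (by linarith) hy)] at this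
    · have e : ∫ y in Set.Iic w, k y = -∫ y in Set.Ioi w, k y := by
        rw [eq_neg_iff_add_eq_zero, intervalIntegral.integral_Iic_add_Ioi hi.integrableOn
          hi.integrableOn, h0]
      dsimp only
      rw [e, abs_of_nonneg h, norm_neg]
      refine norm_integral_le_of_norm_le (hBi _ h) ?_
      refine (ae_restrict_mem measurableSet_Ioi).mono fun y hy => ?_
      have := hB y
      rwa [abs_of_pos (lt_of_le_of_lt h hy)] at this

theorem integrableOn_Ioi_one_div_pow {t w : ℝ} (hw : 0 ≤ w) (n : ℕ) :
    IntegrableOn (fun y => 1 / (1 + y + √t) ^ (n + 2)) (Set.Ioi w) ∧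
      ∫ y in Set.Ioi w, 1 / (1 + y + √t) ^ (n + 2) = 1 / (n + 1) * (1 / (1 + w + √t) ^ (n + 1)) := by
  have hst := Real.sqrt_nonneg t
  have hd : ∀ y ∈ Set.Ici w, HasDerivAt
      (fun y => -(1 / ((n : ℝ) + 1) * (1 / (1 + y + √t) ^ (n + 1)))) (1 / (1 + y + √t) ^ (n + 2)) y := by
    intro y hy
    have hy' : 0 ≤ y := hw.trans hy
    have h1 : HasDerivAt (fun y => 1 + y + √t) 1 y := ((hasDerivAt_id y).const_add 1).add_const _
    have h2 := (((h1.pow (n + 1)).inv (pow_ne_zero _ (by positivity))).const_mul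
      (1 / ((n : ℝ) + 1))).neg
    refine (h2.congr_of_eventuallyEq (Eventually.of_forall fun z => by simp)).congr_deriv ?_
    have : 0 < 1 + y + √t := by positivity
    simp only [Pi.pow_apply, Nat.add_sub_cancel]
    field_simp
    push_cast
    ring
  have hpos : ∀ y ∈ Set.Ioi w, 0 ≤ 1 / (1 + y + √t) ^ (n + 2) := fun y hy => by
    have hy' : 0 ≤ y := hw.trans (le_of_lt hy)
    positivity
  have hlim : Tendsto (fun y => -(1 / ((n : ℝ) + 1) * (1 / (1 + y + √t) ^ (n + 1)))) atTop (𝓝 0) := by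
    have h1 : Tendsto (fun y => (1 + y + √t) ^ (n + 1)) atTop atTop :=
      (tendsto_pow_atTop (Nat.succ_ne_zero n)).comp
        (tendsto_atTop_add_const_right _ _ (tendsto_atTop_add_const_left _ _ tendsto_id))
    have h2 := (h1.inv_tendsto_atTop.const_mul (1 / ((n : ℝ) + 1))).neg
    simp only [mul_zero, neg_zero] at h2
    exact h2.congr fun y => by simp
  refine ⟨integrableOn_Ioi_deriv_of_nonneg' hd hpos hlim, ?_⟩
  rw [integral_Ioi_of_hasDerivAt_of_nonneg' hd hpos hlim]
  ring

theorem integrable_exp_neg_sq_div {a : ℝ} (ha : 0 < a) :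
    Integrable fun y : ℝ => Real.exp (-y ^ 2 / a) := by
  refine (integrable_exp_neg_mul_sq (inv_pos.2 ha)).congr (Eventually.of_forall fun y => ?_)
  dsimp only; congr 1; ring

theorem integral_exp_neg_sq_div {a : ℝ} :
    ∫ y : ℝ, Real.exp (-y ^ 2 / a) = √(Real.pi * a) := by
  have h := integral_gaussian a⁻¹
  rw [div_inv_eq_mul] at h
  rw [← h]
  congr 1; ext y; congr 1; ring

theorem integral_Ioi_exp_neg_sq_div_le {a w : ℝ} (ha : 0 < a) (hw : 0 ≤ w) :
    ∫ y in Set.Ioi w, Real.exp (-y ^ 2 / a) ≤ √(Real.pi * a) * Real.exp (-w ^ 2 / a) := by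
  have hi := integrable_exp_neg_sq_div ha
  have h1 : ∫ y in Set.Ioi w, Real.exp (-y ^ 2 / a)
      ≤ ∫ y in Set.Ioi w, Real.exp (-(y - w) ^ 2 / a) * Real.exp (-w ^ 2 / a) := by
    refine setIntegral_mono_on hi.integrableOn
      ((hi.comp_sub_right w).mul_const _).integrableOn measurableSet_Ioi fun y hy => ?_
    rw [← Real.exp_add]
    apply Real.exp_le_exp.2
    rw [← add_div]
    have hy' : w ≤ y := le_of_lt hy
    gcongr
    nlinarith
  refine h1.trans ?_
  have h2 := setIntegral_le_integral ((hi.comp_sub_right w).mul_const (Real.exp (-w ^ 2 / a)))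
    (s := Set.Ioi w) (Eventually.of_forall fun y => by positivity)
  refine h2.trans (le_of_eq ?_)
  rw [integral_mul_const, integral_sub_right_eq_self (fun y => Real.exp (-y ^ 2 / a)) w,
    integral_exp_neg_sq_div]

theorem one_div_pow_le_inv_one_add_sq (n : ℕ) (t w : ℝ) :
    1 / (1 + |w| + √t) ^ (n + 2) ≤ (1 + w ^ 2)⁻¹ := by
  have hst := Real.sqrt_nonneg t
  have hw := abs_nonneg w
  rw [← one_div]
  gcongr
  calc 1 + w ^ 2 ≤ (1 + |w|) ^ 2 := by nlinarith [sq_abs w]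
    _ ≤ (1 + |w| + √t) ^ 2 := pow_le_pow_left₀ (by positivity) (le_add_of_nonneg_right hst) 2
    _ ≤ (1 + |w| + √t) ^ (n + 2) := pow_le_pow_right₀ (by linarith) (by omega)

theorem integrable_one_div_pow (n : ℕ) (t : ℝ) :
    Integrable fun w : ℝ => 1 / (1 + |w| + √t) ^ (n + 2) := by
  refine integrable_inv_one_add_sq.mono' ?_ (Eventually.of_forall fun w => ?_)
  · refine (Continuous.div continuous_const (by fun_prop) fun w => ?_).aestronglyMeasurable
    positivity
  · rw [Real.norm_eq_abs, abs_of_nonneg (by positivity)]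
    exact one_div_pow_le_inv_one_add_sq n t w

theorem integrable_kernelProfile {b : ℝ} (hb : 0 < b) (n : ℕ) {t : ℝ} (ht : 0 < t) :
    Integrable (kernelProfile b (n + 2) t) :=
  (integrable_one_div_pow n t).add
    (((integrable_exp_neg_sq_div (a := 8 * b * t) (by positivity))).const_mul _)

theorem integrable_exp_phase_smul {m : ℝ → ℂ} {θ : ℝ} (hm : IsDiffusivePhase m θ) {A : ℝ → E}
    (hA : IsAmplitude A) (t : ℝ) :
    Integrable fun ξ : ℝ => Complex.exp (t * ((ξ : ℂ) ^ 2 * m ξ)) • A ξ := by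
  have h1 := hm.contDiff.continuous
  have h2 := hA.contDiff.continuous
  exact Continuous.integrable_of_hasCompactSupport (by fun_prop) hA.compact.smul_left

theorem continuous_oscKernel {m : ℝ → ℂ} {θ : ℝ} (hm : IsDiffusivePhase m θ) {A : ℝ → E}
    (hA : IsAmplitude A) (t : ℝ) : Continuous (oscKernel m A t) := by
  refine (continuous_integral_exp_smul (integrable_exp_phase_smul hm hA t)).congr fun w => ?_
  simp only [oscKernel, smul_smul]

theorem integrable_oscKernel_right [CompleteSpace E] {m : ℝ → ℂ} {θ b : ℝ}
    (hm : IsDiffusivePhase m θ) (hb : 0 < b) (hm0 : m 0 = -b)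
    {A : ℝ → E} (hA : IsAmplitude A) {t : ℝ} (ht : 0 < t) : Integrable (oscKernel m A t) := by
  obtain ⟨C, -, hC⟩ := exists_norm_oscKernel_le hm hb hm0 1 hA
  exact ((integrable_kernelProfile hb 0 ht).const_mul C).mono'
    (continuous_oscKernel hm hA t).aestronglyMeasurable (Eventually.of_forall (hC t ht))

theorem continuous_gaussKernel {b t : ℝ} (hb : 0 < b) (ht : 0 < t) :
    Continuous (gaussKernel b t) := by
  refine (continuous_integral_exp_smul (integrable_gaussKernel_integrand hb ht)).congr fun w => ?_
  simp only [gaussKernel, oscKernel, smul_smul]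

theorem exists_norm_gaussKernel_le {b : ℝ} (hb : 0 < b) : ∃ C, 0 ≤ C ∧ ∀ t, 0 < t → ∀ w,
    ‖gaussKernel b t w‖ ≤ C * ((√t)⁻¹ * Real.exp (-w ^ 2 / (8 * b * t))) := by
  obtain ⟨C, h0, hC⟩ := exists_abs_pow_mul_exp_le hb 0
  refine ⟨‖(Real.pi / b : ℂ) ^ (1 / 2 : ℂ)‖ * C, by positivity, fun t ht w => ?_⟩
  rw [gaussKernel_eq_smul_oscMoment (m := fun _ => (-b : ℂ)) (A := fun _ => 1) rfl rfl ht,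
    oscMoment_zero_zero hb rfl, ← rescaled_gaussian ht]
  have h := hC ((√t)⁻¹ * w)
  rw [pow_zero, one_mul] at h
  set v := (√t)⁻¹ * w
  have hn : ‖Complex.exp (-(v : ℂ) ^ 2 / (4 * b))‖ = Real.exp (-v ^ 2 / (4 * b)) := by
    have : (-(v : ℂ) ^ 2 / (4 * b)) = ((-v ^ 2 / (4 * b) : ℝ) : ℂ) := by push_cast; ring
    rw [this, Complex.norm_exp, Complex.ofReal_re]
  rw [norm_smul, norm_smul, norm_mul, hn, Real.norm_eq_abs, abs_of_nonneg (by positivity : 0 ≤ (√t)⁻¹),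
    norm_one, mul_one]
  calc _ ≤ (√t)⁻¹ * (‖(Real.pi / b : ℂ) ^ (1 / 2 : ℂ)‖ * (C * Real.exp (-v ^ 2 / (8 * b)))) := by
        gcongr
    _ = _ := by ring

theorem integrable_gaussKernel {b t : ℝ} (hb : 0 < b) (ht : 0 < t) :
    Integrable (gaussKernel b t) := by
  obtain ⟨C, -, hC⟩ := exists_norm_gaussKernel_le hb
  exact (((integrable_exp_neg_sq_div (a := 8 * b * t) (by positivity)).const_mul _).const_mul C).mono'
    (continuous_gaussKernel hb ht).aestronglyMeasurable (Eventually.of_forall (hC t ht))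

/-- The difference of the critical kernel and its Gaussian limit gains a factor `t^{-1/2}` for
large times. -/
theorem exists_norm_oscKernel_sub_gaussKernel_le {m : ℝ → ℂ} {θ b : ℝ}
    (hm : IsDiffusivePhase m θ) (hb : 0 < b) (hm0 : m 0 = -b) (n : ℕ)
    {A : ℝ → ℂ} (hA : IsAmplitude A) (hA0 : A 0 = 1) : ∃ C, 0 ≤ C ∧ ∀ t, 0 < t → ∀ w,
      ‖oscKernel m A t w - gaussKernel b t w‖ ≤ C * (1 / (1 + |w| + √t) ^ (n + 2)
        + min 1 (√t)⁻¹ * (√t)⁻¹ * Real.exp (-w ^ 2 / (8 * b * t))) := by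
  obtain ⟨C1, h1, H1⟩ := exists_norm_oscKernel_le_of_le_one hm (n + 2) hA
  obtain ⟨C2, h2, H2⟩ := exists_norm_oscMoment_sub_le hm hb hm0 (n + 2) n hA 0
  obtain ⟨C3, h3, H3⟩ := exists_norm_gaussKernel_le hb
  refine ⟨C1 + C3 + 2 ^ (n + 2) * C2, by positivity, fun t ht w => ?_⟩
  have hst : 0 < (√t)⁻¹ := by positivity
  rcases le_total t 1 with h | h
  · have h4 := H1 t ⟨ht.le, h⟩ w
    have h5 := H3 t ht w
    have hmin : min 1 (√t)⁻¹ = 1 :=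
      min_eq_left (one_le_inv₀ (Real.sqrt_pos.2 ht) |>.2 (Real.sqrt_le_one.2 h))
    rw [hmin, one_mul]
    set g := (√t)⁻¹ * Real.exp (-w ^ 2 / (8 * b * t))
    set p := 1 / (1 + |w| + √t) ^ (n + 2) with hp
    have hg : 0 < g := by positivity
    have hp0 : 0 < p := by positivity
    have h6 : C1 / (1 + |w| + √t) ^ (n + 2) = C1 * p := by rw [hp, mul_one_div]
    rw [h6] at h4
    refine (norm_sub_le _ _).trans ((add_le_add h4 h5).trans ?_)
    have : 0 ≤ (2 : ℝ) ^ (n + 2) * C2 := by positivity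
    nlinarith [mul_nonneg h1 hg.le, mul_nonneg h3 hp0.le, mul_nonneg this hg.le,
      mul_nonneg this hp0.le]
  · have hmin : min 1 (√t)⁻¹ = (√t)⁻¹ := min_eq_right (inv_sqrt_mem h).2
    have h4 := H2 _ (inv_sqrt_mem h) ((√t)⁻¹ * w)
    rw [rescaled_gaussian ht] at h4
    rw [oscKernel_eq_smul_oscMoment m A ht, gaussKernel_eq_smul_oscMoment hm0 hA0 ht, ← smul_sub,
      norm_smul, Real.norm_eq_abs, abs_of_pos hst, hmin]
    have h5 := rescaled_remainder_le h (n + 2) w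
    have h6 : (1 : ℝ) ≤ 2 ^ (n + 2) := one_le_pow₀ one_le_two
    set g := Real.exp (-w ^ 2 / (8 * b * t))
    have hg : 0 < g := Real.exp_pos _
    calc _ ≤ (√t)⁻¹ * (C2 * (g + (√t)⁻¹ ^ n / (1 + |(√t)⁻¹ * w|) ^ (n + 2)) * (√t)⁻¹) := by gcongr
      _ = C2 * ((√t)⁻¹ ^ (n + 2) / (1 + |(√t)⁻¹ * w|) ^ (n + 2) + (√t)⁻¹ * (√t)⁻¹ * g) := by ring
      _ ≤ C2 * (2 ^ (n + 2) / (1 + |w| + √t) ^ (n + 2) + 2 ^ (n + 2) * ((√t)⁻¹ * (√t)⁻¹ * g)) := by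
        exact mul_le_mul_of_nonneg_left (add_le_add h5
          (le_mul_of_one_le_left (by positivity) h6)) h2
      _ = 2 ^ (n + 2) * C2 * (1 / (1 + |w| + √t) ^ (n + 2) + (√t)⁻¹ * (√t)⁻¹ * g) := by ring
      _ ≤ _ := by
        gcongr
        linarith

end Kernel

theorem integral_oscKernel_sub_gaussKernel {m : ℝ → ℂ} {θ b : ℝ}
    (hm : IsDiffusivePhase m θ) (hb : 0 < b) (hm0 : m 0 = -b)
    {A : ℝ → ℂ} (hA : IsAmplitude A) (hA0 : A 0 = 1) {t : ℝ} (ht : 0 < t) :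
    ∫ w, (oscKernel m A t w - gaussKernel b t w) = 0 := by
  have hi := (integrable_oscKernel_right hm hb hm0 hA ht).sub (integrable_gaussKernel hb ht)
  have hmc := hm.contDiff.continuous
  have hAc := hA.contDiff.continuous
  have hg1 := integrable_exp_phase_smul hm hA t
  have hg2 := integrable_gaussKernel_integrand hb ht
  have he : ∀ w, oscKernel m A t w - gaussKernel b t w
      = ∫ ξ : ℝ, Complex.exp (Complex.I * ξ * w) • (Complex.exp (t * ((ξ : ℂ) ^ 2 * m ξ)) • A ξ
          - Complex.exp (t * ((ξ : ℂ) ^ 2 * (-b : ℂ))) • (1 : ℂ)) := by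
    intro w
    have i2 : Integrable fun ξ : ℝ => (Complex.exp (Complex.I * ξ * w)
        * Complex.exp (t * ((ξ : ℂ) ^ 2 * (-b : ℂ)))) • (1 : ℂ) := by
      refine hg2.norm.mono' (Continuous.aestronglyMeasurable (by fun_prop))
        (Eventually.of_forall fun ξ => ?_)
      rw [norm_smul, norm_mul, norm_exp_I_mul_mul, one_mul, norm_smul]
    rw [gaussKernel, oscKernel, oscKernel, ← integral_sub (integrable_oscKernel hm hA t w) i2]
    refine integral_congr_ae (Eventually.of_forall fun ξ => ?_)
    simp only [smul_sub, smul_smul]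
  have hi' : Integrable fun w : ℝ => ∫ ξ : ℝ, Complex.exp (Complex.I * ξ * w) •
      (Complex.exp (t * ((ξ : ℂ) ^ 2 * m ξ)) • A ξ
          - Complex.exp (t * ((ξ : ℂ) ^ 2 * (-b : ℂ))) • (1 : ℂ)) :=
    hi.congr (Eventually.of_forall he)
  have h := integral_integral_exp_smul (hg1.sub hg2) (by fun_prop) hi'
  rw [integral_congr_ae (Eventually.of_forall he)]
  refine h.trans ?_
  simp [hA0]

/-- The difference of the critical kernel and its Gaussian limit has mass zero, hence a primitive
that obeys the same bounds as a diffusive kernel. -/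
theorem exists_primitive_oscKernel_sub_gaussKernel {m : ℝ → ℂ} {θ b : ℝ}
    (hm : IsDiffusivePhase m θ) (hb : 0 < b) (hm0 : m 0 = -b) (n : ℕ)
    {A : ℝ → ℂ} (hA : IsAmplitude A) (hA0 : A 0 = 1) : ∃ C, 0 ≤ C ∧ ∀ t, 0 < t →
      ∃ Γ : ℝ → ℂ, (∀ w, HasDerivAt Γ (oscKernel m A t w - gaussKernel b t w) w) ∧
        ∀ w, ‖Γ w‖ ≤ C * kernelProfile b (n + 1) t w := by
  obtain ⟨C, h0, hC⟩ := exists_norm_oscKernel_sub_gaussKernel_le hm hb hm0 n hA hA0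
  refine ⟨C * (1 + √(Real.pi * (8 * b))), by positivity, fun t ht => ?_⟩
  have hst : 0 < √t := Real.sqrt_pos.2 ht
  have hi := (integrable_oscKernel_right hm hb hm0 hA ht).sub (integrable_gaussKernel hb ht)
  have hzero := integral_oscKernel_sub_gaussKernel hm hb hm0 hA hA0 ht
  have hgi : ∀ w, 0 ≤ w → IntegrableOn (fun y => min 1 (√t)⁻¹ * (√t)⁻¹
      * Real.exp (-y ^ 2 / (8 * b * t))) (Set.Ioi w) := fun w _ =>
    ((integrable_exp_neg_sq_div (by positivity)).const_mul _).integrableOn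
  obtain ⟨Γ, hΓ, hΓb⟩ := exists_primitive_le_tail
    ((continuous_oscKernel hm hA t).sub (continuous_gaussKernel hb ht)) hi hzero
    (B := fun y => C * (1 / (1 + y + √t) ^ (n + 2)
        + min 1 (√t)⁻¹ * (√t)⁻¹ * Real.exp (-y ^ 2 / (8 * b * t))))
    (fun w => by have := hC t ht w; rwa [← sq_abs] at this)
    (fun w hw => ((integrableOn_Ioi_one_div_pow hw n).1.add (hgi w hw)).const_mul C)
  refine ⟨Γ, hΓ, fun w => (hΓb w).trans ?_⟩
  have hw := abs_nonneg w
  rw [integral_const_mul, integral_add (integrableOn_Ioi_one_div_pow hw n).1 (hgi _ hw),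
    (integrableOn_Ioi_one_div_pow hw n).2, integral_const_mul, mul_assoc C]
  refine mul_le_mul_of_nonneg_left ?_ h0
  have h1 := integral_Ioi_exp_neg_sq_div_le (a := 8 * b * t) (by positivity) hw
  have h2 : √(Real.pi * (8 * b * t)) = √(Real.pi * (8 * b)) * √t := by
    rw [← mul_assoc Real.pi, Real.sqrt_mul (by positivity)]
  rw [h2, sq_abs] at h1
  set c := √(Real.pi * (8 * b))
  set g := Real.exp (-w ^ 2 / (8 * b * t)) with hgdef
  have hgp : 0 < g := Real.exp_pos _
  have hc : 0 ≤ c := Real.sqrt_nonneg _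
  have hp : 0 < 1 / (1 + |w| + √t) ^ (n + 1) := by positivity
  have h3 : (1 : ℝ) / (n + 1) ≤ 1 := by
    rw [div_le_one (by positivity)]; linarith [(Nat.cast_nonneg n : (0 : ℝ) ≤ n)]
  have h4 : min 1 (√t)⁻¹ * (√t)⁻¹ * ∫ y in Set.Ioi |w|, Real.exp (-y ^ 2 / (8 * b * t))
      ≤ c * ((√t)⁻¹ * g) := by
    calc _ ≤ (√t)⁻¹ * (√t)⁻¹ * (c * √t * g) := by
          gcongr
          exact min_le_right _ _
      _ = _ := by field_simp
  rw [kernelProfile, ← hgdef]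
  have h5 : 1 / ((n : ℝ) + 1) * (1 / (1 + |w| + √t) ^ (n + 1)) ≤ 1 / (1 + |w| + √t) ^ (n + 1) :=
    mul_le_of_le_one_left hp.le h3
  have h6 : 0 < (√t)⁻¹ * g := by positivity
  nlinarith [mul_nonneg hc hp.le]

/-! ### Decay of convolutions with algebraically decaying data -/

theorem integrable_one_add_abs_rpow {r : ℝ} (hr : 1 < r) :
    Integrable fun y : ℝ => (1 + |y|) ^ (-r) := by
  have := integrable_one_add_norm (E := ℝ) (μ := volume) (r := r) (by simpa using hr)
  simpa only [Real.norm_eq_abs] using this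

theorem kernelProfile_continuous (b : ℝ) (n : ℕ) (t : ℝ) : Continuous (kernelProfile b n t) := by
  unfold kernelProfile
  refine Continuous.add (Continuous.div continuous_const (by fun_prop) fun w => ?_) (by fun_prop)
  have := Real.sqrt_nonneg t
  positivity

theorem kernelProfile_le (b : ℝ) (hb : 0 < b) (n : ℕ) {t : ℝ} (ht : 0 < t) (w : ℝ) :
    kernelProfile b n t w ≤ 1 + (√t)⁻¹ := by
  have h1 : 1 / (1 + |w| + √t) ^ n ≤ 1 := by
    rw [div_le_one (by positivity)]
    exact one_le_pow₀ (by linarith [abs_nonneg w, Real.sqrt_nonneg t])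
  have h2 : Real.exp (-w ^ 2 / (8 * b * t)) ≤ 1 := by
    rw [Real.exp_le_one_iff]
    exact div_nonpos_of_nonpos_of_nonneg (by nlinarith [sq_nonneg w]) (by positivity)
  have h3 : (√t)⁻¹ * Real.exp (-w ^ 2 / (8 * b * t)) ≤ (√t)⁻¹ :=
    mul_le_of_le_one_right (by positivity) h2
  exact add_le_add h1 h3

/-- The mass of the kernel profile is bounded uniformly in time. -/
theorem exists_integral_kernelProfile_le {b : ℝ} (hb : 0 < b) (n : ℕ) :
    ∃ C, 0 ≤ C ∧ ∀ t, 0 < t → ∫ w, kernelProfile b (n + 2) t w ≤ C := by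
  have h0 : 0 ≤ ∫ w : ℝ, (1 + w ^ 2)⁻¹ := integral_nonneg fun w => by positivity
  refine ⟨(∫ w : ℝ, (1 + w ^ 2)⁻¹) + √(Real.pi * (8 * b)), by positivity, fun t ht => ?_⟩
  have hst : 0 < √t := Real.sqrt_pos.2 ht
  have hg := integrable_exp_neg_sq_div (a := 8 * b * t) (by positivity)
  simp only [kernelProfile]
  rw [integral_add (integrable_one_div_pow n t) (hg.const_mul _), integral_const_mul,
    integral_exp_neg_sq_div, ← mul_assoc Real.pi, Real.sqrt_mul (by positivity), mul_comm,
    mul_assoc, mul_inv_cancel₀ hst.ne', mul_one]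
  exact add_le_add (integral_mono (integrable_one_div_pow n t) integrable_inv_one_add_sq
    (one_div_pow_le_inv_one_add_sq n t)) le_rfl

/-- The product of the kernel profile with algebraically decaying data.  Either `|y| ≤ |X|/2`, hence
`|X - y| ≥ |X|/2` and the kernel is small (this turns the Gaussian width `8b` into `4 · 8b = 32b`),
or the data are small.  The restriction `|X| ≤ Ct` matters only for `t ≤ 1`, where it bounds the
algebraic part of the target below. -/
theorem exists_kernelProfile_mul_le {b r C : ℝ} (hb : 0 < b) (hr : 1 < r) (hC : 0 < C) (n : ℕ)
    (hn : r ≤ n) : ∃ K, 0 < K ∧ ∀ t, 0 < t → ∀ X, |X| ≤ C * t → ∀ y,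
      kernelProfile b n t (X - y) * (1 + |y|) ^ (-r) ≤
        K * ((1 + |X| + √t) ^ (-r) + (1 + t) ^ (-(1 / 2) : ℝ) * Real.exp (-(|X| ^ 2 / (32 * b * t))))
          * ((1 + |y|) ^ (-r) + kernelProfile b n t (X - y)) := by
  have hr0 : 0 < r := by linarith
  set K1 : ℝ := (2 + C) ^ r
  set K2 : ℝ := 4 * Real.exp (1 / (32 * b))
  set K3 : ℝ := 2 ^ n + 2 + 4 ^ r
  have hK1 : 0 < K1 := by positivity
  have hK2 : 0 < K2 := by positivity
  have hK3 : 0 < K3 := by positivity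
  refine ⟨K1 + K2 + K3, by positivity, fun t ht X hX y => ?_⟩
  have hst : 0 < √t := Real.sqrt_pos.2 ht
  set k := kernelProfile b n t (X - y) with hk
  set d := (1 + |y|) ^ (-r) with hd
  set P1 := (1 + |X| + √t) ^ (-r) with hP1
  set P2 := (1 + t) ^ (-(1 / 2) : ℝ) * Real.exp (-(|X| ^ 2 / (32 * b * t))) with hP2
  have hk0 : 0 ≤ k := kernelProfile_nonneg ..
  have hd0 : 0 < d := by positivity
  have hP10 : 0 < P1 := by positivity
  have hP20 : 0 < P2 := by positivity
  have hd1 : d ≤ 1 := Real.rpow_le_one_of_one_le_of_nonpos (by linarith [abs_nonneg y]) (by linarith)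
  -- it suffices to bound the product by a multiple of one of the two factors
  have key1 : ∀ κ, 0 < κ → κ ≤ K1 + K2 + K3 → d ≤ κ * (P1 + P2) →
      k * d ≤ (K1 + K2 + K3) * (P1 + P2) * (d + k) := by
    intro κ hκ hκ' h
    calc k * d ≤ k * (κ * (P1 + P2)) := by gcongr
      _ = κ * (P1 + P2) * k := by ring
      _ ≤ (K1 + K2 + K3) * (P1 + P2) * (d + k) := by gcongr; linarith
  have key2 : ∀ κ, 0 < κ → κ ≤ K1 + K2 + K3 → k ≤ κ * (P1 + P2) →
      k * d ≤ (K1 + K2 + K3) * (P1 + P2) * (d + k) := by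
    intro κ hκ hκ' h
    calc k * d ≤ κ * (P1 + P2) * d := by gcongr
      _ ≤ (K1 + K2 + K3) * (P1 + P2) * (d + k) := by gcongr; linarith
  have hsqrt1 : (1 + t) ^ (-(1 / 2) : ℝ) = (√(1 + t))⁻¹ := by
    rw [Real.rpow_neg (by positivity), Real.sqrt_eq_rpow]
  rcases le_total t 1 with h1 | h1
  · -- for bounded times `|X| ≤ Ct` is bounded, and `P1` is bounded below
    refine key1 K1 hK1 (by linarith) (hd1.trans ?_)
    have h2 : (2 + C) ^ (-r) ≤ P1 := by
      refine Real.rpow_le_rpow_of_nonpos (by positivity) ?_ (by linarith)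
      have : √t ≤ 1 := Real.sqrt_le_one.2 h1
      nlinarith
    calc (1 : ℝ) = K1 * (2 + C) ^ (-r) := by
          rw [Real.rpow_neg (by positivity), mul_inv_cancel₀ hK1.ne']
      _ ≤ K1 * (P1 + P2) := by gcongr; linarith
  have hst1 : 1 ≤ √t := Real.one_le_sqrt.2 h1
  have hinv : (√t)⁻¹ ≤ 2 * (√(1 + t))⁻¹ := by
    rw [← div_eq_mul_inv, inv_eq_one_div, div_le_div_iff₀ hst (by positivity), one_mul]
    rw [Real.sqrt_le_left (by positivity), mul_pow, Real.sq_sqrt ht.le]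
    linarith
  rcases le_total (|X|) (√t) with h2 | h2
  · -- in the diffusive zone the Gaussian factor of `P2` is bounded below
    refine key2 K2 hK2 (by linarith) ?_
    have hX2 : |X| ^ 2 ≤ t := by
      calc |X| ^ 2 ≤ √t ^ 2 := by gcongr
        _ = t := Real.sq_sqrt ht.le
    have h3 : Real.exp (-(1 / (32 * b))) ≤ Real.exp (-(|X| ^ 2 / (32 * b * t))) := by
      apply Real.exp_le_exp.2
      rw [neg_le_neg_iff, div_le_div_iff₀ (by positivity) (by positivity)]
      nlinarith
    have h4 : k ≤ 2 * (√t)⁻¹ := by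
      rw [hk, kernelProfile, two_mul]
      refine add_le_add ?_ (mul_le_of_le_one_right (by positivity) ?_)
      · rw [one_div]
        refine inv_anti₀ hst ?_
        have hn1 : n ≠ 0 := by rintro rfl; simp at hn; linarith
        exact (by linarith [abs_nonneg (X - y)] : √t ≤ 1 + |X - y| + √t).trans
          (le_self_pow₀ (by linarith [abs_nonneg (X - y)]) hn1)
      · rw [Real.exp_le_one_iff]
        exact div_nonpos_of_nonpos_of_nonneg (by nlinarith [sq_nonneg (X - y)]) (by positivity)
    calc k ≤ 4 * (√(1 + t))⁻¹ := by linarith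
      _ = K2 * ((1 + t) ^ (-(1 / 2) : ℝ) * Real.exp (-(1 / (32 * b)))) := by
        rw [hsqrt1]
        have : Real.exp (1 / (32 * b)) * Real.exp (-(1 / (32 * b))) = 1 := by
          rw [← Real.exp_add]; simp
        simp only [K2]
        linear_combination (-4 * (√(1 + t))⁻¹) * this
      _ ≤ K2 * P2 := by rw [hP2]; gcongr
      _ ≤ K2 * (P1 + P2) := by gcongr; linarith
  rcases le_total (|y|) (|X| / 2) with h3 | h3
  · -- `y` is close to the origin: the kernel is evaluated far out
    refine key2 K3 hK3 (by linarith) ?_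
    have hw : |X| / 2 ≤ |X - y| := by
      have := abs_sub_abs_le_abs_sub X y
      linarith
    have h4 : 1 / (1 + |X - y| + √t) ^ n ≤ 2 ^ n * P1 := by
      have h5 : 1 / (1 + |X - y| + √t) ^ n ≤ 2 ^ n * (1 / (1 + |X| + √t) ^ n) := by
        rw [mul_one_div, ← one_div_pow, ← div_pow]
        refine pow_le_pow_left₀ (by positivity) ?_ n
        rw [div_le_div_iff₀ (by positivity) (by positivity)]
        linarith
      refine h5.trans ?_
      gcongr
      rw [hP1, Real.rpow_neg (by positivity), ← Real.rpow_natCast, one_div]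
      refine inv_anti₀ (by positivity) ?_
      exact Real.rpow_le_rpow_of_exponent_le (by linarith [abs_nonneg X]) hn
    have h5 : (√t)⁻¹ * Real.exp (-(X - y) ^ 2 / (8 * b * t)) ≤ 2 * P2 := by
      rw [hP2, hsqrt1, ← mul_assoc]
      gcongr
      rw [neg_div, neg_le_neg_iff, div_le_div_iff₀ (by positivity) (by positivity), ← sq_abs (X - y)]
      have : |X| ^ 2 ≤ 4 * |X - y| ^ 2 := by nlinarith [abs_nonneg X]
      have hbt : 0 < b * t := by positivity
      nlinarith
    have h2n : (0 : ℝ) < 2 ^ n := by positivity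
    have h4r : (0 : ℝ) < 4 ^ r := by positivity
    calc k ≤ 2 ^ n * P1 + 2 * P2 := by rw [hk, kernelProfile]; exact add_le_add h4 h5
      _ ≤ K3 * (P1 + P2) := by
        simp only [K3]
        nlinarith [mul_pos h2n hP20, mul_pos h4r hP10, mul_pos h4r hP20]
  · -- `y` is far from the origin: the data are small
    refine key1 K3 hK3 (by linarith) ?_
    have h4 : (1 + |X| + √t) / 4 ≤ 1 + |y| := by linarith [abs_nonneg X]
    have h5 : d ≤ 4 ^ r * P1 := by
      calc d ≤ ((1 + |X| + √t) / 4) ^ (-r) :=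
            Real.rpow_le_rpow_of_nonpos (by positivity) h4 (by linarith)
        _ = 4 ^ r * P1 := by
          rw [Real.div_rpow (by positivity) (by norm_num), hP1, Real.rpow_neg (by norm_num : (0:ℝ) ≤ 4),
            div_inv_eq_mul, mul_comm]
    have h2n : (0 : ℝ) < 2 ^ n := by positivity
    have h4r : (0 : ℝ) < 4 ^ r := by positivity
    refine h5.trans ?_
    simp only [K3]
    nlinarith [mul_pos h2n hP20, mul_pos h4r hP20, mul_pos h2n hP10]

/-- Initial data whose derivative decays algebraically. -/
structure IsDecaying (E₀ r : ℝ) (h : ℝ → ℝ) : Prop where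
  differentiable : Differentiable ℝ h
  abs_deriv_le : ∀ x, |deriv h x| ≤ E₀ * (1 + |x|) ^ (-r)

theorem IsDecaying.integrable_deriv {E₀ r : ℝ} {h : ℝ → ℝ} (hh : IsDecaying E₀ r h) (hr : 1 < r) :
    Integrable (deriv h) :=
  ((integrable_one_add_abs_rpow hr).const_mul E₀).mono' (measurable_deriv h).aestronglyMeasurable
    (Eventually.of_forall fun x => by simpa using hh.abs_deriv_le x)

theorem IsDecaying.bounded {E₀ r : ℝ} {h : ℝ → ℝ} (hh : IsDecaying E₀ r h) (hr : 1 < r) :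
    ∃ B, ∀ x, |h x| ≤ B := by
  have hi := hh.integrable_deriv hr
  refine ⟨|h 0| + ∫ x, |deriv h x|, fun x => ?_⟩
  have h1 : h x = h 0 + ∫ y in (0 : ℝ)..x, deriv h y := by
    rw [intervalIntegral.integral_deriv_eq_sub (fun y _ => hh.differentiable y)
      hi.intervalIntegrable]
    ring
  rw [h1]
  refine (abs_add_le _ _).trans (add_le_add le_rfl ?_)
  have h2 : ‖∫ y in (0 : ℝ)..x, deriv h y‖ ≤ ∫ y in Set.uIoc 0 x, ‖deriv h y‖ :=
    intervalIntegral.norm_integral_le_integral_norm_uIoc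
  refine h2.trans (setIntegral_le_integral hi.norm (Eventually.of_forall fun _ => norm_nonneg _))

/-- Integration by parts against data with integrable derivative. -/
theorem IsDecaying.integral_mul_eq {E₀ r : ℝ} {h : ℝ → ℝ} (hh : IsDecaying E₀ r h) (hr : 1 < r)
    {k Γ : ℝ → ℂ} (hΓ : ∀ y, HasDerivAt Γ (k y) y) (hk : Integrable k) (hΓi : Integrable Γ)
    {B : ℝ} (hB : ∀ y, ‖Γ y‖ ≤ B) :
    ∫ y, (h y : ℂ) * k y = -∫ y, ((deriv h y : ℝ) : ℂ) * Γ y := by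
  obtain ⟨D, hD⟩ := hh.bounded hr
  have hc : Continuous fun y => (h y : ℂ) :=
    Complex.continuous_ofReal.comp hh.differentiable.continuous
  have hb : ∀ y, ‖(h y : ℂ)‖ ≤ D := fun y => by simpa using hD y
  refine integral_mul_deriv_eq_deriv_mul_of_integrable (u := fun y => (h y : ℂ)) (v := Γ)
    (fun y _ => (hh.differentiable y).hasDerivAt.ofReal_comp) (fun y _ => hΓ y)
    (hk.bdd_mul hc.aestronglyMeasurable (Eventually.of_forall hb))
    ?_ (hΓi.bdd_mul hc.aestronglyMeasurable (Eventually.of_forall hb))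
  have hi := (hh.integrable_deriv hr).ofReal (𝕜 := ℂ)
  exact hi.mul_bdd hΓi.aestronglyMeasurable (Eventually.of_forall hB)

theorem IsDecaying.integrable_kernelProfile_mul {E₀ r : ℝ} {h : ℝ → ℝ} (hh : IsDecaying E₀ r h)
    (hr : 1 < r) {b : ℝ} (hb : 0 < b) (n : ℕ) {t : ℝ} (ht : 0 < t) (X : ℝ) :
    Integrable fun y => kernelProfile b n t (X - y) * |deriv h y| := by
  refine (hh.integrable_deriv hr).abs.bdd_mul (c := 1 + (√t)⁻¹)
    ((kernelProfile_continuous b n t).comp (continuous_const.sub continuous_id)).aestronglyMeasurable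
    (Eventually.of_forall fun y => ?_)
  rw [Real.norm_eq_abs, abs_of_nonneg (kernelProfile_nonneg ..)]
  exact kernelProfile_le b hb n ht _

/-- The convolution of the kernel profile with data of decay rate `r` keeps this rate, as long as
`r` does not exceed the algebraic order of the profile. -/
theorem exists_integral_kernelProfile_mul_le {b r C : ℝ} (hb : 0 < b) (hr : 1 < r) (hC : 0 < C)
    (n : ℕ) (hn : r ≤ (n + 2 : ℕ)) : ∃ K, 0 < K ∧ ∀ E₀ h, 0 < E₀ → IsDecaying E₀ r h → ∀ t, 0 < t →
      ∀ X, |X| ≤ C * t → ∫ y, kernelProfile b (n + 2) t (X - y) * |deriv h y| ≤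
        K * (E₀ * ((1 + |X| + √t) ^ (-r)
          + (1 + t) ^ (-(1 / 2) : ℝ) * Real.exp (-(|X| ^ 2 / (32 * b * t))))) := by
  obtain ⟨K, hK, H⟩ := exists_kernelProfile_mul_le hb hr hC (n + 2) hn
  obtain ⟨c, hc, hc'⟩ := exists_integral_kernelProfile_le hb n
  have hJ := integrable_one_add_abs_rpow hr
  have hJ0 : 0 ≤ ∫ y : ℝ, (1 + |y|) ^ (-r) := integral_nonneg fun y => by positivity
  refine ⟨K * ((∫ y : ℝ, (1 + |y|) ^ (-r)) + c + 1), by positivity, fun E₀ h hE hh t ht X hX => ?_⟩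
  set P := (1 + |X| + √t) ^ (-r)
          + (1 + t) ^ (-(1 / 2) : ℝ) * Real.exp (-(|X| ^ 2 / (32 * b * t)))
  have hP : 0 ≤ P := by positivity
  have hki : Integrable fun y => kernelProfile b (n + 2) t (X - y) :=
    (integrable_kernelProfile hb n ht).comp_sub_left X
  calc ∫ y, kernelProfile b (n + 2) t (X - y) * |deriv h y|
      ≤ ∫ y, E₀ * (K * P * ((1 + |y|) ^ (-r) + kernelProfile b (n + 2) t (X - y))) := by
        refine integral_mono (hh.integrable_kernelProfile_mul hr hb _ ht X)
          (((hJ.add hki).const_mul _).const_mul _) fun y => ?_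
        calc kernelProfile b (n + 2) t (X - y) * |deriv h y|
            ≤ kernelProfile b (n + 2) t (X - y) * (E₀ * (1 + |y|) ^ (-r)) :=
              mul_le_mul_of_nonneg_left (hh.abs_deriv_le y) (kernelProfile_nonneg ..)
          _ = E₀ * (kernelProfile b (n + 2) t (X - y) * (1 + |y|) ^ (-r)) := by ring
          _ ≤ _ := mul_le_mul_of_nonneg_left (H t ht X hX y) hE.le
    _ = E₀ * (K * P * ((∫ y : ℝ, (1 + |y|) ^ (-r)) + ∫ y, kernelProfile b (n + 2) t y)) := by
        rw [integral_const_mul, integral_const_mul, integral_add hJ hki,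
          integral_sub_left_eq_self (kernelProfile b (n + 2) t)]
    _ ≤ E₀ * (K * P * ((∫ y : ℝ, (1 + |y|) ^ (-r)) + c + 1)) := by
        refine mul_le_mul_of_nonneg_left (mul_le_mul_of_nonneg_left ?_ (by positivity)) hE.le
        linarith [hc' t ht]
    _ = _ := by ring

/-! ### The critical part of the solution operator -/

section

variable {E : Type*} [NormedAddCommGroup E] [NormedSpace ℂ E]

theorem hasDerivAt_oscKernel {m : ℝ → ℂ} {θ : ℝ} (hm : IsDiffusivePhase m θ) {A : ℝ → E}
    (hA : IsAmplitude A) {t : ℝ} (ht : 0 ≤ t) (w : ℝ) :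
    HasDerivAt (oscKernel m A t)
      (oscKernel m (fun ξ : ℝ => (Complex.I * ξ) • A ξ) t w) w := by
  have hA1 : IsAmplitude (fun ξ : ℝ => (Complex.I * ξ) • A ξ) :=
    hA.smul (contDiff_const.mul Complex.ofRealCLM.contDiff)
  refine (hasDerivAt_integral_of_dominated_loc_of_deriv_le (μ := volume) (𝕜 := ℝ)
    (s := Set.univ)
    (F' := fun w ξ => (Complex.exp (Complex.I * ξ * w) * Complex.exp (t * ((ξ : ℂ) ^ 2 * m ξ))) •
      (Complex.I * ξ) • A ξ) (bound := fun ξ : ℝ => ‖(Complex.I * ξ) • A ξ‖) univ_mem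
    (Eventually.of_forall fun w => (integrable_oscKernel hm hA t w).aestronglyMeasurable)
    (integrable_oscKernel hm hA t w)
    (integrable_oscKernel hm hA1 t w).aestronglyMeasurable
    (Eventually.of_forall fun ξ w _ => ?_)
    (hA1.contDiff.continuous.integrable_of_hasCompactSupport hA1.compact).norm
    (Eventually.of_forall fun ξ w _ => ?_)).2
  · rw [norm_smul, norm_mul, norm_exp_I_mul_mul, one_mul]
    exact mul_le_of_le_one_left (norm_nonneg _) (norm_exp_phase_le hm ht ξ)
  · have hof : HasDerivAt (fun η : ℝ => (η : ℂ)) 1 w := Complex.ofRealCLM.hasDerivAt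
    have h1 : HasDerivAt (fun w : ℝ => Complex.exp (Complex.I * ξ * w)) _ w :=
      (hof.const_mul (Complex.I * ξ)).cexp
    refine ((h1.mul_const (Complex.exp (t * ((ξ : ℂ) ^ 2 * m ξ)))).smul_const (A ξ)).congr_deriv ?_
    rw [smul_smul]
    congr 1; ring

end

/-- The `j`-th coordinate of an `ℓ¹`-valued amplitude. -/
theorem IsAmplitude.coord {G : ℝ → lp (fun _ : ℤ => ℂ) 1} (hG : IsAmplitude G) (j : ℤ) :
    IsAmplitude (fun ξ => G ξ j) := by
  have h := ((lp.evalCLM ℂ (fun _ : ℤ => ℂ) 1 j).restrictScalars ℝ).contDiff (n := ∞)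
  exact ⟨h.comp hG.contDiff, hG.compact.comp_left (g := fun v : lp (fun _ : ℤ => ℂ) 1 => v j) rfl⟩

theorem oscKernel_coord {m : ℝ → ℂ} {θ : ℝ} (hm : IsDiffusivePhase m θ)
    {G : ℝ → lp (fun _ : ℤ => ℂ) 1} (hG : IsAmplitude G) (t w : ℝ) (j : ℤ) :
    oscKernel m (fun ξ => G ξ j) t w = oscKernel m G t w j := by
  have h := (lp.evalCLM ℂ (fun _ : ℤ => ℂ) 1 j).integral_comp_comm (integrable_oscKernel hm hG t w)
  exact h

theorem sum_norm_coord_le (v : lp (fun _ : ℤ => ℂ) 1) (s : Finset ℤ) : ∑ j ∈ s, ‖v j‖ ≤ ‖v‖ := by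
  simpa using lp.sum_rpow_le_norm_rpow (by simp) v s

/-- The symbol of a term of the Bloch formula, in the form of an oscillatory kernel. -/
theorem integral_critical_symbol {m lam β : ℝ → ℂ} {α : ℝ → ℝ} {a : ℝ}
    (hlam : ∀ ξ, α ξ ≠ 0 → lam ξ = -Complex.I * a * ξ + (ξ : ℂ) ^ 2 * m ξ) (j : ℤ) (t x y : ℝ) :
    ∫ ξ : ℝ, Complex.exp (-Complex.I * (ξ + (2 * Real.pi * j : ℝ)) * y) *
      (Complex.exp (Complex.I * ξ * x) * Complex.exp (lam ξ * t) * (α ξ : ℂ) * β ξ)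
      = Complex.exp (-Complex.I * (2 * Real.pi * j) * y) *
        oscKernel m (fun ξ => (α ξ : ℂ) * β ξ) t (x - a * t - y) := by
  rw [oscKernel, ← integral_const_mul]
  congr 1; ext ξ
  by_cases h : α ξ = 0
  · simp [h]
  · rw [hlam ξ h, smul_eq_mul]
    have : Complex.exp (-Complex.I * (ξ + (2 * Real.pi * j : ℝ)) * y) * Complex.exp (Complex.I * ξ * x)
        * Complex.exp ((-Complex.I * a * ξ + (ξ : ℂ) ^ 2 * m ξ) * t)
        = Complex.exp (-Complex.I * (2 * Real.pi * j) * y)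
          * (Complex.exp (Complex.I * ξ * (x - a * t - y : ℝ)) * Complex.exp (t * ((ξ : ℂ) ^ 2 * m ξ))) := by
      simp only [← Complex.exp_add]
      congr 1; push_cast; ring
    linear_combination (α ξ : ℂ) * β ξ * this

theorem integral_gaussian_symbol (a b t x y : ℝ) :
    ∫ ξ : ℝ, Complex.exp (-Complex.I * (ξ + (0 : ℝ)) * y) *
      (Complex.exp (Complex.I * ξ * x) * Complex.exp ((-Complex.I * a * ξ - b * (ξ : ℂ) ^ 2) * t))
      = gaussKernel b t (x - a * t - y) := by
  rw [gaussKernel, oscKernel]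
  congr 1; ext ξ
  rw [smul_eq_mul, mul_one]
  simp only [← Complex.exp_add]
  congr 1; push_cast; ring

/-- The data on which the estimate of the critical part depends: the expansion of the critical
eigenvalue and the coefficients of the Bloch formula.  Those with `j ≠ 0`, divided by `ξ + 2πj`, form
a smooth function `G` with values in `ℓ¹`; its entry at `j = 0` is irrelevant. -/
structure IsCriticalSymbol {n : ℕ} (u : ℝ → RVec n) (lam : ℝ → ℂ) (qt : ℝ → L2Per n) (α : ℝ → ℝ)
    (a b θ : ℝ) (m A₀ : ℝ → ℂ) (G : ℝ → lp (fun _ : ℤ => ℂ) 1) : Prop where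
  phase : IsDiffusivePhase m θ
  pos : 0 < b
  phase_zero : m 0 = -b
  lam_eq : ∀ ξ, α ξ ≠ 0 → lam ξ = -Complex.I * a * ξ + (ξ : ℂ) ^ 2 * m ξ
  amplitude_zero : IsAmplitude A₀
  zero_eq_one : A₀ 0 = 1
  coeff_zero : ∀ ξ, A₀ ξ = α ξ * modeCoeff u qt 0 ξ
  amplitude : IsAmplitude G
  coeff : ∀ ξ j, j ≠ 0 → (ξ + 2 * Real.pi * j) * G ξ j = α ξ * modeCoeff u qt j ξ

section

variable {n : ℕ} {u : ℝ → RVec n} {lam : ℝ → ℂ} {qt : ℝ → L2Per n} {α : ℝ → ℝ}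
  {a b θ : ℝ} {m A₀ : ℝ → ℂ} {G : ℝ → lp (fun _ : ℤ => ℂ) 1}

theorem norm_exp_neg_I_mul (c y : ℝ) : ‖Complex.exp (-Complex.I * c * y)‖ = 1 := by
  rw [Complex.norm_exp]; simp

/-- For `j ≠ 0` the frequency `ξ + 2πj` does not vanish, and one derivative is moved to the data. -/
theorem IsCriticalSymbol.criticalTerm_eq (hs : IsCriticalSymbol u lam qt α a b θ m A₀ G) {E₀ r : ℝ}
    (hr : 1 < r) {h : ℝ → ℝ} (hh : IsDecaying E₀ r h) {t : ℝ} (ht : 0 < t) (x : ℝ) {j : ℤ}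
    (hj : j ≠ 0) : criticalTerm u lam qt α h t x j
      = -∫ y, ((deriv h y : ℝ) : ℂ) * (Complex.I * Complex.exp (-Complex.I * (2 * Real.pi * j : ℝ) * y)
          * oscKernel m G t (x - a * t - y) j) := by
  have hm := hs.phase
  have hA := hs.amplitude.coord j
  have hα : (fun ξ => (α ξ : ℂ) * modeCoeff u qt j ξ)
      = fun ξ : ℝ => ((ξ : ℂ) + 2 * Real.pi * j) • (G ξ j : ℂ) := by
    ext ξ; exact (hs.coeff ξ j hj).symm
  have hA1 : IsAmplitude fun ξ => (α ξ : ℂ) * modeCoeff u qt j ξ := by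
    rw [hα]; exact hA.smul (Complex.ofRealCLM.contDiff.add contDiff_const)
  have hA2 : IsAmplitude (fun ξ : ℝ => (Complex.I * ξ) • G ξ j) :=
    hA.smul (contDiff_const.mul Complex.ofRealCLM.contDiff)
  have hsplit : ∀ w, oscKernel m (fun ξ => (α ξ : ℂ) * modeCoeff u qt j ξ) t w
      = (2 * Real.pi * j) * oscKernel m (fun ξ => G ξ j) t w
        - Complex.I * oscKernel m (fun ξ : ℝ => (Complex.I * ξ) • G ξ j) t w := by
    intro w
    rw [hα, oscKernel, oscKernel, oscKernel, ← integral_const_mul, ← integral_const_mul,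
      ← integral_sub ((integrable_oscKernel hm hA t w).const_mul _)
        ((integrable_oscKernel hm hA2 t w).const_mul _)]
    congr 1; ext ξ
    simp only [smul_eq_mul]
    linear_combination ((ξ : ℂ) * G ξ j * Complex.exp (Complex.I * ξ * w)
      * Complex.exp (t * ((ξ : ℂ) ^ 2 * m ξ))) * Complex.I_mul_I
  obtain ⟨C, hC0, hC⟩ := exists_norm_oscKernel_le hm hs.pos hs.phase_zero 1 hA
  have hexp : Continuous fun y : ℝ => Complex.exp (-Complex.I * (2 * Real.pi * j : ℝ) * y) := by
    fun_prop
  have hi1 := (integrable_oscKernel_right hm hs.pos hs.phase_zero hA1 ht).comp_sub_left (x - a * t)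
  have hi2 := (integrable_oscKernel_right hm hs.pos hs.phase_zero hA ht).comp_sub_left (x - a * t)
  rw [criticalTerm, fourierPairing]
  simp only [← oscKernel_coord hm hs.amplitude]
  refine Eq.trans ?_ (hh.integral_mul_eq hr (Γ := fun y =>
    Complex.I * Complex.exp (-Complex.I * (2 * Real.pi * j : ℝ) * y)
          * oscKernel m (fun ξ => G ξ j) t (x - a * t - y))
    (k := fun y => Complex.exp (-Complex.I * (2 * Real.pi * j : ℝ) * y) *
        oscKernel m (fun ξ => (α ξ : ℂ) * modeCoeff u qt j ξ) t (x - a * t - y))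
    (fun y => ?_) ?_ ?_ (B := C * (1 + (√t)⁻¹)) (fun y => ?_))
  · congr 1; ext y
    have := integral_critical_symbol (β := modeCoeff u qt j) hs.lam_eq j t x y
    push_cast at this ⊢
    rw [this]
  · have hof : HasDerivAt (fun η : ℝ => (η : ℂ)) 1 y := Complex.ofRealCLM.hasDerivAt
    have h1 : HasDerivAt (fun y : ℝ => Complex.exp (-Complex.I * (2 * Real.pi * j : ℝ) * y)) _ y :=
      (hof.const_mul (-Complex.I * (2 * Real.pi * j : ℝ))).cexp
    have h2 : HasDerivAt (fun y => oscKernel m (fun ξ => G ξ j) t (x - a * t - y)) _ y :=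
      (hasDerivAt_oscKernel hm hA ht.le _).scomp y ((hasDerivAt_id y).const_sub (x - a * t))
    refine ((h1.const_mul Complex.I).mul h2).congr_deriv ?_
    rw [hsplit]
    simp only [neg_smul, one_smul]
    push_cast
    linear_combination (-Complex.exp (-Complex.I * (2 * Real.pi * j) * y) * (2 * Real.pi * j)
      * oscKernel m (fun ξ => G ξ j) t (x - a * t - y)) * Complex.I_mul_I
  · exact hi1.bdd_mul hexp.aestronglyMeasurable
      (Eventually.of_forall fun y => (norm_exp_neg_I_mul _ y).le)
  · exact hi2.bdd_mul (c := 1) (by fun_prop)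
      (Eventually.of_forall fun y => by
        rw [norm_mul, Complex.norm_I, norm_exp_neg_I_mul, one_mul])
  · rw [norm_mul, norm_mul, Complex.norm_I, norm_exp_neg_I_mul, one_mul, one_mul]
    exact (hC t ht _).trans (mul_le_mul_of_nonneg_left (kernelProfile_le b hs.pos _ ht _) hC0)

/-- The critical part minus its Gaussian limit is bounded by the convolution of the derivative of
the data with the kernel profile. -/
theorem IsCriticalSymbol.exists_bound (hs : IsCriticalSymbol u lam qt α a b θ m A₀ G) (N : ℕ)
    {r : ℝ} (hr : 1 < r) : ∃ K, 0 < K ∧ ∀ E₀ h, IsDecaying E₀ r h → ∀ t, 0 < t → ∀ x,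
      Summable (criticalTerm u lam qt α h t x) ∧ ‖sTildeOne u lam qt α a b h t x‖
        ≤ K * ∫ y, kernelProfile b (N + 2) t (x - a * t - y) * |deriv h y| := by
  have hm := hs.phase
  have hb := hs.pos
  obtain ⟨C, hC0, hC⟩ := exists_norm_oscKernel_le hm hb hs.phase_zero (N + 1) hs.amplitude
  obtain ⟨D, hD0, hD⟩ := exists_primitive_oscKernel_sub_gaussKernel hm hb hs.phase_zero (N + 1)
    hs.amplitude_zero hs.zero_eq_one
  refine ⟨C + D + 1, by positivity, fun E₀ h hh t ht x => ?_⟩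
  set X := x - a * t
  set J := ∫ y, kernelProfile b (N + 2) t (X - y) * |deriv h y|
  have hJi := hh.integrable_kernelProfile_mul hr hb (N + 2) ht X
  have hJ0 : 0 ≤ J := integral_nonneg fun y => mul_nonneg (kernelProfile_nonneg ..) (abs_nonneg _)
  have hdi := hh.integrable_deriv hr
  -- the nonzero frequencies
  have hcoord : ∀ j, Integrable fun y => |deriv h y| * ‖oscKernel m G t (X - y) j‖ := by
    intro j
    have h1 := (continuous_oscKernel hm (hs.amplitude.coord j) t).comp
      (continuous_const.sub continuous_id : Continuous fun y => X - y)
    simp only [Function.comp_def, oscKernel_coord hm hs.amplitude] at h1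
    refine hdi.abs.mul_bdd (c := C * (1 + (√t)⁻¹)) h1.norm.aestronglyMeasurable
      (Eventually.of_forall fun y => ?_)
    rw [norm_norm]
    exact (lp.norm_apply_le_norm one_ne_zero _ j).trans ((hC t ht _).trans
      (mul_le_mul_of_nonneg_left (kernelProfile_le b hb _ ht _) hC0))
  have hterm : ∀ j, j ≠ 0 → ‖criticalTerm u lam qt α h t x j‖
      ≤ ∫ y, |deriv h y| * ‖oscKernel m G t (X - y) j‖ := by
    intro j hj
    rw [hs.criticalTerm_eq hr hh ht x hj, norm_neg]
    refine norm_integral_le_of_norm_le (hcoord j) (Eventually.of_forall fun y => ?_)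
    rw [norm_mul, norm_mul, norm_mul, Complex.norm_I, norm_exp_neg_I_mul, one_mul, one_mul,
      Complex.norm_real, Real.norm_eq_abs]
  set f : ℤ → ℂ := fun j => if j = 0 then 0 else criticalTerm u lam qt α h t x j with hf
  have hfsum : ∀ s : Finset ℤ, ∑ j ∈ s, ‖f j‖ ≤ C * J := by
    intro s
    calc ∑ j ∈ s, ‖f j‖ ≤ ∑ j ∈ s, ∫ y, |deriv h y| * ‖oscKernel m G t (X - y) j‖ := by
          refine Finset.sum_le_sum fun j _ => ?_
          by_cases hj : j = 0
          · simp only [hf, hj, if_true, norm_zero]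
            exact integral_nonneg fun y => by positivity
          · simp only [hf, hj, if_false]
            exact hterm j hj
      _ = ∫ y, ∑ j ∈ s, |deriv h y| * ‖oscKernel m G t (X - y) j‖ :=
          (integral_finsetSum s fun j _ => hcoord j).symm
      _ ≤ ∫ y, C * (kernelProfile b (N + 2) t (X - y) * |deriv h y|) := by
          refine integral_mono (integrable_finsetSum s fun j _ => hcoord j) (hJi.const_mul C)
            fun y => ?_
          simp only [← Finset.mul_sum]
          calc _ ≤ |deriv h y| * (C * kernelProfile b (N + 2) t (X - y)) :=
                mul_le_mul_of_nonneg_left ((sum_norm_coord_le _ s).trans (hC t ht _)) (abs_nonneg _)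
            _ = _ := by ring
      _ = C * J := integral_const_mul _ _
  have hfs : Summable fun j => ‖f j‖ := summable_of_sum_le (fun j => norm_nonneg _) hfsum
  have hfb : ‖∑' j, f j‖ ≤ C * J :=
    (norm_tsum_le_tsum_norm hfs).trans (hfs.tsum_le_of_sum_le hfsum)
  have hsplit : criticalTerm u lam qt α h t x
      = fun j => f j + if j = 0 then criticalTerm u lam qt α h t x 0 else 0 := by
    ext j
    by_cases hj : j = 0
    · simp [hf, hj]
    · simp [hf, hj]
  have hg : Summable fun j : ℤ => if j = 0 then criticalTerm u lam qt α h t x 0 else 0 :=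
    (hasSum_ite_eq 0 _).summable
  refine ⟨by rw [hsplit]; exact hfs.of_norm.add hg, ?_⟩
  have htsum : ∑' j, criticalTerm u lam qt α h t x j
      = (∑' j, f j) + criticalTerm u lam qt α h t x 0 := by
    rw [hsplit, hfs.of_norm.tsum_add hg, tsum_ite_eq]
    simp [hf]
  -- the zero frequency, where the Gaussian part removes the singularity at `ξ = 0`
  obtain ⟨Γ, hΓ, hΓb⟩ := hD t ht
  have hk1 := (integrable_oscKernel_right hm hb hs.phase_zero hs.amplitude_zero ht).comp_sub_left X
  have hk2 := (integrable_gaussKernel hb ht).comp_sub_left X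
  have hΓc : Continuous Γ := continuous_iff_continuousAt.2 fun w => (hΓ w).continuousAt
  have hΓi : Integrable Γ := ((integrable_kernelProfile hb N ht).const_mul D).mono'
    hΓc.aestronglyMeasurable (Eventually.of_forall hΓb)
  obtain ⟨B, hB⟩ := hh.bounded hr
  have hhc : Continuous fun y => (h y : ℂ) :=
    Complex.continuous_ofReal.comp hh.differentiable.continuous
  have hhb : ∀ y, ‖(h y : ℂ)‖ ≤ B := fun y => by simpa using hB y
  have hzero : criticalTerm u lam qt α h t x 0 - gaussianPart a b h t x
      = ∫ y, ((deriv h y : ℝ) : ℂ) * Γ (X - y) := by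
    have h1 : criticalTerm u lam qt α h t x 0 = ∫ y, (h y : ℂ) * oscKernel m A₀ t (X - y) := by
      rw [criticalTerm, fourierPairing]
      congr 1; ext y
      have := integral_critical_symbol (β := modeCoeff u qt 0) hs.lam_eq 0 t x y
      rw [show (fun ξ => (α ξ : ℂ) * modeCoeff u qt 0 ξ) = A₀ from
        funext fun ξ => (hs.coeff_zero ξ).symm] at this
      push_cast at this ⊢
      rw [this]
      simp [X]
    have h2 : gaussianPart a b h t x = ∫ y, (h y : ℂ) * gaussKernel b t (X - y) := by
      rw [gaussianPart, fourierPairing]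
      congr 1; ext y
      have := integral_gaussian_symbol a b t x y
      push_cast at this ⊢
      rw [this]
    rw [h1, h2, ← integral_sub (hk1.bdd_mul hhc.aestronglyMeasurable (Eventually.of_forall hhb))
      (hk2.bdd_mul hhc.aestronglyMeasurable (Eventually.of_forall hhb))]
    have h3 := hh.integral_mul_eq hr (Γ := fun y => -Γ (X - y))
      (k := fun y => oscKernel m A₀ t (X - y) - gaussKernel b t (X - y)) (fun y => ?_)
      (hk1.sub hk2) (hΓi.comp_sub_left X).neg (B := D * (1 + (√t)⁻¹)) (fun y => ?_)
    · simp only [mul_sub, mul_neg, integral_neg, neg_neg] at h3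
      exact h3
    · have := ((hΓ (X - y)).scomp y ((hasDerivAt_id y).const_sub X)).neg
      exact this.congr_deriv (by simp)
    · rw [norm_neg]
      exact (hΓb _).trans (mul_le_mul_of_nonneg_left (kernelProfile_le b hb _ ht _) hD0)
  have hzb : ‖criticalTerm u lam qt α h t x 0 - gaussianPart a b h t x‖ ≤ D * J := by
    rw [hzero]
    refine (norm_integral_le_of_norm_le (hJi.const_mul D) (Eventually.of_forall fun y => ?_)).trans
      (integral_const_mul _ _).le
    rw [norm_mul, Complex.norm_real, Real.norm_eq_abs]
    calc |deriv h y| * ‖Γ (X - y)‖ ≤ |deriv h y| * (D * kernelProfile b (N + 2) t (X - y)) :=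
          mul_le_mul_of_nonneg_left (hΓb _) (abs_nonneg _)
      _ = _ := by ring
  rw [sTildeOne, htsum, add_sub_assoc]
  refine (norm_add_le _ _).trans ((add_le_add hfb hzb).trans ?_)
  linarith

end

/-! ### The pointwise estimates -/

theorem convolutionBound_eq (a b : ℝ) (h : ℝ → ℝ) {t : ℝ} (ht : 0 < t) (x : ℝ) :
    convolutionBound a (8 * b) h t x
      = ∫ y, kernelProfile b 2 t (x - a * t - y) * |deriv h y| := by
  rw [convolutionBound]
  congr 1; ext y
  have e : x - y - a * t = x - a * t - y := by ring
  rw [e, kernelProfile]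
  congr 2
  · rw [Real.rpow_neg (by positivity), one_div]
    norm_cast
  · rw [Real.rpow_neg ht.le, Real.sqrt_eq_rpow, sq_abs, neg_div]

/-- The pointwise estimates of the critical part, with `M = 8b` and `M' = 32b`.  For `r > 2` the
algebraic order of the bound `convolutionBound` is below the rate `r` of the data, so the estimate by
`decayProfile` uses the kernel bounds of order `⌈r⌉₊ + 2`. -/
theorem IsCriticalSymbol.estimate {n : ℕ} {u : ℝ → RVec n} {lam : ℝ → ℂ} {qt : ℝ → L2Per n}
    {α : ℝ → ℝ} {a b θ : ℝ} {m A₀ : ℝ → ℂ} {G : ℝ → lp (fun _ : ℤ => ℂ) 1}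
    (hs : IsCriticalSymbol u lam qt α a b θ m A₀ G) {r : ℝ} (hr : 1 < r) {C : ℝ} (hC : 0 < C) :
    ∃ M M' K : ℝ, 0 < M ∧ M < M' ∧ 0 < K ∧
          ∀ (E₀ : ℝ) (h₀ : ℝ → ℝ), 0 < E₀ → Differentiable ℝ h₀ →
            (∀ x, |deriv h₀ x| ≤ E₀ * (1 + |x|) ^ (-r)) →
            ∀ t x : ℝ, 0 < t → |x| ≤ C * t →
              Summable (criticalTerm u lam qt α h₀ t x) ∧
              ‖sTildeOne u lam qt α a b h₀ t x‖ ≤ K * convolutionBound a M h₀ t x ∧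
              ‖sTildeOne u lam qt α a b h₀ t x‖ ≤ K * (E₀ * decayProfile a M' r t x) ∧
              (r ≤ 2 → convolutionBound a M h₀ t x ≤ K * (E₀ * decayProfile a M' r t x)) := by
  have hb := hs.pos
  have hC' : 0 < C + |a| := by positivity
  have h2 : ∃ K, 0 < K ∧ (r ≤ 2 → ∀ E₀ h, 0 < E₀ → IsDecaying E₀ r h → ∀ t, 0 < t →
      ∀ X, |X| ≤ (C + |a|) * t → ∫ y, kernelProfile b (0 + 2) t (X - y) * |deriv h y| ≤
        K * (E₀ * ((1 + |X| + √t) ^ (-r)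
          + (1 + t) ^ (-(1 / 2) : ℝ) * Real.exp (-(|X| ^ 2 / (32 * b * t)))))) := by
    by_cases h : r ≤ 2
    · obtain ⟨K, hK, H⟩ := exists_integral_kernelProfile_mul_le hb hr hC' 0 (by simpa using h)
      exact ⟨K, hK, fun _ => H⟩
    · exact ⟨1, one_pos, fun h' => absurd h' h⟩
  obtain ⟨K0, hK0, H0⟩ := h2
  obtain ⟨K1, hK1, H1⟩ := hs.exists_bound 0 hr
  obtain ⟨K2, hK2, H2⟩ := hs.exists_bound ⌈r⌉₊ hr
  obtain ⟨K3, hK3, H3⟩ := exists_integral_kernelProfile_mul_le hb hr hC' ⌈r⌉₊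
    (by push_cast; linarith [Nat.le_ceil r])
  refine ⟨8 * b, 32 * b, K0 + K1 + K2 * K3, by positivity, by linarith, by positivity,
    fun E₀ h hE hd hh' t x ht hx => ?_⟩
  have hh : IsDecaying E₀ r h := ⟨hd, hh'⟩
  have hX : |x - a * t| ≤ (C + |a|) * t := by
    calc |x - a * t| ≤ |x| + |a * t| := abs_sub _ _
      _ = |x| + |a| * t := by rw [abs_mul, abs_of_pos ht]
      _ ≤ _ := by linarith
  have hP : 0 ≤ decayProfile a (32 * b) r t x := by rw [decayProfile]; positivity
  have hJ : 0 ≤ convolutionBound a (8 * b) h t x := by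
    rw [convolutionBound_eq a b h ht]
    exact integral_nonneg fun y => mul_nonneg (kernelProfile_nonneg ..) (abs_nonneg _)
  have hEP : 0 ≤ E₀ * decayProfile a (32 * b) r t x := by positivity
  have hK23 : 0 < K2 * K3 := by positivity
  refine ⟨(H1 E₀ h hh t ht x).1, ?_, ?_, fun hr2 => ?_⟩
  · have := (H1 E₀ h hh t ht x).2
    rw [zero_add, ← convolutionBound_eq a b h ht] at this
    nlinarith
  · have h4 := (H2 E₀ h hh t ht x).2
    have h5 := H3 E₀ h hE hh t ht _ hX
    calc _ ≤ K2 * (K3 * (E₀ * decayProfile a (32 * b) r t x)) :=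
          h4.trans (mul_le_mul_of_nonneg_left h5 hK2.le)
      _ ≤ _ := by nlinarith
  · have h6 := H0 hr2 E₀ h hE hh t ht _ hX
    rw [zero_add, ← convolutionBound_eq a b h ht] at h6
    refine h6.trans ?_
    change K0 * (E₀ * decayProfile a (32 * b) r t x) ≤ _
    nlinarith

/-! ### Diagonal operators on sequence spaces -/

section Diagonal

variable {ι : Type*} {p : ENNReal}

theorem memℓp_mul {d : ι → ℂ} {B : ℝ} (hd : ∀ i, ‖d i‖ ≤ B) (a : lp (fun _ : ι => ℂ) p) :
    Memℓp (fun i => d i * a i) p := by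
  refine ((lp.memℓp a).const_smul (B : ℂ)).mono' fun i => ?_
  rw [Pi.smul_apply, norm_mul, norm_smul, Complex.norm_real, Real.norm_eq_abs]
  exact mul_le_mul_of_nonneg_right ((hd i).trans (le_abs_self B)) (norm_nonneg _)

variable [Fact (1 ≤ p)]

theorem norm_le_of_forall_norm_le_mul {B : ℝ} (hB : 0 ≤ B) {a b : lp (fun _ : ι => ℂ) p}
    (h : ∀ i, ‖b i‖ ≤ B * ‖a i‖) : ‖b‖ ≤ B * ‖a‖ := by
  have hp : p ≠ 0 := (zero_lt_one.trans_le (Fact.out : 1 ≤ p)).ne'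
  have h1 : ‖b‖ ≤ ‖(B : ℂ) • a‖ := lp.norm_mono hp fun i => by
    rw [lp.coeFn_smul, Pi.smul_apply, norm_smul, Complex.norm_real, Real.norm_eq_abs,
      abs_of_nonneg hB]
    exact h i
  rwa [norm_smul, Complex.norm_real, Real.norm_eq_abs, abs_of_nonneg hB] at h1

variable (p) in
/-- Multiplication by a bounded sequence on `ℓᵖ`. -/
def diagMul (d : ι → ℂ) (hd : ∃ B : ℝ, 0 ≤ B ∧ ∀ i, ‖d i‖ ≤ B) :
    lp (fun _ : ι => ℂ) p →L[ℂ] lp (fun _ : ι => ℂ) p :=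
  LinearMap.mkContinuousOfExistsBound
    { toFun := fun a => ⟨fun i => d i * a i, memℓp_mul hd.choose_spec.2 a⟩
      map_add' := fun a b => by ext i; exact mul_add _ _ _
      map_smul' := fun c a => by ext i; exact mul_left_comm _ _ _ }
    ⟨hd.choose, fun a => norm_le_of_forall_norm_le_mul hd.choose_spec.1 fun i => by
      change ‖d i * a i‖ ≤ _
      rw [norm_mul]
      exact mul_le_mul_of_nonneg_right (hd.choose_spec.2 i) (norm_nonneg _)⟩

theorem diagMul_apply (d : ι → ℂ) (hd : ∃ B : ℝ, 0 ≤ B ∧ ∀ i, ‖d i‖ ≤ B)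
    (a : lp (fun _ : ι => ℂ) p) (i : ι) : diagMul p d hd a i = d i * a i := rfl

theorem norm_diagMul_le (d : ι → ℂ) (hd : ∃ B : ℝ, 0 ≤ B ∧ ∀ i, ‖d i‖ ≤ B) {B : ℝ} (hB : 0 ≤ B)
    (h : ∀ i, ‖d i‖ ≤ B) : ‖diagMul p d hd‖ ≤ B :=
  ContinuousLinearMap.opNorm_le_bound _ hB fun a => norm_le_of_forall_norm_le_mul hB fun i => by
    rw [diagMul_apply, norm_mul]
    exact mul_le_mul_of_nonneg_right (h i) (norm_nonneg _)

/-- A diagonal operator whose entries tend to zero is a limit of operators of finite rank. -/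
theorem isCompactOperator_diagMul (d : ι → ℂ) (hd : ∃ B : ℝ, 0 ≤ B ∧ ∀ i, ‖d i‖ ≤ B)
    (h0 : Tendsto d cofinite (𝓝 0)) : IsCompactOperator (diagMul p d hd) := by
  classical
  let F : Finset ι → lp (fun _ : ι => ℂ) p →L[ℂ] lp (fun _ : ι => ℂ) p := fun s =>
    ∑ i ∈ s, (d i • lp.singleContinuousLinearMap ℂ (fun _ : ι => ℂ) p i).comp
      (lp.evalCLM ℂ (fun _ : ι => ℂ) p i)
  have hF : ∀ s a j, F s a j = if j ∈ s then d j * a j else 0 := by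
    intro s a j
    have : F s a = ∑ i ∈ s, d i • lp.single p i (a i) := by
      simp only [F, _root_.sum_apply]
      rfl
    rw [this, lp.coeFn_sum, Finset.sum_apply]
    simp only [lp.coeFn_smul, Pi.smul_apply, lp.single_apply, smul_eq_mul, Pi.single_apply,
      mul_ite, mul_zero]
    rw [Finset.sum_ite_eq]
  refine isCompactOperator_of_tendsto (l := atTop) (F := F) ?_ (Eventually.of_forall fun s => ?_)
  · rw [tendsto_iff_norm_sub_tendsto_zero, Metric.tendsto_atTop]
    intro ε hε
    have hfin : {i | ¬ ‖d i‖ < ε / 2}.Finite := by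
      have := h0.norm
      rw [norm_zero] at this
      exact this.eventually_lt_const (half_pos hε)
    refine ⟨hfin.toFinset, fun s hs => ?_⟩
    rw [dist_zero_right, norm_norm]
    refine lt_of_le_of_lt ?_ (half_lt_self hε)
    refine ContinuousLinearMap.opNorm_le_bound _ (by positivity) fun a =>
      norm_le_of_forall_norm_le_mul (by positivity) fun i => ?_
    rw [_root_.sub_apply, lp.coeFn_sub, Pi.sub_apply, hF, diagMul_apply]
    by_cases hi : i ∈ s
    · rw [if_pos hi, sub_self, norm_zero]; positivity
    · have hi' : ‖d i‖ < ε / 2 := by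
        by_contra hc
        exact hi (hs (hfin.mem_toFinset.2 hc))
      rw [if_neg hi, zero_sub, norm_neg, norm_mul]
      gcongr
  · have hsum : ∀ s : Finset ι, IsCompactOperator (F s) := by
      intro s
      induction s using Finset.induction_on with
      | empty => simpa [F] using isCompactOperator_zero
      | insert i s hi ih =>
        have : F (insert i s) = (d i • lp.singleContinuousLinearMap ℂ (fun _ : ι => ℂ) p i).comp
            (lp.evalCLM ℂ (fun _ : ι => ℂ) p i) + F s := Finset.sum_insert hi
        rw [this]
        refine IsCompactOperator.add ?_ ih
        have h1 : IsCompactOperator (lp.evalCLM ℂ (fun _ : ι => ℂ) p i) :=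
          isCompactOperator_of_locallyCompactSpace_dom _
        exact h1.clm_comp (d i • lp.singleContinuousLinearMap ℂ (fun _ : ι => ℂ) p i)
    exact hsum s

end Diagonal

/-! ### Periodic functions and functions on the circle -/

theorem ae_circle_iff {P : UnitAddCircle → Prop} :
    (∀ᵐ z, P z) ↔ ∀ᵐ x : ℝ, P (x : UnitAddCircle) := by
  constructor
  · intro h
    have h1 : ∀ k : ℤ, ∀ᵐ x : ℝ, x ∈ Set.Ioc (k : ℝ) (k + 1) → P (x : UnitAddCircle) := fun k => by
      have := (UnitAddCircle.measurePreserving_mk (k : ℝ)).quasiMeasurePreserving.ae h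
      exact (ae_restrict_iff' measurableSet_Ioc).1 this
    filter_upwards [ae_all_iff.2 h1] with x hx
    refine hx (⌈x⌉ - 1) ⟨?_, ?_⟩
    · push_cast; linarith [Int.ceil_lt_add_one x]
    · push_cast; linarith [Int.le_ceil x]
  · intro h
    have h1 : ∀ᵐ y : Set.Ioc (0 : ℝ) (0 + 1) ∂(Measure.comap Subtype.val volume),
        P ((y : ℝ) : UnitAddCircle) :=
      (ae_restrict_iff_subtype measurableSet_Ioc).1 (ae_restrict_of_ae h)
    have h2 := (AddCircle.measurePreserving_equivIoc (1 : ℝ) (a := 0)).quasiMeasurePreserving.ae h1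
    filter_upwards [h2] with z hz
    have : ((AddCircle.equivIoc (1 : ℝ) 0 z : ℝ) : UnitAddCircle) = z :=
      (AddCircle.equivIoc (1 : ℝ) 0).symm_apply_apply z
    rwa [this] at hz

theorem volume_circle : (volume : Measure UnitAddCircle) = AddCircle.haarAddCircle := by
  rw [AddCircle.volume_eq_smul_haarAddCircle]; simp

instance : IsProbabilityMeasure (volume : Measure UnitAddCircle) := by
  rw [volume_circle]; infer_instance

section L2Per

variable {n : ℕ}

theorem coe_circle_periodic {α : Type*} (w : UnitAddCircle → α) :
    Function.Periodic (fun x : ℝ => w x) 1 := fun x => by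
  simp only [AddCircle.coe_add, AddCircle.coe_period, add_zero]

theorem integrable_L2Per (w : L2Per n) : Integrable (fun z => w z) :=
  (Lp.memLp w).integrable one_le_two

theorem intervalIntegrable_coe {F : Type*} [NormedAddCommGroup F] {w : UnitAddCircle → F}
    (hw : Integrable w) (a b : ℝ) : IntervalIntegrable (fun x : ℝ => w x) volume a b := by
  refine (coe_circle_periodic w).intervalIntegrable one_ne_zero (t := 0) ?_ a b
  rw [intervalIntegrable_iff_integrableOn_Ioc_of_le (by norm_num)]
  exact (UnitAddCircle.measurePreserving_mk 0).integrable_comp_of_integrable hw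

theorem integrable_smul_L2Per {φ : ℝ → ℂ} (hφ : Continuous φ) (hc : HasCompactSupport φ)
    (w : L2Per n) : Integrable (fun x : ℝ => φ x • w x) := by
  obtain ⟨R, hR0, hR⟩ := hc.isCompact.isBounded.subset_closedBall_lt 0 0
  have h1 : IntegrableOn (fun x : ℝ => w x) (Set.Icc (-R) R) := by
    have := intervalIntegrable_coe (integrable_L2Per w) (-R) R
    rwa [intervalIntegrable_iff_integrableOn_Icc_of_le (by linarith)] at this
  have h2 : IntegrableOn (fun x : ℝ => φ x • w x) (Set.Icc (-R) R) :=
    h1.continuousOn_smul hφ.continuousOn isCompact_Icc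
  refine (integrableOn_iff_integrable_of_support_subset fun x hx => ?_).1 h2
  have : x ∈ tsupport φ := subset_tsupport φ fun h => hx (by simp [h])
  have := hR this
  rw [Real.closedBall_eq_Icc] at this
  simpa using this

theorem norm_integral_smul_L2Per_le {φ : ℝ → ℂ} (hφ : Continuous φ) (hc : HasCompactSupport φ) :
    ∃ C, ∀ w : L2Per n, ‖∫ x : ℝ, φ x • w x‖ ≤ C * ‖w‖ := by
  obtain ⟨R, hR0, hR⟩ := hc.isCompact.isBounded.subset_closedBall_lt 0 0
  obtain ⟨N, hN⟩ := exists_nat_gt R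
  obtain ⟨B, hB⟩ := hc.exists_bound_of_continuous hφ
  have hB0 : 0 ≤ B := (norm_nonneg _).trans (hB 0)
  refine ⟨B * (2 * N), fun w => ?_⟩
  have hN0 : (0 : ℝ) ≤ N := N.cast_nonneg
  have h1 : ∀ a b, IntervalIntegrable (fun x : ℝ => ‖w x‖) volume a b := fun a b =>
    intervalIntegrable_coe (w := fun z => ‖w z‖) (integrable_L2Per w).norm a b
  have h2 : ∫ x in (-N : ℝ)..N, ‖w x‖ = 2 * N * ∫ z, ‖w z‖ := by
    have := (coe_circle_periodic (fun z => ‖w z‖)).intervalIntegral_add_zsmul_eq (2 * N : ℤ) (-N) h1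
    rw [UnitAddCircle.intervalIntegral_preimage (-N) (fun z => ‖w z‖)] at this
    simp only [zsmul_eq_mul] at this
    push_cast at this
    rw [← this]
    congr 1; ring
  have h3 : ∫ z, ‖w z‖ ≤ ‖w‖ := by
    have h4 := eLpNorm_le_eLpNorm_of_exponent_le (p := 1) (q := 2) one_le_two
      (Lp.aestronglyMeasurable w)
    rw [Lp.norm_def, integral_norm_eq_lintegral_enorm (Lp.aestronglyMeasurable w),
      ← eLpNorm_one_eq_lintegral_enorm]
    exact ENNReal.toReal_mono (Lp.eLpNorm_ne_top w) h4
  have hsupp : Function.support (fun x : ℝ => φ x • w x) ⊆ Set.Ioc (-N : ℝ) N := by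
    intro x hx
    have h4 : x ∈ tsupport φ := subset_tsupport φ fun h => hx (by simp [h])
    have h5 := hR h4
    rw [Real.closedBall_eq_Icc, zero_sub, zero_add] at h5
    exact ⟨by linarith [h5.1], by linarith [h5.2]⟩
  rw [← intervalIntegral.integral_eq_integral_of_support_subset hsupp]
  calc ‖∫ x in (-N : ℝ)..N, φ x • w x‖ ≤ ∫ x in (-N : ℝ)..N, B * ‖w x‖ := by
        refine intervalIntegral.norm_integral_le_of_norm_le (by linarith)
          (Eventually.of_forall fun x _ => ?_) ((h1 _ _).const_mul B)
        rw [norm_smul]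
        exact mul_le_mul_of_nonneg_right (hB x) (norm_nonneg _)
    _ = B * (2 * N) * ∫ z, ‖w z‖ := by rw [intervalIntegral.integral_const_mul, h2]; ring
    _ ≤ B * (2 * N) * ‖w‖ := by gcongr

/-- Pairing with a compactly supported continuous function, as a continuous linear map. -/
def testPairing {φ : ℝ → ℂ} (hφ : Continuous φ) (hc : HasCompactSupport φ) :
    L2Per n →L[ℂ] CVec n :=
  LinearMap.mkContinuousOfExistsBound
    { toFun := fun w => ∫ x : ℝ, φ x • w x
      map_add' := fun v w => by
        rw [← integral_add (integrable_smul_L2Per hφ hc v) (integrable_smul_L2Per hφ hc w)]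
        refine integral_congr_ae ?_
        filter_upwards [ae_circle_iff.1 (Lp.coeFn_add v w)] with x hx
        rw [hx, Pi.add_apply, smul_add]
      map_smul' := fun c w => by
        rw [RingHom.id_apply, ← integral_smul]
        refine integral_congr_ae ?_
        filter_upwards [ae_circle_iff.1 (Lp.coeFn_smul c w)] with x hx
        rw [hx, Pi.smul_apply, smul_comm] }
    (norm_integral_smul_L2Per_le hφ hc)

theorem testPairing_apply {φ : ℝ → ℂ} (hφ : Continuous φ) (hc : HasCompactSupport φ) (w : L2Per n) :
    testPairing hφ hc w = ∫ x : ℝ, φ x • w x := rfl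

/-- Weak derivatives can be tested against complex-valued functions. -/
theorem HasWeakDeriv.integral_smul {v w : L2Per n}
    (h : HasWeakDeriv (fun x : ℝ => v x) (fun x : ℝ => w x)) {φ : ℝ → ℂ} (hφ : ContDiff ℝ ∞ φ)
    (hc : HasCompactSupport φ) : ∫ x : ℝ, deriv φ x • v x = -∫ x : ℝ, φ x • w x := by
  have hre : ContDiff ℝ ∞ fun x => (φ x).re := Complex.reCLM.contDiff.comp hφ
  have him : ContDiff ℝ ∞ fun x => (φ x).im := Complex.imCLM.contDiff.comp hφ
  have hrec : HasCompactSupport fun x => (φ x).re := hc.comp_left (g := Complex.re) rfl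
  have himc : HasCompactSupport fun x => (φ x).im := hc.comp_left (g := Complex.im) rfl
  have hd : ∀ x, deriv φ x = (deriv (fun x => (φ x).re) x : ℝ) + (deriv (fun x => (φ x).im) x : ℝ)
      * Complex.I := by
    intro x
    have h1 := (hφ.differentiable (by simp)).differentiableAt.hasDerivAt (x := x)
    have h2 : HasDerivAt (fun x => (φ x).re) (deriv φ x).re x :=
      Complex.reCLM.hasFDerivAt.comp_hasDerivAt x h1
    have h3 : HasDerivAt (fun x => (φ x).im) (deriv φ x).im x :=
      Complex.imCLM.hasFDerivAt.comp_hasDerivAt x h1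
    rw [h2.deriv, h3.deriv, Complex.re_add_im]
  have key : ∀ {ψ : ℝ → ℝ}, ContDiff ℝ ∞ ψ → HasCompactSupport ψ → ∀ u : L2Per n,
      Integrable (fun x : ℝ => (ψ x : ℂ) • u x) := fun {ψ} h1 h2 u =>
    integrable_smul_L2Per (Complex.continuous_ofReal.comp h1.continuous)
      (h2.comp_left (g := fun x : ℝ => (x : ℂ)) Complex.ofReal_zero) u
  have hsplit : ∀ {ψ₁ ψ₂ : ℝ → ℝ}, ContDiff ℝ ∞ ψ₁ → HasCompactSupport ψ₁ → ContDiff ℝ ∞ ψ₂ →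
      HasCompactSupport ψ₂ → ∀ u : L2Per n,
      ∫ x : ℝ, ((ψ₁ x : ℂ) + ψ₂ x * Complex.I) • u x
        = (∫ x : ℝ, ψ₁ x • u x) + Complex.I • ∫ x : ℝ, ψ₂ x • u x := by
    intro ψ₁ ψ₂ h1 h2 h3 h4 u
    rw [← MeasureTheory.integral_smul]
    simp only [← Complex.coe_smul]
    have h5 : Integrable fun x : ℝ => Complex.I • (ψ₂ x : ℂ) • u x := (key h3 h4 u).smul Complex.I
    rw [← integral_add (key h1 h2 u) h5]
    congr 1; ext1 x
    rw [add_smul, mul_comm, mul_smul]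
  have hdc : ∀ {ψ : ℝ → ℝ}, ContDiff ℝ ∞ ψ → ContDiff ℝ ∞ (deriv ψ) := fun h =>
    ((contDiff_infty_iff_deriv (F := ℝ)).1 h).2
  simp only [hd]
  rw [hsplit (hdc hre) hrec.deriv (hdc him) himc.deriv, h _ hre hrec, h _ him himc]
  have h5 : (fun x : ℝ => φ x • w x) = fun x : ℝ =>
      (((φ x).re : ℂ) + (φ x).im * Complex.I) • w x := by
    ext1 x; rw [Complex.re_add_im]
  rw [h5, hsplit hre hrec him himc, neg_add, smul_neg]

/-- Classical derivatives are weak derivatives. -/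
theorem hasWeakDeriv_of_hasDerivAt {v v' : ℝ → CVec n} (h : ∀ x, HasDerivAt v (v' x) x)
    (hc : Continuous v') : HasWeakDeriv v v' := by
  intro φ hφ hφc
  have hv : Continuous v := continuous_iff_continuousAt.2 fun x => (h x).continuousAt
  have hφ' : ContDiff ℝ ∞ (deriv φ) := ((contDiff_infty_iff_deriv (F := ℝ)).1 hφ).2
  have h1 := integral_bilinear_hasDerivAt_right_eq_neg_left_of_integrable
    (L := ContinuousLinearMap.lsmul ℝ ℝ) (u := φ) (u' := deriv φ) (v := v) (v' := v')
    (fun x _ => (hφ.differentiable (by simp)).differentiableAt.hasDerivAt) (fun x _ => h x)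
    ((hφ.continuous.smul hc).integrable_of_hasCompactSupport hφc.smul_right)
    ((hφ'.continuous.smul hv).integrable_of_hasCompactSupport hφc.deriv.smul_right)
    ((hφ.continuous.smul hv).integrable_of_hasCompactSupport hφc.smul_right)
  simp only [ContinuousLinearMap.lsmul_apply] at h1
  rw [h1, neg_neg]

theorem HasWeakDeriv.congr_ae {v v' w w' : ℝ → CVec n} (h : HasWeakDeriv v w) (hv : v =ᵐ[volume] v')
    (hw : w =ᵐ[volume] w') : HasWeakDeriv v' w' := by
  intro φ hφ hφc
  rw [← integral_congr_ae (hv.mono fun x hx => congrArg (deriv φ x • ·) hx),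
    ← integral_congr_ae (hw.mono fun x hx => congrArg (φ x • ·) hx)]
  exact h φ hφ hφc

end L2Per

/-! ### The Fourier basis and weak derivatives -/

section FourierBasis

variable {n : ℕ}

/-- The function `x ↦ e^{2πijx} eᵢ` of `L²_per`, for `k = (j, i)`. -/
def fourierMode (k : ℤ × Fin n) : L2Per n :=
  ContinuousMap.toLp 2 volume ℂ
    ⟨fun z : UnitAddCircle => fourier k.1 z • EuclideanSpace.single k.2 (1 : ℂ),
      (map_continuous (fourier k.1)).smul continuous_const⟩

theorem coeFn_fourierMode (k : ℤ × Fin n) : ∀ᵐ z : UnitAddCircle,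
    fourierMode k z = fourier k.1 z • EuclideanSpace.single k.2 (1 : ℂ) :=
  ContinuousMap.coeFn_toLp _ _

theorem integrable_fourier_smul {E : Type*} [NormedAddCommGroup E] [NormedSpace ℂ E]
    {w : UnitAddCircle → E} (h : Integrable w) (j : ℤ) :
    Integrable fun z => fourier j z • w z := by
  rw [volume_circle] at h ⊢
  exact h.fourier_smul j

theorem fourierCoeff_eq_integral {E : Type*} [NormedAddCommGroup E] [NormedSpace ℂ E]
    (w : UnitAddCircle → E) (j : ℤ) : fourierCoeff w j = ∫ z, fourier (-j) z • w z := by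
  rw [fourierCoeff, volume_circle]

theorem ae_haarAddCircle_iff {P : UnitAddCircle → Prop} :
    (∀ᵐ z ∂(AddCircle.haarAddCircle (T := 1)), P z) ↔ ∀ᵐ z : UnitAddCircle, P z := by
  rw [volume_circle]

theorem fourierCoeff_apply (w : L2Per n) (j : ℤ) (i : Fin n) :
    fourierCoeff (fun z => w z) j i = fourierCoeff (fun z => w z i) j := by
  rw [fourierCoeff_eq_integral, fourierCoeff_eq_integral]
  exact (ContinuousLinearMap.integral_comp_comm (EuclideanSpace.proj (𝕜 := ℂ) i)
    (integrable_fourier_smul (integrable_L2Per w) (-j))).symm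

theorem inner_fourierMode (k : ℤ × Fin n) (w : L2Per n) :
    inner ℂ (fourierMode k) w = fourierCoeff (fun z => w z) k.1 k.2 := by
  rw [fourierCoeff_apply, L2.inner_def, fourierCoeff_eq_integral]
  refine integral_congr_ae ?_
  filter_upwards [coeFn_fourierMode k] with z hz
  rw [hz, inner_smul_left, EuclideanSpace.inner_single_left, map_one, one_mul, fourier_neg,
    smul_eq_mul]

theorem fourierCoeff_fourier (j k : ℤ) :
    fourierCoeff (fun z : UnitAddCircle => fourier k z) j = if j = k then 1 else 0 := by
  have h := orthonormal_iff_ite.1 (orthonormal_fourier (T := 1)) j k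
  rw [ContinuousMap.inner_toLp] at h
  rw [← h, fourierCoeff]
  congr 1; ext1 z
  rw [fourier_neg, smul_eq_mul, mul_comm]

theorem orthonormal_fourierMode : Orthonormal ℂ (fourierMode (n := n)) := by
  classical
  rw [orthonormal_iff_ite]
  rintro ⟨j, i⟩ ⟨k, l⟩
  rw [inner_fourierMode, fourierCoeff_apply]
  have h : fourierCoeff (fun z => fourierMode (k, l) z i) j
      = fourierCoeff ((EuclideanSpace.single l (1 : ℂ) i) • fun z : UnitAddCircle => fourier k z) j := by
    refine congrFun (fourierCoeff_congr_ae ?_) j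
    refine ae_haarAddCircle_iff.2 ?_
    filter_upwards [coeFn_fourierMode (k, l)] with z hz
    rw [hz, Pi.smul_apply, PiLp.smul_apply, smul_eq_mul, smul_eq_mul, mul_comm]
  rw [h, fourierCoeff.const_smul, fourierCoeff_fourier, PiLp.single_apply]
  by_cases h1 : i = l <;> by_cases h2 : j = k <;> simp [h1, h2]

theorem eq_zero_of_fourierCoeff_eq_zero {w : L2Per n}
    (h : ∀ j i, fourierCoeff (fun z => w z i) j = 0) : w = 0 := by
  have hz : ∀ i : Fin n, ∀ᵐ z, w z i = 0 := by
    intro i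
    have hm : MemLp (fun z => w z i) 2 (AddCircle.haarAddCircle (T := 1)) := by
      rw [← volume_circle]
      exact (EuclideanSpace.proj (𝕜 := ℂ) i).comp_memLp w
    have h1 : hm.toLp = 0 := by
      apply fourierBasis.repr.injective
      rw [map_zero]
      ext j
      rw [fourierBasis_repr]
      exact (congrFun (fourierCoeff_congr_ae hm.coeFn_toLp) j).trans (h j i)
    rw [← ae_haarAddCircle_iff]
    filter_upwards [hm.coeFn_toLp, (Lp.eq_zero_iff_ae_eq_zero.1 h1)] with z h2 h3
    rw [← h2, h3, Pi.zero_apply]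
  rw [Lp.eq_zero_iff_ae_eq_zero]
  filter_upwards [ae_all_iff.2 hz] with z h1
  ext i
  exact h1 i

/-- The Fourier basis of `L²_per([0,1]; ℂⁿ)`. -/
def modeBasis (n : ℕ) : HilbertBasis (ℤ × Fin n) ℂ (L2Per n) :=
  HilbertBasis.mkOfOrthogonalEqBot orthonormal_fourierMode <| by
    rw [Submodule.eq_bot_iff]
    intro w hw
    refine eq_zero_of_fourierCoeff_eq_zero fun j i => ?_
    rw [← fourierCoeff_apply, ← inner_fourierMode (j, i)]
    exact (Submodule.mem_orthogonal _ _).1 hw _ (Submodule.subset_span ⟨(j, i), rfl⟩)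

theorem coe_modeBasis : ⇑(modeBasis n) = fourierMode :=
  HilbertBasis.coe_mkOfOrthogonalEqBot _ _

theorem modeBasis_repr_apply (w : L2Per n) (k : ℤ × Fin n) :
    (modeBasis n).repr w k = fourierCoeff (fun z => w z) k.1 k.2 := by
  rw [HilbertBasis.repr_apply_apply, coe_modeBasis, inner_fourierMode]

theorem modeBasis_repr_eq_integral (w : L2Per n) (k : ℤ × Fin n) :
    (modeBasis n).repr w k
      = (∫ x in (0 : ℝ)..1, fourier (-k.1) (x : UnitAddCircle) • w x) k.2 := by
  rw [modeBasis_repr_apply, fourierCoeff_eq_intervalIntegral _ _ 0]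
  simp

end FourierBasis

/-! ### Weak derivatives of periodic functions -/

section WeakDeriv

variable {n : ℕ}

/-- A smooth bump supported in `[0, 2]` whose integer translates sum to one. -/
def unitBump (x : ℝ) : ℝ := Real.smoothTransition x - Real.smoothTransition (x - 1)

theorem contDiff_unitBump : ContDiff ℝ ∞ unitBump :=
  Real.smoothTransition.contDiff.sub
    (Real.smoothTransition.contDiff.comp (contDiff_id.sub contDiff_const))

theorem support_unitBump : Function.support unitBump ⊆ Set.Ioc 0 2 := by
  intro x hx
  by_contra h
  refine hx ?_
  rw [Set.mem_Ioc, not_and_or, not_lt, not_le] at h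
  unfold unitBump
  rcases h with h | h
  · rw [Real.smoothTransition.zero_of_nonpos h, Real.smoothTransition.zero_of_nonpos (by linarith),
      sub_zero]
  · rw [Real.smoothTransition.one_of_one_le (by linarith),
      Real.smoothTransition.one_of_one_le (by linarith), sub_self]

theorem unitBump_add {x : ℝ} (h0 : 0 ≤ x) (h1 : x ≤ 1) : unitBump x + unitBump (x + 1) = 1 := by
  unfold unitBump
  rw [Real.smoothTransition.zero_of_nonpos (x := x - 1) (by linarith),
    Real.smoothTransition.one_of_one_le (x := x + 1) (by linarith), add_sub_cancel_right]
  ring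

/-- A pairing over the line, folded onto one period. -/
theorem integral_smul_eq_intervalIntegral {φ : ℝ → ℂ} (hφ : Continuous φ)
    (hs : Function.support φ ⊆ Set.Ioc 0 2) (w : L2Per n) :
    ∫ x : ℝ, φ x • w x = ∫ x in (0 : ℝ)..1, (φ x + φ (x + 1)) • w x := by
  have hi : ∀ a b, IntervalIntegrable (fun x : ℝ => φ x • w x) volume a b := fun a b =>
    (intervalIntegrable_coe (integrable_L2Per w) a b).continuousOn_smul hφ.continuousOn
  have hs' : Function.support (fun x : ℝ => φ x • w x) ⊆ Set.Ioc 0 2 := fun x hx =>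
    hs fun h => hx (by simp [h])
  have hper : ∀ x : ℝ, w ((x + 1 : ℝ) : UnitAddCircle) = w x := coe_circle_periodic w
  have h2 := intervalIntegral.integral_comp_add_right (a := 0) (b := 1)
    (fun x : ℝ => φ x • w x) (1 : ℝ)
  simp only [hper] at h2
  rw [← intervalIntegral.integral_eq_integral_of_support_subset hs',
    ← intervalIntegral.integral_add_adjacent_intervals (hi 0 1) (hi 1 2)]
  simp only [add_smul]
  rw [intervalIntegral.integral_add (hi 0 1), h2]
  · norm_num
  · exact (intervalIntegrable_coe (integrable_L2Per w) 0 1).continuousOn_smul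
      (hφ.comp (continuous_id.add continuous_const)).continuousOn

theorem contDiff_fourier (j : ℤ) : ContDiff ℝ ∞ fun x : ℝ => fourier j (x : UnitAddCircle) := by
  simp only [fourier_coe_apply]
  exact ((contDiff_const.mul Complex.ofRealCLM.contDiff).div_const _).cexp

theorem hasDerivAt_fourierMode (j : ℤ) (x : ℝ) :
    HasDerivAt (fun x : ℝ => fourier j (x : UnitAddCircle))
      (2 * Real.pi * Complex.I * j * fourier j (x : UnitAddCircle)) x := by
  have := hasDerivAt_fourier 1 j x
  simpa using this

/-- The test function `unitBump · e^{-2πijx}` folds to `e^{-2πijx}` on one period, so that testing the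
weak derivative against it yields a Fourier coefficient. -/
theorem HasWeakDeriv.repr_eq {w w₁ : L2Per n}
    (h : HasWeakDeriv (fun x : ℝ => w x) (fun x : ℝ => w₁ x)) (k : ℤ × Fin n) :
    (modeBasis n).repr w₁ k = 2 * Real.pi * Complex.I * k.1 * (modeBasis n).repr w k := by
  set e : ℝ → ℂ := fun x => fourier (-k.1) (x : UnitAddCircle) with he
  set φ : ℝ → ℂ := fun x => (unitBump x : ℂ) * e x with hφ
  have hφs : ContDiff ℝ ∞ φ :=
    (Complex.ofRealCLM.contDiff.comp contDiff_unitBump).mul (contDiff_fourier _)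
  have hsub : Function.support φ ⊆ Set.Ioc 0 2 := fun x hx =>
    support_unitBump fun h => hx (by simp [hφ, h])
  have hc : HasCompactSupport φ :=
    HasCompactSupport.of_support_subset_isCompact isCompact_Icc
      (hsub.trans Set.Ioc_subset_Icc_self)
  have hsum : ∀ x ∈ Set.Icc (0 : ℝ) 1, φ x + φ (x + 1) = e x := by
    intro x hx
    have h1 : e (x + 1) = e x := coe_circle_periodic (fun z => fourier (-k.1) z) x
    have h2 : (unitBump x : ℂ) + unitBump (x + 1) = 1 := by
      exact_mod_cast unitBump_add hx.1 hx.2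
    simp only [hφ]
    rw [h1, ← add_mul, h2, one_mul]
  have hφd : ∀ x, HasDerivAt φ (deriv φ x) x := fun x =>
    ((hφs.differentiable (by simp)) x).hasDerivAt
  have hdsum : ∀ x ∈ Set.Ioo (0 : ℝ) 1, deriv φ x + deriv φ (x + 1)
      = -(2 * Real.pi * Complex.I * k.1) * e x := by
    intro x hx
    have h1 : HasDerivAt (fun x => φ x + φ (x + 1)) (deriv φ x + deriv φ (x + 1)) x :=
      (hφd x).add ((hφd (x + 1)).comp_add_const x 1)
    have h2 := hasDerivAt_fourierMode (-k.1) x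
    have h3 : (fun x => φ x + φ (x + 1)) =ᶠ[𝓝 x] e := by
      filter_upwards [Ioo_mem_nhds hx.1 hx.2] with y hy
      exact hsum y ⟨hy.1.le, hy.2.le⟩
    have h4 := h1.unique (h2.congr_of_eventuallyEq h3)
    rw [h4]
    push_cast
    ring
  have hsub' : Function.support (deriv φ) ⊆ Set.Ioc 0 2 := by
    have h1 : Function.support (deriv φ) ⊆ Set.Icc 0 2 :=
      (support_deriv_subset (f := φ)).trans
        (closure_minimal (hsub.trans Set.Ioc_subset_Icc_self) isClosed_Icc)
    intro x hx
    -- the derivative vanishes at the left endpoint, since `φ` vanishes to the left of it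
    refine ⟨lt_of_le_of_ne (h1 hx).1 fun h0 => hx ?_, (h1 hx).2⟩
    rw [← h0]
    have h5 : HasDerivWithinAt φ 0 (Set.Iic 0) 0 := by
      refine (hasDerivWithinAt_const (0 : ℝ) (Set.Iic (0 : ℝ)) (0 : ℂ)).congr (fun y hy => ?_) ?_
      · by_contra hne; exact absurd (hsub hne).1 (not_lt.2 hy)
      · by_contra hne; exact absurd (hsub hne).1 (lt_irrefl _)
    exact (uniqueDiffWithinAt_Iic 0).eq_deriv _ (hφd 0).hasDerivWithinAt h5
  have hdc : Continuous (deriv φ) := hφs.continuous_deriv (by simp)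
  have key := h.integral_smul hφs hc
  rw [integral_smul_eq_intervalIntegral hφs.continuous hsub,
    integral_smul_eq_intervalIntegral hdc hsub'] at key
  have h5 : ∫ x in (0 : ℝ)..1, (φ x + φ (x + 1)) • w₁ x = ∫ x in (0 : ℝ)..1, e x • w₁ x := by
    refine intervalIntegral.integral_congr fun x hx => ?_
    rw [Set.uIcc_of_le zero_le_one] at hx
    exact congrArg (· • w₁ x) (hsum x hx)
  have h6 : ∫ x in (0 : ℝ)..1, (deriv φ x + deriv φ (x + 1)) • w x
      = -(2 * Real.pi * Complex.I * k.1) • ∫ x in (0 : ℝ)..1, e x • w x := by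
    rw [← intervalIntegral.integral_smul]
    refine intervalIntegral.integral_congr_Ioo_of_le zero_le_one fun x hx => ?_
    change _ = -(2 * Real.pi * Complex.I * k.1) • e x • w x
    rw [smul_smul, ← hdsum x hx]
  rw [h5, h6, neg_smul, neg_inj] at key
  rw [modeBasis_repr_eq_integral, modeBasis_repr_eq_integral, ← smul_eq_mul, ← PiLp.smul_apply]
  exact congrArg (fun v : CVec n => v k.2) key.symm

/-- The weak derivative of the mode `(j, i)` is `2πij` times the mode. -/
theorem hasWeakDeriv_fourierMode (k : ℤ × Fin n) (φ : ℝ → ℝ) (hφ : ContDiff ℝ ∞ φ)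
    (hc : HasCompactSupport φ) :
    ∫ x : ℝ, deriv φ x • (fourierMode k : L2Per n) x
      = -((2 * Real.pi * Complex.I * k.1) • ∫ x : ℝ, φ x • (fourierMode k : L2Per n) x) := by
  have h1 : HasWeakDeriv (n := n)
      (fun x : ℝ => fourier k.1 (x : UnitAddCircle) • EuclideanSpace.single k.2 (1 : ℂ))
      (fun x : ℝ => (2 * Real.pi * Complex.I * k.1 * fourier k.1 (x : UnitAddCircle)) •
        EuclideanSpace.single k.2 (1 : ℂ)) :=
    hasWeakDeriv_of_hasDerivAt (fun x => (hasDerivAt_fourierMode k.1 x).smul_const _)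
      ((continuous_const.mul (contDiff_fourier k.1).continuous).smul continuous_const)
  have h2 := ae_circle_iff.1 (coeFn_fourierMode k)
  rw [← MeasureTheory.integral_smul, integral_congr_ae (h2.mono fun x hx => congrArg (deriv φ x • ·) hx),
    h1 φ hφ hc]
  congr 1
  refine integral_congr_ae (h2.mono fun x hx => ?_)
  simp only [hx]
  rw [smul_comm _ (φ x), mul_smul]

/-- On the Fourier side the weak derivative is multiplication by `2πij`. -/
theorem hasWeakDeriv_iff {w w₁ : L2Per n} :
    HasWeakDeriv (fun x : ℝ => w x) (fun x : ℝ => w₁ x) ↔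
      ∀ k, (modeBasis n).repr w₁ k = 2 * Real.pi * Complex.I * k.1 * (modeBasis n).repr w k := by
  refine ⟨fun h => h.repr_eq, fun h φ hφ hc => ?_⟩
  have hφ' : ContDiff ℝ ∞ (deriv φ) := ((contDiff_infty_iff_deriv (F := ℝ)).1 hφ).2
  have key : ∀ {ψ : ℝ → ℝ} (h1 : ContDiff ℝ ∞ ψ) (h2 : HasCompactSupport ψ) (u : L2Per n),
      HasSum (fun k => (modeBasis n).repr u k • ∫ x : ℝ, ψ x • (fourierMode k : L2Per n) x)
        (∫ x : ℝ, ψ x • u x) := fun {ψ} h1 h2 u => by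
    have := ((modeBasis n).hasSum_repr u).mapL (testPairing
      (Complex.continuous_ofReal.comp h1.continuous)
      (h2.comp_left (g := fun x : ℝ => (x : ℂ)) Complex.ofReal_zero))
    simp only [map_smul, coe_modeBasis, testPairing_apply, Function.comp_apply,
      Complex.coe_smul] at this
    exact this
  refine (key hφ' hc.deriv w).unique ?_
  have h1 := (key hφ hc w₁).neg
  convert h1 using 2 with k
  rw [hasWeakDeriv_fourierMode k φ hφ hc, h k, smul_neg, smul_smul, mul_comm]

end WeakDeriv

/-! ### The Bloch operators as compact perturbations of the identity -/

section BlochOperator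

variable {n : ℕ}

/-- The Fourier multiplier of `(1 + ∂ₓ)⁻¹`. -/
def resolventSymbol (n : ℕ) (k : ℤ × Fin n) : ℂ := (1 + 2 * Real.pi * Complex.I * k.1)⁻¹

theorem normSq_symbol (j : ℤ) :
    ‖(1 + 2 * Real.pi * Complex.I * j : ℂ)‖ ^ 2 = 1 + (2 * Real.pi * j) ^ 2 := by
  have : (1 + 2 * Real.pi * Complex.I * j : ℂ) = (1 : ℝ) + (2 * Real.pi * j : ℝ) * Complex.I := by
    push_cast; ring
  rw [this, ← Complex.normSq_eq_norm_sq, Complex.normSq_add_mul_I, one_pow]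

theorem one_le_norm_symbol (j : ℤ) : 1 ≤ ‖(1 + 2 * Real.pi * Complex.I * j : ℂ)‖ := by
  rw [← abs_of_nonneg (norm_nonneg (1 + 2 * Real.pi * Complex.I * j : ℂ)), ← one_le_sq_iff_one_le_abs,
    normSq_symbol]
  nlinarith [sq_nonneg (2 * Real.pi * j)]

theorem symbol_ne_zero (j : ℤ) : (1 + 2 * Real.pi * Complex.I * j : ℂ) ≠ 0 :=
  norm_pos_iff.1 (zero_lt_one.trans_le (one_le_norm_symbol j))

theorem resolventSymbol_bounded :
    ∃ B : ℝ, 0 ≤ B ∧ ∀ k, ‖resolventSymbol n k‖ ≤ B :=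
  ⟨1, zero_le_one, fun k => by
    rw [resolventSymbol, norm_inv]
    exact inv_le_one_of_one_le₀ (one_le_norm_symbol k.1)⟩

theorem tendsto_resolventSymbol : Tendsto (resolventSymbol n) cofinite (𝓝 0) := by
  have h1 : ∀ j : ℤ, |(j : ℝ)| ≤ ‖(1 + 2 * Real.pi * Complex.I * j : ℂ)‖ := fun j => by
    refine abs_le_of_sq_le_sq ?_ (norm_nonneg _)
    rw [normSq_symbol, mul_pow]
    have : 1 ≤ (2 * Real.pi) ^ 2 := by nlinarith [Real.pi_gt_three]
    nlinarith [sq_nonneg (j : ℝ)]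
  rw [tendsto_zero_iff_norm_tendsto_zero, Metric.tendsto_nhds]
  intro ε hε
  have hfin : {k : ℤ × Fin n | |(k.1 : ℝ)| ≤ ε⁻¹}.Finite := by
    refine ((Set.finite_Icc (-⌈ε⁻¹⌉) ⌈ε⁻¹⌉).prod (Set.finite_univ (α := Fin n))).subset fun k hk => ?_
    have hk' := abs_le.1 (show |(k.1 : ℝ)| ≤ ε⁻¹ from hk)
    refine ⟨⟨?_, ?_⟩, Set.mem_univ _⟩
    · have : (-⌈ε⁻¹⌉ : ℝ) ≤ k.1 := by linarith [Int.le_ceil ε⁻¹]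
      exact_mod_cast this
    · have : (k.1 : ℝ) ≤ ⌈ε⁻¹⌉ := by linarith [Int.le_ceil ε⁻¹]
      exact_mod_cast this
  refine hfin.subset fun k hk => ?_
  by_contra hc
  refine hk ?_
  simp only [Set.mem_ofPred_eq, not_le] at hc
  change dist ‖resolventSymbol n k‖ 0 < ε
  rw [dist_zero_right, norm_norm, resolventSymbol, norm_inv]
  exact inv_lt_of_inv_lt₀ hε (hc.trans_le (h1 k.1))

/-- The operator `(1 + ∂ₓ)⁻¹` on `L²_per`. -/
def resolventD (n : ℕ) : L2Per n →L[ℂ] L2Per n :=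
  ((modeBasis n).repr.symm.toContinuousLinearEquiv : _ →L[ℂ] _).comp
    ((diagMul 2 (resolventSymbol n) resolventSymbol_bounded).comp
      ((modeBasis n).repr.toContinuousLinearEquiv : _ →L[ℂ] _))

theorem repr_resolventD (w : L2Per n) (k : ℤ × Fin n) :
    (modeBasis n).repr (resolventD n w) k = resolventSymbol n k * (modeBasis n).repr w k := by
  change (modeBasis n).repr ((modeBasis n).repr.symm _) k = _
  rw [LinearIsometryEquiv.apply_symm_apply]
  rfl

theorem isCompactOperator_resolventD : IsCompactOperator (resolventD n) := by
  have h := isCompactOperator_diagMul (p := 2) (resolventSymbol n) resolventSymbol_bounded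
    tendsto_resolventSymbol
  have h2 := h.comp_clm
    ((modeBasis n).repr.toContinuousLinearEquiv : L2Per n →L[ℂ] lp (fun _ : ℤ × Fin n => ℂ) 2)
  exact h2.clm_comp
    ((modeBasis n).repr.symm.toContinuousLinearEquiv : lp (fun _ : ℤ × Fin n => ℂ) 2 →L[ℂ] L2Per n)

theorem hasWeakDeriv_iff_resolventD {w v : L2Per n} :
    HasWeakDeriv (fun x : ℝ => w x) (fun x : ℝ => v x) ↔ resolventD n (w + v) = w := by
  rw [hasWeakDeriv_iff, ← (modeBasis n).repr.injective.eq_iff, lp.ext_iff, funext_iff]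
  refine forall_congr' fun k => ?_
  rw [repr_resolventD, map_add, lp.coeFn_add, Pi.add_apply, resolventSymbol,
    inv_mul_eq_iff_eq_mul₀ (symbol_ne_zero k.1), add_mul, one_mul, add_right_inj]

/-- `(1 + ∂ₓ)⁻¹ w = 0` makes `w` the weak derivative of zero. -/
theorem resolventD_injective : Function.Injective (resolventD n) := by
  rw [injective_iff_map_eq_zero]
  intro w hw
  have h : HasWeakDeriv (fun x : ℝ => (0 : L2Per n) x) (fun x : ℝ => w x) := by
    rw [hasWeakDeriv_iff_resolventD, zero_add, hw]
  rw [hasWeakDeriv_iff] at h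
  apply (modeBasis n).repr.injective
  ext k
  rw [h k, map_zero]
  simp

/-- Multiplication by a continuous operator-valued function on the circle. -/
def mulOp {k : ℕ} (Φ : C(UnitAddCircle, CVec n →L[ℂ] CVec k)) : L2Per n →L[ℂ] L2Per k :=
  (ContinuousLinearMap.id ℂ (CVec n →L[ℂ] CVec k)).holderL volume ⊤ 2 2
    (ContinuousMap.toLp ⊤ volume ℂ Φ)

theorem coeFn_mulOp {k : ℕ} (Φ : C(UnitAddCircle, CVec n →L[ℂ] CVec k)) (w : L2Per n) :
    ∀ᵐ z, mulOp Φ w z = Φ z (w z) := by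
  have h1 := ContinuousLinearMap.coeFn_holder (r := 2) (ContinuousLinearMap.id ℂ (CVec n →L[ℂ] CVec k))
    (ContinuousMap.toLp ⊤ volume ℂ Φ) w
  filter_upwards [h1, ContinuousMap.coeFn_toLp (p := ⊤) (𝕜 := ℂ) volume Φ] with z hz hz2
  rw [← hz2]
  exact hz

/-- The continuous function on the circle given by a continuous periodic function. -/
def periodicMap {F : Type*} [TopologicalSpace F] {g : ℝ → F} (hg : Continuous g)
    (hp : Function.Periodic g 1) : C(UnitAddCircle, F) :=
  ⟨hp.lift, continuous_coinduced_dom.2 hg⟩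

theorem periodicMap_coe {F : Type*} [TopologicalSpace F] {g : ℝ → F} (hg : Continuous g)
    (hp : Function.Periodic g 1) (x : ℝ) : periodicMap hg hp (x : UnitAddCircle) = g x :=
  hp.lift_coe x

/-- The complexified Jacobian as a continuous linear map. -/
def jacobianCLM (f : RVec n → RVec n) (p : RVec n) : CVec n →L[ℂ] CVec n :=
  LinearMap.toContinuousLinearMap
    { toFun := jacobian f p
      map_add' := fun v w => by
        ext i
        simp [jacobian, mul_add, Finset.sum_add_distrib]
      map_smul' := fun a v => by
        ext i
        simp only [jacobian, PiLp.smul_apply, smul_eq_mul, RingHom.id_apply, Finset.mul_sum]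
        exact Finset.sum_congr rfl fun j _ => by ring }

theorem jacobianCLM_apply (f : RVec n → RVec n) (p : RVec n) (v : CVec n) :
    jacobianCLM f p v = jacobian f p v := rfl

theorem continuous_jacobianCLM {f : RVec n → RVec n} (hf : ContDiff ℝ 1 f) :
    Continuous (jacobianCLM f) := by
  rw [continuous_clm_apply]
  intro v
  simp only [jacobianCLM_apply, jacobian]
  refine (PiLp.continuous_toLp 2 _).comp (continuous_pi fun i => continuous_finsetSum _ fun j _ => ?_)
  have h1 : Continuous fun p => fderiv ℝ f p (EuclideanSpace.single j 1) :=
    (hf.continuous_fderiv (by simp)).clm_apply continuous_const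
  exact (Complex.continuous_ofReal.comp ((EuclideanSpace.proj (𝕜 := ℝ) i).continuous.comp h1)).mul
    continuous_const

theorem IsPeriodicProfile.continuous_jacobian {f : RVec n → RVec n} {c : ℝ} {u : ℝ → RVec n}
    (hu : IsPeriodicProfile f c u) (hf : ContDiff ℝ 1 f) :
    Continuous fun x => jacobianCLM f (u x) :=
  (continuous_jacobianCLM hf).comp hu.contDiff.continuous

theorem IsPeriodicProfile.periodic_jacobian {f : RVec n → RVec n} {c : ℝ} {u : ℝ → RVec n}
    (hu : IsPeriodicProfile f c u) : Function.Periodic (fun x => jacobianCLM f (u x)) 1 :=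
  fun x => congrArg (jacobianCLM f) (hu.periodic x)

/-- Multiplication by `df(u)` on `L²_per`. -/
def jacobianOp {f : RVec n → RVec n} {c : ℝ} {u : ℝ → RVec n} (hu : IsPeriodicProfile f c u)
    (hf : ContDiff ℝ 1 f) : L2Per n →L[ℂ] L2Per n :=
  mulOp (periodicMap (hu.continuous_jacobian hf) hu.periodic_jacobian)

theorem coeFn_jacobianOp {f : RVec n → RVec n} {c : ℝ} {u : ℝ → RVec n}
    (hu : IsPeriodicProfile f c u) (hf : ContDiff ℝ 1 f) (w : L2Per n) :
    ∀ᵐ x : ℝ, jacobianOp hu hf w x = jacobian f (u x) (w x) := by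
  filter_upwards [ae_circle_iff.1 (coeFn_mulOp (periodicMap (hu.continuous_jacobian hf) hu.periodic_jacobian) w)] with x hx
  rw [← jacobianCLM_apply]
  exact hx.trans (by rw [periodicMap_coe])

/-- The bounded operator `R_ξ` with `L_ξ (1 + ∂ₓ)⁻² = 1 + R_ξ (1 + ∂ₓ)⁻¹`, a polynomial in `ξ`. -/
def blochPerturbation {f : RVec n → RVec n} {c : ℝ} {u : ℝ → RVec n} (hu : IsPeriodicProfile f c u)
    (hf : ContDiff ℝ 1 f) (ξ : ℝ) : L2Per n →L[ℂ] L2Per n :=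
  ((c - 2 : ℂ) • 1 + (1 - c : ℂ) • resolventD n + (jacobianOp hu hf) ∘L (resolventD n))
    + (ξ : ℂ) • ((2 * Complex.I) • 1 + ((c - 2) * Complex.I) • resolventD n)
    + (ξ : ℂ) ^ 2 • (-resolventD n)

/-- The bounded operator `L_ξ (1 + ∂ₓ)⁻²`, a compact perturbation of the identity. -/
def blochOp {f : RVec n → RVec n} {c : ℝ} {u : ℝ → RVec n} (hu : IsPeriodicProfile f c u)
    (hf : ContDiff ℝ 1 f) (ξ : ℝ) : L2Per n →L[ℂ] L2Per n :=
  1 + (blochPerturbation hu hf ξ) ∘L (resolventD n)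

theorem ae_coeFn_bloch (a b d : ℂ) (w₂ w₁ w j : L2Per n) :
    ∀ᵐ x : ℝ, (w₂ + a • w₁ + b • w + d • w₁ + j : L2Per n) x
      = w₂ x + a • w₁ x + b • w x + d • w₁ x + j x := by
  filter_upwards [ae_circle_iff.1 (Lp.coeFn_add (w₂ + a • w₁ + b • w + d • w₁) j),
    ae_circle_iff.1 (Lp.coeFn_add (w₂ + a • w₁ + b • w) (d • w₁)),
    ae_circle_iff.1 (Lp.coeFn_add (w₂ + a • w₁) (b • w)),
    ae_circle_iff.1 (Lp.coeFn_add w₂ (a • w₁)), ae_circle_iff.1 (Lp.coeFn_smul d w₁),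
    ae_circle_iff.1 (Lp.coeFn_smul b w), ae_circle_iff.1 (Lp.coeFn_smul a w₁)]
    with x h1 h2 h3 h4 h5 h6 h7
  rw [h1, Pi.add_apply, h2, Pi.add_apply, h3, Pi.add_apply, h4, Pi.add_apply, h5, h6, h7]
  rfl

theorem ae_circle_eq_iff {v w : L2Per n} : (∀ᵐ x : ℝ, v x = w x) ↔ v = w :=
  ⟨fun h => Lp.ext (ae_circle_iff.2 h), fun h => by simp [h]⟩

/-- The graph of `L_ξ` in terms of operators on `L²_per`. -/
theorem blochGraph_iff {f : RVec n → RVec n} {c : ℝ} {u : ℝ → RVec n} (hu : IsPeriodicProfile f c u)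
    (hf : ContDiff ℝ 1 f) {ξ : ℝ} {w g : L2Per n} :
    BlochGraph f c u ξ w g ↔ ∃ w₁ w₂ : L2Per n,
      resolventD n (w + w₁) = w ∧ resolventD n (w₁ + w₂) = w₁ ∧
      g = w₂ + (2 * Complex.I * ξ) • w₁ + ((Complex.I * ξ) ^ 2 + c * (Complex.I * ξ)) • w
        + (c : ℂ) • w₁ + jacobianOp hu hf w := by
  refine exists_congr fun w₁ => exists_congr fun w₂ => ?_
  rw [hasWeakDeriv_iff_resolventD, hasWeakDeriv_iff_resolventD]
  refine and_congr_right fun _ => and_congr_right fun _ => ?_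
  have h1 := ae_coeFn_bloch (2 * Complex.I * ξ) ((Complex.I * ξ) ^ 2 + c * (Complex.I * ξ)) c w₂ w₁ w
    (jacobianOp hu hf w)
  have h2 := coeFn_jacobianOp hu hf w
  have h3 : ∀ᵐ x : ℝ, (w₂ x + (2 * Complex.I * ξ) • w₁ x + (Complex.I * ξ) ^ 2 • w x)
        + (c : ℂ) • (w₁ x + (Complex.I * ξ) • w x) + jacobian f (u x) (w x)
      = (w₂ + (2 * Complex.I * ξ) • w₁ + ((Complex.I * ξ) ^ 2 + c * (Complex.I * ξ)) • w
        + (c : ℂ) • w₁ + jacobianOp hu hf w : L2Per n) x := by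
    filter_upwards [h1, h2] with x hx1 hx2
    rw [hx1, hx2]
    module
  exact (eventually_congr (h3.mono fun x hx => by rw [hx])).trans ae_circle_eq_iff

/-- The domain of `L_ξ` is the range of `(1 + ∂ₓ)⁻²`. -/
theorem blochGraph_iff_exists {f : RVec n → RVec n} {c : ℝ} {u : ℝ → RVec n}
    (hu : IsPeriodicProfile f c u) (hf : ContDiff ℝ 1 f) {ξ : ℝ} {w g : L2Per n} :
    BlochGraph f c u ξ w g ↔ ∃ p : L2Per n,
      w = resolventD n (resolventD n p) ∧ g = blochOp hu hf ξ p := by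
  have key : ∀ p w₁ w₂ w: L2Per n, w = resolventD n (resolventD n p) →
      w₁ = resolventD n p - w → w₂ = p - w₁ - resolventD n p →
      w₂ + (2 * Complex.I * ξ) • w₁ + ((Complex.I * ξ) ^ 2 + c * (Complex.I * ξ)) • w
        + (c : ℂ) • w₁ + jacobianOp hu hf w = blochOp hu hf ξ p := by
    intro p w₁ w₂ w h1 h2 h3
    simp only [blochOp, blochPerturbation, _root_.add_apply, _root_.smul_apply,
      ContinuousLinearMap.comp_apply, one_apply_eq_self, _root_.neg_apply, ← h1, h3, h2,
      mul_pow, Complex.I_sq]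
    module
  rw [blochGraph_iff hu hf]
  constructor
  · rintro ⟨w₁, w₂, h1, h2, h3⟩
    have h4 : resolventD n (w + w₁ + (w₁ + w₂)) = w + w₁ := by rw [map_add, h1, h2]
    refine ⟨w + w₁ + (w₁ + w₂), by rw [h4, h1], ?_⟩
    rw [h3, key (w + w₁ + (w₁ + w₂)) w₁ w₂ w (by rw [h4, h1]) (by rw [h4]; abel)
      (by rw [h4]; abel)]
  · rintro ⟨p, rfl, rfl⟩
    refine ⟨resolventD n p - resolventD n (resolventD n p),
      p - (resolventD n p - resolventD n (resolventD n p)) - resolventD n p, ?_, ?_,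
      (key p _ _ _ rfl rfl rfl).symm⟩
    · rw [add_sub_cancel]
    · rw [show resolventD n p - resolventD n (resolventD n p) +
        (p - (resolventD n p - resolventD n (resolventD n p)) - resolventD n p)
        = p - resolventD n p by abel, map_sub]

end BlochOperator

/-! ### Analytic continuation of a simple eigenvalue -/

section Branch

variable {X : Type*} [NormedAddCommGroup X] [NormedSpace ℂ X]

/-- The operator `A` bordered by a vector and a functional:
`(p, κ) ↦ (A p + κ s, φ p)`. -/
def bordered (s : X) (φ : X →L[ℂ] ℂ) (A : X →L[ℂ] X) : X × ℂ →L[ℂ] X × ℂ :=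
  (A ∘L ContinuousLinearMap.fst ℂ X ℂ
    + (ContinuousLinearMap.toSpanSingleton ℂ s) ∘L ContinuousLinearMap.snd ℂ X ℂ).prod
    (φ ∘L ContinuousLinearMap.fst ℂ X ℂ)

theorem bordered_apply (s : X) (φ : X →L[ℂ] ℂ) (A : X →L[ℂ] X) (v : X × ℂ) :
    bordered s φ A v = (A v.1 + v.2 • s, φ v.1) := rfl

/-- The Fredholm alternative for a bordered compact perturbation of the identity. -/
theorem isUnit_bordered [CompleteSpace X] (s : X) (φ : X →L[ℂ] ℂ) {K : X →L[ℂ] X}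
    (hK : IsCompactOperator K)
    (hinj : ∀ (p : X) (κ : ℂ), p + K p + κ • s = 0 → φ p = 0 → p = 0 ∧ κ = 0) :
    IsUnit (bordered s φ (1 + K)) := by
  have hcomp : IsCompactOperator
      (bordered s φ (1 + K) - 1 : X × ℂ →L[ℂ] X × ℂ) := by
    have h1 : IsCompactOperator (ContinuousLinearMap.snd ℂ X ℂ) :=
      isCompactOperator_of_locallyCompactSpace_dom _
    have h2 : IsCompactOperator φ := isCompactOperator_of_locallyCompactSpace_dom φ
    have h : bordered s φ (1 + K) - 1
        = (ContinuousLinearMap.inl ℂ X ℂ) ∘L (K ∘L ContinuousLinearMap.fst ℂ X ℂ)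
          + ((ContinuousLinearMap.inl ℂ X ℂ) ∘L ContinuousLinearMap.toSpanSingleton ℂ s)
            ∘L ContinuousLinearMap.snd ℂ X ℂ
          + (ContinuousLinearMap.inr ℂ X ℂ) ∘L (φ ∘L ContinuousLinearMap.fst ℂ X ℂ)
          - (ContinuousLinearMap.inr ℂ X ℂ) ∘L ContinuousLinearMap.snd ℂ X ℂ := by
      ext v <;> simp [bordered]
    have k1 : IsCompactOperator
        ((ContinuousLinearMap.inl ℂ X ℂ) ∘L (K ∘L ContinuousLinearMap.fst ℂ X ℂ)) :=
      (hK.comp_clm (ContinuousLinearMap.fst ℂ X ℂ)).clm_comp (ContinuousLinearMap.inl ℂ X ℂ)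
    have k2 : IsCompactOperator
        (((ContinuousLinearMap.inl ℂ X ℂ) ∘L ContinuousLinearMap.toSpanSingleton ℂ s)
          ∘L ContinuousLinearMap.snd ℂ X ℂ) :=
      h1.clm_comp ((ContinuousLinearMap.inl ℂ X ℂ) ∘L ContinuousLinearMap.toSpanSingleton ℂ s)
    have k3 : IsCompactOperator
        ((ContinuousLinearMap.inr ℂ X ℂ) ∘L (φ ∘L ContinuousLinearMap.fst ℂ X ℂ)) :=
      (h2.comp_clm (ContinuousLinearMap.fst ℂ X ℂ)).clm_comp (ContinuousLinearMap.inr ℂ X ℂ)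
    have k4 : IsCompactOperator
        ((ContinuousLinearMap.inr ℂ X ℂ) ∘L ContinuousLinearMap.snd ℂ X ℂ) :=
      h1.clm_comp (ContinuousLinearMap.inr ℂ X ℂ)
    rw [h]
    exact ((k1.add k2).add k3).sub k4
  rcases hcomp.hasEigenvalue_or_mem_resolventSet (μ := -1) (by norm_num) with h | h
  · exfalso
    obtain ⟨v, hv⟩ := h.exists_hasEigenvector
    have h1 : bordered s φ (1 + K) v - v = (-1 : ℂ) • v := hv.apply_eq_smul
    rw [neg_one_smul, sub_eq_neg_self, bordered_apply, Prod.mk_eq_zero] at h1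
    obtain ⟨h2, h3⟩ := hinj v.1 v.2 h1.1 h1.2
    exact hv.2 (Prod.ext h2 h3)
  · have h1 : IsUnit (algebraMap ℂ (X × ℂ →L[ℂ] X × ℂ) (-1) - (bordered s φ (1 + K) - 1)) := h
    rw [map_neg, map_one] at h1
    have h2 := h1.neg
    have h3 : -(-1 - (bordered s φ (1 + K) - 1)) = bordered s φ (1 + K) := by abel
    rwa [h3] at h2

/-- The linear part of the affine map `A ↦ bordered s φ A`. -/
def borderedLinear (X : Type*) [NormedAddCommGroup X] [NormedSpace ℂ X] :
    (X →L[ℂ] X) →L[ℂ] (X × ℂ →L[ℂ] X × ℂ) :=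
  (ContinuousLinearMap.compL ℂ (X × ℂ) X (X × ℂ) (ContinuousLinearMap.inl ℂ X ℂ)) ∘L
    ((ContinuousLinearMap.compL ℂ (X × ℂ) X X).flip (ContinuousLinearMap.fst ℂ X ℂ))

theorem bordered_eq (s : X) (φ : X →L[ℂ] ℂ) (A : X →L[ℂ] X) :
    bordered s φ A = borderedLinear X A + bordered s φ 0 := by
  ext v <;> simp [bordered, borderedLinear]

/-- If the bordered operator is invertible at `ξ = 0`, a right and a left null vector of the
pencil `T(ξ) - λ S` continue analytically: `κ(ξ, λ)`, the last component of the preimage of `(0, 1)`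
under the bordered operator, satisfies `κ(0, λ) = λ`, so that the equation `κ(ξ, λ) = 0` can be
solved for `λ`. -/
theorem exists_analytic_eigenvalue_branch [CompleteSpace X] {T : ℝ → X →L[ℂ] X} {S : X →L[ℂ] X}
    (hT : AnalyticAt ℝ T 0) {p₀ : X} {φ : X →L[ℂ] ℂ} (hφ : φ p₀ = 1) (hp₀ : T 0 p₀ = 0)
    (hunit : IsUnit (bordered (S p₀) φ (T 0))) :
    ∃ (lam : ℝ → ℂ) (p : ℝ → X) (l : ℝ → X →L[ℂ] ℂ),
      AnalyticAt ℝ lam 0 ∧ AnalyticAt ℝ p 0 ∧ AnalyticAt ℝ l 0 ∧ lam 0 = 0 ∧ p 0 = p₀ ∧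
      l 0 (S p₀) = 1 ∧
      (∀ᶠ ξ in 𝓝 0, T ξ (p ξ) = lam ξ • S (p ξ)) ∧
      ∀ᶠ ξ in 𝓝 0, ∀ v, l ξ (T ξ v) = lam ξ * l ξ (S v) := by
  -- the bordered pencil is analytic and invertible near the origin
  set 𝔅 : ℝ × ℂ → X × ℂ →L[ℂ] X × ℂ := fun z => bordered (S p₀) φ (T z.1 - z.2 • S) with h𝔅
  have hu0 : IsUnit (𝔅 0) := by simpa [h𝔅] using hunit
  have han : AnalyticAt ℝ 𝔅 0 := by
    have h1 : AnalyticAt ℝ (fun z : ℝ × ℂ => T z.1 - z.2 • S) 0 := by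
      refine AnalyticAt.sub ?_ ?_
      · exact AnalyticAt.comp (f := fun z : ℝ × ℂ => z.1) hT analyticAt_fst
      · exact (((ContinuousLinearMap.toSpanSingleton ℂ S).restrictScalars ℝ).analyticAt _).comp
          (f := fun z : ℝ × ℂ => z.2) analyticAt_snd
    have h2 : 𝔅 = fun z => borderedLinear X (T z.1 - z.2 • S) + bordered (S p₀) φ 0 := by
      funext z; exact bordered_eq _ _ _
    rw [h2]
    exact ((((borderedLinear X).restrictScalars ℝ).analyticAt _).comp h1).add analyticAt_const
  have hinv : AnalyticAt ℝ (fun z => Ring.inverse (𝔅 z)) 0 := by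
    obtain ⟨U, hU⟩ := hu0
    have h1 : AnalyticAt ℂ Ring.inverse (𝔅 0) := hU ▸ analyticAt_inverse (𝕜 := ℂ) U
    exact (h1.restrictScalars (𝕜 := ℝ)).comp han
  have hev : ∀ᶠ z in 𝓝 (0 : ℝ × ℂ), IsUnit (𝔅 z) :=
    han.continuousAt.eventually (Units.isOpen.mem_nhds hu0)
  have hmul : ∀ z, IsUnit (𝔅 z) → ∀ v, 𝔅 z (Ring.inverse (𝔅 z) v) = v := fun z hz v =>
    congrArg (fun A : X × ℂ →L[ℂ] X × ℂ => A v) (Ring.mul_inverse_cancel _ hz)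
  have hmul' : ∀ z, IsUnit (𝔅 z) → ∀ v, Ring.inverse (𝔅 z) (𝔅 z v) = v := fun z hz v =>
    congrArg (fun A : X × ℂ →L[ℂ] X × ℂ => A v) (Ring.inverse_mul_cancel _ hz)
  set E : ℝ × ℂ → X × ℂ := fun z => Ring.inverse (𝔅 z) (0, 1) with hE
  have hEan : AnalyticAt ℝ E 0 :=
    (((ContinuousLinearMap.apply ℂ (X × ℂ) ((0 : X), (1 : ℂ))).restrictScalars ℝ).analyticAt _).comp
      hinv
  have hE0 : ∀ μ : ℂ, IsUnit (𝔅 (0, μ)) → E (0, μ) = (p₀, μ) := by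
    intro μ hμ
    have h1 : 𝔅 (0, μ) (p₀, μ) = (0, 1) := by
      simp [h𝔅, bordered_apply, hp₀, hφ]
    rw [hE]
    simp only
    rw [← h1, hmul' _ hμ]
  have hκan : AnalyticAt ℝ (fun z => (E z).2) 0 := analyticAt_snd.comp hEan
  set F : ℝ × ℂ → ℝ × ℂ := fun z => (z.1, (E z).2) with hF
  have hFan : AnalyticAt ℝ F 0 := analyticAt_fst.prod hκan
  have hF0 : F 0 = 0 := by
    have h1 := hE0 0 hu0
    rw [hF]
    simp only
    rw [show (0 : ℝ × ℂ) = (0, 0) from rfl, h1]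
  -- the derivative of `F` is injective since `κ(0, λ) = λ`
  have hker : ∀ z, fderiv ℝ F 0 z = 0 → z = 0 := by
    intro z hz
    have h1 : fderiv ℝ F 0 = (ContinuousLinearMap.fst ℝ ℝ ℂ).prod
        (fderiv ℝ (fun z => (E z).2) 0) :=
      (hasFDerivAt_fst.prodMk hκan.differentiableAt.hasFDerivAt).fderiv
    rw [h1] at hz
    have h2 : z.1 = 0 := congrArg Prod.fst hz
    have h3 : fderiv ℝ (fun z => (E z).2) 0 z = 0 := congrArg Prod.snd hz
    have h4 : HasFDerivAt (fun μ : ℂ => (E (0, μ)).2)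
        ((fderiv ℝ (fun z => (E z).2) 0) ∘L (ContinuousLinearMap.inr ℝ ℝ ℂ)) 0 :=
      HasFDerivAt.comp (g := fun z => (E z).2) (f := fun μ : ℂ => ((0 : ℝ), μ)) (0 : ℂ)
        hκan.differentiableAt.hasFDerivAt (ContinuousLinearMap.inr ℝ ℝ ℂ).hasFDerivAt
    have h5 : (fun μ : ℂ => (E (0, μ)).2) =ᶠ[𝓝 0] id := by
      have hc : Tendsto (fun μ : ℂ => ((0 : ℝ), μ)) (𝓝 0) (𝓝 0) :=
        (Continuous.prodMk_right (0 : ℝ)).tendsto' _ _ rfl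
      filter_upwards [hc.eventually hev] with μ hμ
      rw [hE0 μ hμ, id]
    have h6 := (h4.congr_of_eventuallyEq h5.symm).unique (hasFDerivAt_id (0 : ℂ))
    have h7 : z = (ContinuousLinearMap.inr ℝ ℝ ℂ) z.2 := Prod.ext h2 rfl
    have h8 : z.2 = 0 := by
      rw [h7] at h3
      have := congrArg (fun A : ℂ →L[ℝ] ℂ => A z.2) h6
      exact this.symm.trans h3
    exact Prod.ext h2 h8
  set F' : (ℝ × ℂ) ≃L[ℝ] (ℝ × ℂ) :=
    (LinearEquiv.ofInjectiveEndo (fderiv ℝ F 0 : ℝ × ℂ →ₗ[ℝ] ℝ × ℂ)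
      (LinearMap.ker_eq_bot.1 (LinearMap.ker_eq_bot'.2 hker))).toContinuousLinearEquiv with hF'
  have hF'eq : fderiv ℝ F 0 = (F' : ℝ × ℂ →L[ℝ] ℝ × ℂ) := by ext <;> rfl
  have hstrict : HasStrictFDerivAt F (F' : ℝ × ℂ →L[ℝ] ℝ × ℂ) 0 := by
    rw [← hF'eq]
    exact hFan.hasStrictFDerivAt
  set Φ := hstrict.toOpenPartialHomeomorph F with hΦ
  have hΦ0 : (0 : ℝ × ℂ) ∈ Φ.source := hstrict.mem_toOpenPartialHomeomorph_source
  have hΦF : (Φ : ℝ × ℂ → ℝ × ℂ) = F := hstrict.toOpenPartialHomeomorph_coe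
  have hgan : AnalyticAt ℝ Φ.symm 0 := by
    have h1 := Φ.analyticAt_symm' (i := F') hΦ0 (by rw [hΦF]; exact hFan) (by rw [hΦF]; exact hF'eq)
    rwa [hΦF, hF0] at h1
  have hg0 : Φ.symm 0 = 0 := by
    have h1 := Φ.left_inv hΦ0
    rwa [hΦF, hF0] at h1
  have hgev : ∀ᶠ z in 𝓝 (0 : ℝ × ℂ), F (Φ.symm z) = z := by
    have h1 : Φ.target ∈ 𝓝 (0 : ℝ × ℂ) :=
      Φ.open_target.mem_nhds (by have h2 := Φ.map_source hΦ0; rwa [hΦF, hF0] at h2)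
    filter_upwards [h1] with z hz
    rw [← hΦF]
    exact Φ.right_inv hz
  have hι : AnalyticAt ℝ (fun ξ : ℝ => (ξ, (0 : ℂ))) 0 := analyticAt_id.prod analyticAt_const
  have hlan : AnalyticAt ℝ (fun ξ : ℝ => (Φ.symm (ξ, 0)).2) 0 :=
    analyticAt_snd.comp (AnalyticAt.comp (g := Φ.symm) (f := fun ξ : ℝ => (ξ, (0 : ℂ))) hgan hι)
  set lam : ℝ → ℂ := fun ξ => (Φ.symm (ξ, 0)).2 with hlam
  have hlam0 : lam 0 = 0 := by
    rw [hlam]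
    simp only
    rw [show ((0 : ℝ), (0 : ℂ)) = 0 from rfl, hg0]
    rfl
  have hζan : AnalyticAt ℝ (fun ξ : ℝ => (ξ, lam ξ)) 0 := analyticAt_id.prod hlan
  have hζ0 : ((0 : ℝ), lam 0) = 0 := by rw [hlam0]; rfl
  have hζt : Tendsto (fun ξ : ℝ => (ξ, lam ξ)) (𝓝 0) (𝓝 0) := by
    have := hζan.continuousAt.tendsto
    rwa [hζ0] at this
  have hcomp : ∀ {Y : Type _} [NormedAddCommGroup Y] [NormedSpace ℝ Y] {k : ℝ × ℂ → Y},
      AnalyticAt ℝ k 0 → AnalyticAt ℝ (fun ξ : ℝ => k (ξ, lam ξ)) 0 := fun {Y} _ _ {k} hk =>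
    AnalyticAt.comp (g := k) (f := fun ξ : ℝ => (ξ, lam ξ)) (by rwa [hζ0]) hζan
  have hκ0 : ∀ᶠ ξ in 𝓝 (0 : ℝ), (E (ξ, lam ξ)).2 = 0 := by
    have h1 : Tendsto (fun ξ : ℝ => (ξ, (0 : ℂ))) (𝓝 0) (𝓝 0) := hι.continuousAt.tendsto
    filter_upwards [h1.eventually hgev] with ξ hξ
    have h2 : (Φ.symm (ξ, 0)).1 = ξ := congrArg Prod.fst hξ
    have h3 : (E (Φ.symm (ξ, 0))).2 = 0 := congrArg Prod.snd hξ
    have h4 : Φ.symm (ξ, 0) = (ξ, lam ξ) := Prod.ext h2 rfl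
    rwa [h4] at h3
  set Λ : (X × ℂ →L[ℂ] X × ℂ) →L[ℂ] (X →L[ℂ] ℂ) :=
    (ContinuousLinearMap.compL ℂ X (X × ℂ) ℂ (ContinuousLinearMap.snd ℂ X ℂ)) ∘L
      ((ContinuousLinearMap.compL ℂ X (X × ℂ) (X × ℂ)).flip (ContinuousLinearMap.inl ℂ X ℂ)) with hΛ
  have hΛa : ∀ A v, Λ A v = (A (v, 0)).2 := fun A v => by simp [hΛ]
  -- where `κ = 0`, the preimage of `(0, 1)` is a right null vector, and the last component of the
  -- inverse, restricted to the first factor, is a left null vector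
  refine ⟨lam, fun ξ => (E (ξ, lam ξ)).1, fun ξ => Λ (Ring.inverse (𝔅 (ξ, lam ξ))), hlan,
    hcomp (analyticAt_fst.comp hEan), hcomp (((Λ.restrictScalars ℝ).analyticAt _).comp hinv),
    hlam0, ?_, ?_, ?_, ?_⟩
  · simp only
    rw [hlam0, hE0 0 hu0]
  · simp only
    rw [hlam0, hΛa]
    have h1 : 𝔅 0 (0, 1) = (S p₀, 0) := by simp [h𝔅, bordered_apply]
    rw [← h1, show ((0 : ℝ), (0 : ℂ)) = 0 from rfl, hmul' _ hu0]
  · filter_upwards [hκ0, hζt.eventually hev] with ξ h1 h2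
    have h3 := hmul _ h2 (0, 1)
    have h4 : E (ξ, lam ξ) = ((E (ξ, lam ξ)).1, 0) := Prod.ext rfl h1
    change 𝔅 (ξ, lam ξ) (E (ξ, lam ξ)) = _ at h3
    rw [h4] at h3
    have h5 := congrArg Prod.fst h3
    simp only [h𝔅, bordered_apply, zero_smul, add_zero, _root_.sub_apply, _root_.smul_apply] at h5
    exact sub_eq_zero.1 h5
  · filter_upwards [hκ0, hζt.eventually hev] with ξ h1 h2 v
    have h3 : 𝔅 (ξ, lam ξ) (v, 0) = ((T ξ - lam ξ • S) v, 0) + φ v • ((0, 1) : X × ℂ) := by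
      simp [h𝔅, bordered_apply]
    have h4 := hmul' _ h2 (v, 0)
    rw [h3, map_add, map_smul] at h4
    have h5 := congrArg Prod.snd h4
    have h6 : (Ring.inverse (𝔅 (ξ, lam ξ)) (0, 1)).2 = 0 := h1
    rw [Prod.snd_add, Prod.smul_snd, h6, smul_zero, add_zero, ← hΛa, _root_.sub_apply, map_sub,
      _root_.smul_apply, map_smul, smul_eq_mul] at h5
    exact sub_eq_zero.1 h5

end Branch

/-! ### Existence of an analytic critical mode -/

section Existence

variable {n : ℕ}

/-- The inclusion `ℝⁿ ⊆ ℂⁿ` as a real-linear map. -/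
def cvecCLM (n : ℕ) : RVec n →L[ℝ] CVec n :=
  LinearMap.toContinuousLinearMap
    { toFun := cvec
      map_add' := fun v w => by ext i; simp [cvec]
      map_smul' := fun a v => by ext i; simp [cvec] }

theorem continuous_cvec : Continuous (cvec (n := n)) := (cvecCLM n).continuous

theorem cvec_apply (v : RVec n) (i : Fin n) : cvec v i = (v i : ℂ) := rfl

theorem jacobian_cvec (f : RVec n → RVec n) (p v : RVec n) :
    jacobian f p (cvec v) = cvec (fderiv ℝ f p v) := by
  ext i
  have h : v = ∑ j, v j • EuclideanSpace.single j (1 : ℝ) := by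
    ext i; simp [Finset.sum_apply, Pi.single_apply]
  conv_rhs => rw [h, map_sum, cvec_apply]
  simp [jacobian, cvec_apply, mul_comm]

/-- The element of `L²_per` given by a continuous periodic function. -/
def periodicLp {g : ℝ → CVec n} (hg : Continuous g) (hp : Function.Periodic g 1) : L2Per n :=
  ContinuousMap.toLp 2 volume ℂ (periodicMap hg hp)

theorem coeFn_periodicLp {g : ℝ → CVec n} (hg : Continuous g) (hp : Function.Periodic g 1) :
    ∀ᵐ x : ℝ, periodicLp hg hp x = g x := by
  filter_upwards [ae_circle_iff.1
    (ContinuousMap.coeFn_toLp (p := 2) (𝕜 := ℂ) volume (periodicMap hg hp))] with x hx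
  rw [← periodicMap_coe hg hp x]
  exact hx

namespace IsPeriodicProfile

variable {f : RVec n → RVec n} {c : ℝ} {u : ℝ → RVec n}

theorem hasDerivAt (hu : IsPeriodicProfile f c u) (x : ℝ) : HasDerivAt u (deriv u x) x :=
  (hu.contDiff.differentiable (by norm_num) x).hasDerivAt

theorem contDiff_deriv (hu : IsPeriodicProfile f c u) : ContDiff ℝ 1 (deriv u) :=
  (contDiff_succ_iff_deriv.1 (by simpa [one_add_one_eq_two] using hu.contDiff :
    ContDiff ℝ (1 + 1) u)).2.2

theorem hasDerivAt_deriv (hu : IsPeriodicProfile f c u) (x : ℝ) :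
    HasDerivAt (deriv u) (deriv (deriv u) x) x :=
  (hu.contDiff_deriv.differentiable (by norm_num) x).hasDerivAt

theorem continuous_deriv_deriv (hu : IsPeriodicProfile f c u) : Continuous (deriv (deriv u)) :=
  hu.contDiff_deriv.continuous_deriv le_rfl

/-- By the profile equation `u''` is differentiable, although `u` is only assumed to be `C²`. -/
theorem hasDerivAt_deriv_deriv (hu : IsPeriodicProfile f c u) (hf : ContDiff ℝ 1 f) (x : ℝ) :
    HasDerivAt (deriv (deriv u)) (-(c • deriv (deriv u) x) - fderiv ℝ f (u x) (deriv u x)) x := by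
  have h1 : deriv (deriv u) = fun x => -(c • deriv u x) - f (u x) := by
    funext y
    have := hu.stationary y
    rw [add_assoc] at this
    rw [eq_neg_of_add_eq_zero_left this, neg_add, sub_eq_add_neg]
  have h2 : HasDerivAt (fun x => f (u x)) (fderiv ℝ f (u x) (deriv u x)) x :=
    (hf.differentiable (by norm_num) (u x)).hasFDerivAt.comp_hasDerivAt x (hu.hasDerivAt x)
  have h3 := ((hu.hasDerivAt_deriv x).const_smul c).neg.sub h2
  exact h3.congr_of_eventuallyEq (Eventually.of_forall fun y => congrFun h1 y)

theorem periodic_deriv (hu : IsPeriodicProfile f c u) : Function.Periodic (deriv u) 1 := fun x => by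
  rw [← deriv_comp_add_const]
  congr 1
  exact funext hu.periodic

theorem periodic_deriv_deriv (hu : IsPeriodicProfile f c u) :
    Function.Periodic (deriv (deriv u)) 1 := fun x => by
  rw [← deriv_comp_add_const]
  congr 1
  exact funext hu.periodic_deriv

/-- The derivative `u'` of the profile as an element of `L²_per`. -/
def derivLp (hu : IsPeriodicProfile f c u) : L2Per n :=
  periodicLp (continuous_cvec.comp hu.contDiff_deriv.continuous) (hu.periodic_deriv.comp cvec)

theorem coeFn_derivLp (hu : IsPeriodicProfile f c u) :
    ∀ᵐ x : ℝ, hu.derivLp x = cvec (deriv u x) :=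
  coeFn_periodicLp _ _

theorem derivLp_ne_zero (hu : IsPeriodicProfile f c u) : hu.derivLp ≠ 0 := by
  intro h
  obtain ⟨x, hx⟩ := hu.nonconstant
  have h1 : (fun x => cvec (deriv u x)) =ᵐ[volume] fun _ => 0 := by
    filter_upwards [hu.coeFn_derivLp, ae_circle_iff.1 (Lp.eq_zero_iff_ae_eq_zero.1 h)] with x h1 h2
    rw [← h1, h2, Pi.zero_apply]
  have h2 := (Continuous.ae_eq_iff_eq volume
    (continuous_cvec.comp hu.contDiff_deriv.continuous) continuous_const).1 h1
  refine hx ?_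
  ext i
  have := congrArg (fun v : CVec n => v i) (congrFun h2 x)
  simpa [cvec_apply] using this

/-- Translation invariance: `L_0 u' = 0`. -/
theorem blochGraph_derivLp (hu : IsPeriodicProfile f c u) (hf : ContDiff ℝ 1 f) :
    BlochGraph f c u 0 hu.derivLp 0 := by
  have hc3 : Continuous fun x => -(c • deriv (deriv u) x) - fderiv ℝ f (u x) (deriv u x) :=
    (hu.continuous_deriv_deriv.const_smul c).neg.sub
      (((hf.continuous_fderiv (by norm_num)).comp hu.contDiff.continuous).clm_apply
        hu.contDiff_deriv.continuous)
  have hp3 : Function.Periodic (fun x => -(c • deriv (deriv u) x) - fderiv ℝ f (u x) (deriv u x)) 1 :=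
    fun x => by simp only [hu.periodic x, hu.periodic_deriv x, hu.periodic_deriv_deriv x]
  refine ⟨periodicLp (continuous_cvec.comp hu.continuous_deriv_deriv)
    (hu.periodic_deriv_deriv.comp cvec),
    periodicLp (continuous_cvec.comp hc3) (hp3.comp cvec), ?_, ?_, ?_⟩
  · refine (hasWeakDeriv_of_hasDerivAt (v := fun x => cvec (deriv u x))
      (v' := fun x => cvec (deriv (deriv u) x)) (fun x => ?_)
      (continuous_cvec.comp hu.continuous_deriv_deriv)).congr_ae
      (EventuallyEq.symm hu.coeFn_derivLp) (EventuallyEq.symm (coeFn_periodicLp _ _))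
    exact (cvecCLM n).hasFDerivAt.comp_hasDerivAt x (hu.hasDerivAt_deriv x)
  · refine (hasWeakDeriv_of_hasDerivAt (v := fun x => cvec (deriv (deriv u) x))
      (fun x => ?_) (continuous_cvec.comp hc3)).congr_ae
      (EventuallyEq.symm (coeFn_periodicLp _ _)) (EventuallyEq.symm (coeFn_periodicLp _ _))
    exact (cvecCLM n).hasFDerivAt.comp_hasDerivAt x (hu.hasDerivAt_deriv_deriv hf x)
  · filter_upwards [hu.coeFn_derivLp,
      coeFn_periodicLp (continuous_cvec.comp hu.continuous_deriv_deriv)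
        (hu.periodic_deriv_deriv.comp cvec),
      coeFn_periodicLp (continuous_cvec.comp hc3) (hp3.comp cvec),
      ae_circle_iff.1 (Lp.coeFn_zero (CVec n) 2 (volume : Measure UnitAddCircle))] with x h1 h2 h3 h4
    rw [h1, h2, h3, h4, jacobian_cvec]
    ext i
    simp [cvec_apply]
    ring

end IsPeriodicProfile

variable {f : RVec n → RVec n} {c : ℝ} {u : ℝ → RVec n}

theorem analyticAt_blochOp (hu : IsPeriodicProfile f c u) (hf : ContDiff ℝ 1 f) (ξ₀ : ℝ) :
    AnalyticAt ℝ (blochOp hu hf) ξ₀ := by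
  have hξ : AnalyticAt ℝ (fun ξ : ℝ => (ξ : ℂ)) ξ₀ := Complex.ofRealCLM.analyticAt ξ₀
  have h1 : ∀ A : L2Per n →L[ℂ] L2Per n, AnalyticAt ℝ (fun ξ : ℝ => (ξ : ℂ) • A) ξ₀ := fun A =>
    (((ContinuousLinearMap.toSpanSingleton ℂ A).restrictScalars ℝ).analyticAt _).comp hξ
  have h2 : ∀ A : L2Per n →L[ℂ] L2Per n, AnalyticAt ℝ (fun ξ : ℝ => (ξ : ℂ) ^ 2 • A) ξ₀ := fun A =>
    (((ContinuousLinearMap.toSpanSingleton ℂ A).restrictScalars ℝ).analyticAt _).comp (hξ.pow 2)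
  have h3 : AnalyticAt ℝ (blochPerturbation hu hf) ξ₀ :=
    (analyticAt_const.add (h1 _)).add (h2 _)
  exact analyticAt_const.add (((((ContinuousLinearMap.compL ℂ (L2Per n) (L2Per n) (L2Per n)).flip
    (resolventD n)).restrictScalars ℝ).analyticAt _).comp h3)

/-- The inverse Riesz isomorphism as a real-linear map. -/
def rieszReal (H : Type*) [NormedAddCommGroup H] [InnerProductSpace ℂ H] [CompleteSpace H] :
    (H →L[ℂ] ℂ) →L[ℝ] H :=
  LinearMap.mkContinuous
    { toFun := fun l => (InnerProductSpace.toDual ℂ H).symm l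
      map_add' := fun l m => map_add _ l m
      map_smul' := fun a l => by
        have h : a • l = (a : ℂ) • l := (Complex.coe_smul a l).symm
        rw [h, map_smulₛₗ, RingHom.id_apply, Complex.conj_ofReal, Complex.coe_smul] } 1
    fun l => by
      rw [one_mul]
      exact ((InnerProductSpace.toDual ℂ H).symm.norm_map l).le

theorem inner_rieszReal {H : Type*} [NormedAddCommGroup H] [InnerProductSpace ℂ H] [CompleteSpace H]
    (l : H →L[ℂ] ℂ) (v : H) : inner ℂ (rieszReal H l) v = l v :=
  InnerProductSpace.toDual_symm_apply

/-- Algebraic simplicity of the eigenvalue `0` makes the bordered operator injective: a null vector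
`(p, κ)` gives `L_0 w = -κ u'`, so `w` lies in the kernel of `L_0²` and is a multiple of `u'`; then
`φ p = 0` forces `p = 0` and `κ = 0`. -/
theorem isUnit_bordered_blochOp (hu : IsPeriodicProfile f c u) (hf : ContDiff ℝ 1 f)
    (hs : IsSimpleEigenvalue (BlochGraph f c u 0) 0) {p₀ : L2Per n}
    (hw : hu.derivLp = resolventD n (resolventD n p₀)) {φ : L2Per n →L[ℂ] ℂ}
    (hφ : φ p₀ = 1) :
    IsUnit (bordered (resolventD n (resolventD n p₀)) φ (blochOp hu hf 0)) := by
  have hK : IsCompactOperator (blochPerturbation hu hf 0 ∘L resolventD n) :=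
    isCompactOperator_resolventD.clm_comp (blochPerturbation hu hf 0)
  refine isUnit_bordered _ _ hK fun p κ h1 h2 => ?_
  obtain ⟨w, -, -, hk⟩ := hs
  have hu0 := hu.blochGraph_derivLp hf
  obtain ⟨k₁, hk₁⟩ := hk hu.derivLp 0 (by simpa using hu0)
    ((blochGraph_iff_exists hu hf).2 ⟨0, by simp, by simp⟩)
  have hk₁0 : k₁ ≠ 0 := fun h => hu.derivLp_ne_zero (by rw [hk₁, h, zero_smul])
  have hG : BlochGraph f c u 0 (resolventD n (resolventD n p)) (-(κ • hu.derivLp)) := by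
    refine (blochGraph_iff_exists hu hf).2 ⟨p, rfl, ?_⟩
    rw [hw]
    exact (eq_neg_of_add_eq_zero_left h1).symm
  have hG' : BlochGraph f c u 0 (-(κ • hu.derivLp)) ((0 : ℂ) • -(κ • hu.derivLp)) := by
    obtain ⟨p', hp1, hp2⟩ := (blochGraph_iff_exists hu hf).1 hu0
    refine (blochGraph_iff_exists hu hf).2 ⟨-(κ • p'), ?_, ?_⟩
    · rw [hp1]; simp
    · rw [map_neg, map_smul, ← hp2]; simp
  obtain ⟨k, hk⟩ := hk _ _ (by rw [zero_smul, zero_add]; exact hG) hG'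
  have h3 : p = (k * k₁⁻¹) • p₀ := by
    apply resolventD_injective
    apply resolventD_injective
    rw [hk, map_smul, map_smul, ← hw, hk₁, smul_smul, inv_mul_cancel_right₀ hk₁0]
  have h4 : k * k₁⁻¹ = 0 := by
    rw [h3, map_smul, hφ, smul_eq_mul, mul_one] at h2
    exact h2
  have h5 : p = 0 := by rw [h3, h4, zero_smul]
  refine ⟨h5, ?_⟩
  rw [h5, map_zero, add_zero, zero_add, ← hw] at h1
  exact (smul_eq_zero.1 h1).resolve_right hu.derivLp_ne_zero

/-- The critical mode, for the pencil `L_ξ (1 + ∂ₓ)⁻² - λ (1 + ∂ₓ)⁻²`.  The left eigenfunction is the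
Riesz representative of the left null functional, normalised by `ν(ξ) = l_ξ(q ξ)`. -/
theorem exists_isCriticalMode (hu : IsPeriodicProfile f c u) (hf : ContDiff ℝ 1 f)
    (hs : IsSimpleEigenvalue (BlochGraph f c u 0) 0) :
    ∃ (ε₀ : ℝ) (lam : ℝ → ℂ) (q qt : ℝ → L2Per n), IsCriticalMode f c u ε₀ lam q qt := by
  obtain ⟨p₀, hw, hp₀⟩ := (blochGraph_iff_exists hu hf).1 (hu.blochGraph_derivLp hf)
  have hp₀0 : p₀ ≠ 0 := fun h => hu.derivLp_ne_zero (by rw [hw, h, map_zero, map_zero])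
  obtain ⟨φ, hφ⟩ := SeparatingDual.exists_eq_one (R := ℂ) hp₀0
  obtain ⟨lam, p, l, -, hpan, hlan, hlam0, hp0, hl0, hright, hleft⟩ :=
    exists_analytic_eigenvalue_branch (S := resolventD n ∘L resolventD n)
      (analyticAt_blochOp hu hf 0) hφ hp₀.symm (isUnit_bordered_blochOp hu hf hs hw hφ)
  set q : ℝ → L2Per n := fun ξ => resolventD n (resolventD n (p ξ)) with hq
  have hqan : AnalyticAt ℝ q 0 :=
    (((resolventD n ∘L resolventD n).restrictScalars ℝ).analyticAt _).comp hpan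
  set ν : ℝ → ℂ := fun ξ => l ξ (q ξ) with hν
  have hνan : AnalyticAt ℝ ν 0 := by
    have h1 := ((ContinuousLinearMap.apply ℂ ℂ (E := L2Per n)).flip.bilinearRestrictScalars
      ℝ).analyticAt_bilinear (l 0, q 0)
    exact AnalyticAt.comp (f := fun ξ => (l ξ, q ξ)) h1 (hlan.prod hqan)
  have hν0 : ν 0 = 1 := by
    rw [hν]
    simp only [hq, hp0]
    exact hl0
  have hνne : ∀ᶠ ξ in 𝓝 0, ν ξ ≠ 0 :=
    hνan.continuousAt.eventually_ne (by rw [hν0]; exact one_ne_zero)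
  set qt : ℝ → L2Per n := fun ξ => rieszReal (L2Per n) ((ν ξ)⁻¹ • l ξ) with hqt
  have hqtan : AnalyticAt ℝ qt 0 := by
    have h1 : AnalyticAt ℝ (fun ξ => (ν ξ)⁻¹) 0 := hνan.inv (by rw [hν0]; exact one_ne_zero)
    have h2 := ((ContinuousLinearMap.lsmul ℂ ℂ (E := L2Per n →L[ℂ] ℂ)).bilinearRestrictScalars
      ℝ).analyticAt_bilinear ((ν 0)⁻¹, l 0)
    have h3 : AnalyticAt ℝ (fun ξ => (ν ξ)⁻¹ • l ξ) 0 :=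
      AnalyticAt.comp (f := fun ξ => ((ν ξ)⁻¹, l ξ)) h2 (h1.prod hlan)
    exact ((rieszReal (L2Per n)).analyticAt _).comp h3
  have hall := hright.and (hleft.and (hνne.and
    (hqan.eventually_analyticAt.and hqtan.eventually_analyticAt)))
  obtain ⟨ε, hε, hball⟩ := Metric.eventually_nhds_iff.1 hall
  have hin : ∀ ξ ∈ Set.Ioo (-min ε Real.pi) (min ε Real.pi), dist ξ 0 < ε := fun ξ hξ => by
    rw [Real.dist_eq, sub_zero, abs_lt]
    exact ⟨by linarith [hξ.1, min_le_left ε Real.pi], hξ.2.trans_le (min_le_left _ _)⟩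
  refine ⟨min ε Real.pi, lam, q, qt, lt_min hε Real.pi_pos, min_le_right _ _, hlam0, ?_,
    fun ξ hξ => (hball (hin ξ hξ)).2.2.2.1, fun ξ hξ => (hball (hin ξ hξ)).2.2.2.2,
    fun ξ hξ => ?_, fun ξ hξ w g hwg => ?_, fun ξ hξ => ?_⟩
  · have : q 0 = hu.derivLp := by rw [hq, hw]; simp only [hp0]
    rw [this]
    exact hu.coeFn_derivLp
  · exact (blochGraph_iff_exists hu hf).2 ⟨p ξ, rfl, (hball (hin ξ hξ)).1.symm⟩
  · obtain ⟨v, rfl, rfl⟩ := (blochGraph_iff_exists hu hf).1 hwg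
    rw [hqt]
    simp only [inner_rieszReal, _root_.smul_apply, (hball (hin ξ hξ)).2.1 v, smul_eq_mul]
    rw [mul_left_comm]
    rfl
  · rw [hqt]
    simp only [inner_rieszReal, _root_.smul_apply, smul_eq_mul]
    exact inv_mul_cancel₀ (hball (hin ξ hξ)).2.2.1

end Existence

/-! ### The critical eigenvalue -/

theorem analyticAt_dslope_zero {E : Type*} [NormedAddCommGroup E] [NormedSpace ℝ E] {g : ℝ → E}
    (h0 : AnalyticAt ℝ g 0) {x : ℝ} (hx : AnalyticAt ℝ g x) : AnalyticAt ℝ (dslope g 0) x := by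
  by_cases h : x = 0
  · subst h
    obtain ⟨p, hp⟩ := h0
    exact hp.has_fpower_series_dslope_fslope.analyticAt
  · have h1 : AnalyticAt ℝ (fun y : ℝ => (y - 0)⁻¹ • (g y - g 0)) x :=
      ((analyticAt_id.sub analyticAt_const).inv (by simpa using h)).smul (hx.sub analyticAt_const)
    exact h1.congr (dslope_eventuallyEq_slope_of_ne g h).symm

theorem contDiff_of_forall_tsupport {E : Type*} [NormedAddCommGroup E] [NormedSpace ℝ E] {g : ℝ → E}
    (h : ∀ x ∈ tsupport g, ContDiffAt ℝ ∞ g x) : ContDiff ℝ ∞ g := by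
  rw [contDiff_iff_contDiffAt]
  intro x
  by_cases hx : x ∈ tsupport g
  · exact h x hx
  · exact contDiffAt_const.congr_of_eventuallyEq (notMem_tsupport_iff_eventuallyEq.1 hx)

section Critical

variable {n : ℕ}

/-- Componentwise complex conjugation. -/
def conjCVec (n : ℕ) : CVec n →L[ℝ] CVec n :=
  LinearMap.toContinuousLinearMap
    { toFun := fun v => WithLp.toLp 2 fun i => (starRingEnd ℂ) (v i)
      map_add' := fun v w => by ext i; simp
      map_smul' := fun a v => by ext i; simp }

theorem conjCVec_apply (v : CVec n) (i : Fin n) : conjCVec n v i = (starRingEnd ℂ) (v i) := rfl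

theorem conjCVec_smul (a : ℂ) (v : CVec n) :
    conjCVec n (a • v) = (starRingEnd ℂ) a • conjCVec n v := by
  ext i; simp [conjCVec_apply]

theorem conjCVec_cvec (v : RVec n) : conjCVec n (cvec v) = cvec v := by
  ext i; rw [conjCVec_apply, cvec_apply, Complex.conj_ofReal]

theorem conjCVec_jacobian (f : RVec n → RVec n) (p : RVec n) (v : CVec n) :
    conjCVec n (jacobian f p v) = jacobian f p (conjCVec n v) := by
  ext i
  simp [conjCVec_apply, jacobian]

/-- Complex conjugation on `L²_per`. -/
def conjLp (w : L2Per n) : L2Per n := (conjCVec n).compLpL 2 volume w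

theorem coeFn_conjLp (w : L2Per n) : ∀ᵐ x : ℝ, conjLp w x = conjCVec n (w x) :=
  ae_circle_iff.1 ((conjCVec n).coeFn_compLpL w)

theorem HasWeakDeriv.conjLp {w v : L2Per n}
    (h : HasWeakDeriv (fun x : ℝ => w x) (fun x : ℝ => v x)) :
    HasWeakDeriv (fun x : ℝ => conjLp w x) (fun x : ℝ => PeriodicRD.conjLp v x) := by
  have key : HasWeakDeriv (fun x : ℝ => conjCVec n (w x)) (fun x : ℝ => conjCVec n (v x)) := by
    intro φ hφ hc
    have hφ' : ContDiff ℝ ∞ (deriv φ) := ((contDiff_infty_iff_deriv (F := ℝ)).1 hφ).2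
    have h1 : ∀ {ψ : ℝ → ℝ}, ContDiff ℝ ∞ ψ → HasCompactSupport ψ → ∀ z : L2Per n,
        ∫ x : ℝ, ψ x • conjCVec n (z x) = conjCVec n (∫ x : ℝ, ψ x • z x) := fun {ψ} h1 h2 z => by
      have h3 : Integrable fun x : ℝ => ψ x • z x := integrable_smul_L2Per
        (Complex.continuous_ofReal.comp h1.continuous)
        (h2.comp_left (g := fun x : ℝ => (x : ℂ)) Complex.ofReal_zero) z
      rw [← (conjCVec n).integral_comp_comm h3]
      simp only [map_smul]
    rw [h1 hφ' hc.deriv, h1 hφ hc, h φ hφ hc, map_neg]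
  exact key.congr_ae (EventuallyEq.symm (coeFn_conjLp w)) (EventuallyEq.symm (coeFn_conjLp v))

variable {f : RVec n → RVec n} {c : ℝ} {u : ℝ → RVec n}

/-- Since the coefficients are real, conjugation turns `L_ξ` into `L_{-ξ}`. -/
theorem BlochGraph.conjLp {ξ : ℝ} {w g : L2Per n} (h : BlochGraph f c u ξ w g) :
    BlochGraph f c u (-ξ) (conjLp w) (PeriodicRD.conjLp g) := by
  obtain ⟨w₁, w₂, h1, h2, h3⟩ := h
  refine ⟨PeriodicRD.conjLp w₁, PeriodicRD.conjLp w₂, h1.conjLp, h2.conjLp, ?_⟩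
  filter_upwards [h3, coeFn_conjLp w, coeFn_conjLp w₁, coeFn_conjLp w₂, coeFn_conjLp g]
    with x e1 e2 e3 e4 e5
  rw [e2, e3, e4, e5, e1, ← conjCVec_jacobian]
  simp only [map_add, conjCVec_smul, map_mul, map_pow, Complex.conj_I, Complex.conj_ofReal,
    Complex.ofReal_neg, map_ofNat]
  simp only [neg_mul, mul_neg]

theorem analyticAt_inner_left {E : Type*} [NormedAddCommGroup E] [InnerProductSpace ℂ E]
    {g : ℝ → E} {ξ : ℝ} (hg : AnalyticAt ℝ g ξ) (v : E) :
    AnalyticAt ℝ (fun ξ => inner ℂ (g ξ) v) ξ := by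
  have h1 : AnalyticAt ℝ (fun ξ => inner ℂ v (g ξ)) ξ :=
    (((innerSL ℂ v).restrictScalars ℝ).analyticAt _).comp hg
  have h2 : AnalyticAt ℝ (fun ξ => Complex.conjCLE (inner ℂ v (g ξ))) ξ :=
    ((Complex.conjCLE : ℂ →L[ℝ] ℂ).analyticAt _).comp h1
  refine h2.congr (Eventually.of_forall fun ξ => ?_)
  simp only [Complex.conjCLE_apply]
  exact inner_conj_symm _ _

namespace IsCriticalMode

variable {ε₀ : ℝ} {lam : ℝ → ℂ} {q qt : ℝ → L2Per n}

theorem zero_mem (hm : IsCriticalMode f c u ε₀ lam q qt) : (0 : ℝ) ∈ Set.Ioo (-ε₀) ε₀ :=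
  ⟨neg_lt_zero.2 hm.pos, hm.pos⟩

theorem Ioo_mem_nhds_zero (hm : IsCriticalMode f c u ε₀ lam q qt) :
    Set.Ioo (-ε₀) ε₀ ∈ 𝓝 (0 : ℝ) := Ioo_mem_nhds hm.zero_mem.1 hm.zero_mem.2

/-- The critical eigenvalue is analytic: testing `L_ξ q(ξ₀)`, a polynomial in `ξ`, against the
left eigenfunction gives `λ(ξ) ⟨qt ξ, q ξ₀⟩`. -/
theorem analyticAt_eigenvalue (hm : IsCriticalMode f c u ε₀ lam q qt)
    (hu : IsPeriodicProfile f c u) (hf : ContDiff ℝ 1 f) {ξ₀ : ℝ} (hξ₀ : ξ₀ ∈ Set.Ioo (-ε₀) ε₀) :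
    AnalyticAt ℝ lam ξ₀ := by
  obtain ⟨w₁, w₂, h1, h2, -⟩ := (blochGraph_iff hu hf).1 (hm.right_eigen ξ₀ hξ₀)
  have hqt := hm.analytic_qt ξ₀ hξ₀
  have hden := analyticAt_inner_left hqt (q ξ₀)
  have hden0 : inner ℂ (qt ξ₀) (q ξ₀) ≠ 0 := by rw [hm.normalized ξ₀ hξ₀]; exact one_ne_zero
  have hξ : AnalyticAt ℝ (fun ξ : ℝ => (ξ : ℂ)) ξ₀ := Complex.ofRealCLM.analyticAt ξ₀
  have hIξ : AnalyticAt ℝ (fun ξ : ℝ => Complex.I * (ξ : ℂ)) ξ₀ := analyticAt_const.mul hξ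
  have hnum : AnalyticAt ℝ (fun ξ : ℝ => inner ℂ (qt ξ) w₂
      + (2 * Complex.I * ξ) * inner ℂ (qt ξ) w₁
      + ((Complex.I * ξ) ^ 2 + c * (Complex.I * ξ)) * inner ℂ (qt ξ) (q ξ₀)
      + c * inner ℂ (qt ξ) w₁ + inner ℂ (qt ξ) (jacobianOp hu hf (q ξ₀))) ξ₀ :=
    ((((analyticAt_inner_left hqt _).add
      ((analyticAt_const.mul hξ).mul (analyticAt_inner_left hqt _))).add
      (((hIξ.pow 2).add (analyticAt_const.mul hIξ)).mul hden)).add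
      (analyticAt_const.mul (analyticAt_inner_left hqt _))).add (analyticAt_inner_left hqt _)
  refine (hnum.div hden hden0).congr ?_
  filter_upwards [hden.continuousAt.eventually_ne hden0, Ioo_mem_nhds hξ₀.1 hξ₀.2] with ξ h4 h5
  have h6 := hm.left_eigen ξ h5 (q ξ₀) _ ((blochGraph_iff hu hf).2 ⟨w₁, w₂, h1, h2, rfl⟩)
  rw [Pi.div_apply, div_eq_iff h4, ← h6]
  simp only [inner_add_right, inner_smul_right]

/-- An eigenvalue belongs to the spectrum, where (D3) applies. -/
theorem re_le (hm : IsCriticalMode f c u ε₀ lam q qt) {θ : ℝ}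
    (hD3 : ∀ ξ ∈ Set.Ico (-Real.pi) Real.pi,
      ∀ μ ∈ graphSpectrum (BlochGraph f c u ξ), μ.re ≤ -θ * |ξ| ^ 2) {ξ : ℝ}
    (hξ : ξ ∈ Set.Ioo (-ε₀) ε₀) (hu : IsPeriodicProfile f c u) (hf : ContDiff ℝ 1 f) :
    (lam ξ).re ≤ -θ * ξ ^ 2 := by
  rw [← sq_abs]
  refine hD3 ξ ⟨by linarith [hξ.1, hm.le_pi], hξ.2.trans_le hm.le_pi⟩ _ fun h => ?_
  have h1 : q ξ = 0 := by
    refine (h 0).unique ?_ ?_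
    · rw [add_zero]; exact hm.right_eigen ξ hξ
    · exact (blochGraph_iff_exists hu hf).2 ⟨0, by simp, by simp⟩
  have h2 := hm.normalized ξ hξ
  rw [h1, inner_zero_right] at h2
  exact zero_ne_one h2

theorem conjLp_q_zero (hm : IsCriticalMode f c u ε₀ lam q qt) : conjLp (q 0) = q 0 := by
  rw [← ae_circle_eq_iff]
  filter_upwards [coeFn_conjLp (q 0), hm.q_zero] with x h1 h2
  rw [h1, h2, conjCVec_cvec]

/-- The symmetry `λ(ξ) = conj λ(-ξ)`: the conjugate of `q(-ξ)` is an eigenfunction of `L_ξ`, and its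
pairing with `qt ξ` is close to `1` since `q 0 = u'` is real. -/
theorem eigenvalue_neg (hm : IsCriticalMode f c u ε₀ lam q qt) :
    ∀ᶠ ξ in 𝓝 (0 : ℝ), lam ξ = (starRingEnd ℂ) (lam (-ξ)) := by
  have h1 : ContinuousAt (fun ξ : ℝ => inner ℂ (qt ξ) (conjLp (q (-ξ)))) 0 := by
    have hq : ContinuousAt (fun ξ : ℝ => conjLp (q (-ξ))) 0 := by
      have h2 : ContinuousAt q (-0) := by
        rw [neg_zero]; exact (hm.analytic_q 0 hm.zero_mem).continuousAt
      exact ((conjCVec n).compLpL 2 volume).continuous.continuousAt.comp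
        (ContinuousAt.comp (g := q) (f := fun ξ : ℝ => -ξ) h2 continuousAt_neg)
    exact (hm.analytic_qt 0 hm.zero_mem).continuousAt.inner hq
  have h2 : inner ℂ (qt 0) (conjLp (q (-0))) ≠ 0 := by
    rw [neg_zero, hm.conjLp_q_zero, hm.normalized 0 hm.zero_mem]
    exact one_ne_zero
  filter_upwards [h1.eventually_ne h2, hm.Ioo_mem_nhds_zero] with ξ h3 h4
  have h5 : -ξ ∈ Set.Ioo (-ε₀) ε₀ := ⟨neg_lt_neg h4.2, by linarith [h4.1]⟩
  have h6 := (hm.right_eigen (-ξ) h5).conjLp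
  rw [neg_neg] at h6
  have h7 := hm.left_eigen ξ h4 _ _ h6
  have h8 : conjLp (lam (-ξ) • q (-ξ)) = (starRingEnd ℂ) (lam (-ξ)) • conjLp (q (-ξ)) := by
    rw [← ae_circle_eq_iff]
    filter_upwards [coeFn_conjLp (lam (-ξ) • q (-ξ)), coeFn_conjLp (q (-ξ)),
      ae_circle_iff.1 (Lp.coeFn_smul (lam (-ξ)) (q (-ξ))),
      ae_circle_iff.1 (Lp.coeFn_smul ((starRingEnd ℂ) (lam (-ξ))) (conjLp (q (-ξ))))]
      with x e1 e2 e3 e4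
    rw [e1, e3, e4, Pi.smul_apply, Pi.smul_apply, conjCVec_smul, e2]
  rw [h8, inner_smul_right] at h7
  exact (mul_right_cancel₀ h3 h7).symm

/-- The expansion `λ(ξ) = -iaξ + ξ² s(ξ)` with `s` analytic, `s(0) = -b` real and
`Re s ≤ -θ`.  The symmetry `λ(ξ) = conj λ(-ξ)` makes `λ'(0)` imaginary and `s(0)` real. -/
theorem exists_expansion (hm : IsCriticalMode f c u ε₀ lam q qt) (hu : IsPeriodicProfile f c u)
    (hf : ContDiff ℝ 1 f) {θ : ℝ}
    (hD3 : ∀ ξ ∈ Set.Ico (-Real.pi) Real.pi,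
      ∀ μ ∈ graphSpectrum (BlochGraph f c u ξ), μ.re ≤ -θ * |ξ| ^ 2) :
    ∃ (a b : ℝ) (s : ℝ → ℂ), s 0 = -b ∧ (∀ ξ, lam ξ = -Complex.I * a * ξ + (ξ : ℂ) ^ 2 * s ξ) ∧
      ∀ ξ ∈ Set.Ioo (-ε₀) ε₀, AnalyticAt ℝ s ξ ∧ (s ξ).re ≤ -θ := by
  have hlam : ∀ ξ ∈ Set.Ioo (-ε₀) ε₀, AnalyticAt ℝ lam ξ := fun ξ hξ =>
    hm.analyticAt_eigenvalue hu hf hξ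
  set g := dslope lam 0 with hg
  set s := dslope g 0 with hs
  have hgan : ∀ ξ ∈ Set.Ioo (-ε₀) ε₀, AnalyticAt ℝ g ξ := fun ξ hξ =>
    analyticAt_dslope_zero (hlam 0 hm.zero_mem) (hlam ξ hξ)
  have hsan : ∀ ξ ∈ Set.Ioo (-ε₀) ε₀, AnalyticAt ℝ s ξ := fun ξ hξ =>
    analyticAt_dslope_zero (hgan 0 hm.zero_mem) (hgan ξ hξ)
  have hexp : ∀ ξ : ℝ, lam ξ = ξ * (g 0 + ξ * s ξ) := by
    intro ξ
    have h1 := sub_smul_dslope lam 0 ξ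
    have h2 := sub_smul_dslope g 0 ξ
    rw [← hg, hm.lam_zero, sub_zero, sub_zero, Complex.real_smul] at h1
    rw [← hs, sub_zero, Complex.real_smul] at h2
    rw [← h1, h2]
    ring
  have hsc : ContinuousAt (fun ξ : ℝ => (starRingEnd ℂ) (s (-ξ))) 0 := by
    have h2 : ContinuousAt s (-0) := by
      rw [neg_zero]; exact (hsan 0 hm.zero_mem).continuousAt
    exact Complex.continuous_conj.continuousAt.comp
      (ContinuousAt.comp (g := s) (f := fun ξ : ℝ => -ξ) h2 continuousAt_neg)
  have hs0 := (hsan 0 hm.zero_mem).continuousAt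
  have hrel : ∀ᶠ ξ : ℝ in 𝓝[≠] 0,
      g 0 + (starRingEnd ℂ) (g 0) + ξ * (s ξ - (starRingEnd ℂ) (s (-ξ))) = 0 := by
    filter_upwards [hm.eigenvalue_neg.filter_mono nhdsWithin_le_nhds, self_mem_nhdsWithin]
      with ξ h1 h2
    rw [hexp ξ, hexp (-ξ)] at h1
    simp only [map_mul, map_add, Complex.conj_ofReal, Complex.ofReal_neg, map_neg] at h1
    have h3 : (ξ : ℂ) ≠ 0 := Complex.ofReal_ne_zero.2 h2
    refine mul_left_cancel₀ h3 ?_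
    rw [mul_zero]
    linear_combination h1
  have hg0 : g 0 + (starRingEnd ℂ) (g 0) = 0 := by
    have h1 : Tendsto (fun ξ : ℝ => g 0 + (starRingEnd ℂ) (g 0)
        + ξ * (s ξ - (starRingEnd ℂ) (s (-ξ)))) (𝓝[≠] 0)
        (𝓝 (g 0 + (starRingEnd ℂ) (g 0) + (0 : ℝ) * (s 0 - (starRingEnd ℂ) (s (-0))))) :=
      (continuousAt_const.add (Complex.continuous_ofReal.continuousAt.mul
        (hs0.sub hsc))).tendsto.mono_left nhdsWithin_le_nhds
    have h2 := tendsto_nhds_unique (h1.congr' hrel) tendsto_const_nhds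
    simpa using h2
  have hs00 : s 0 = (starRingEnd ℂ) (s 0) := by
    have h1 : Tendsto (fun ξ : ℝ => s ξ - (starRingEnd ℂ) (s (-ξ))) (𝓝[≠] 0)
        (𝓝 (s 0 - (starRingEnd ℂ) (s (-0)))) :=
      (hs0.sub hsc).tendsto.mono_left nhdsWithin_le_nhds
    have h2 : ∀ᶠ ξ : ℝ in 𝓝[≠] 0, s ξ - (starRingEnd ℂ) (s (-ξ)) = 0 := by
      filter_upwards [hrel, self_mem_nhdsWithin] with ξ h3 h4
      rw [hg0, zero_add] at h3
      exact (mul_eq_zero.1 h3).resolve_left (Complex.ofReal_ne_zero.2 h4)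
    have h3 := tendsto_nhds_unique (h1.congr' h2) tendsto_const_nhds
    rw [neg_zero] at h3
    exact sub_eq_zero.1 h3
  have hgre : (g 0).re = 0 := by
    have := congrArg Complex.re hg0
    simp only [Complex.add_re, Complex.conj_re, Complex.zero_re] at this
    linarith
  have hre : ∀ ξ ∈ Set.Ioo (-ε₀) ε₀, ξ ≠ 0 → (s ξ).re ≤ -θ := by
    intro ξ hξ h0
    have h1 := hm.re_le hD3 hξ hu hf
    rw [hexp ξ, Complex.re_ofReal_mul, Complex.add_re, Complex.re_ofReal_mul, hgre, zero_add] at h1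
    have h2 : 0 < ξ ^ 2 := by positivity
    nlinarith
  refine ⟨-(g 0).im, -(s 0).re, s, ?_, fun ξ => ?_, fun ξ hξ => ⟨hsan ξ hξ, ?_⟩⟩
  · rw [Complex.ofReal_neg, neg_neg]
    exact (Complex.conj_eq_iff_re.1 hs00.symm).symm
  · have h1 : g 0 = Complex.I * (g 0).im := by
      conv_lhs => rw [← Complex.re_add_im (g 0), hgre]
      simp [mul_comm]
    rw [hexp ξ, h1]
    simp
    ring
  · by_cases h0 : ξ = 0
    · subst h0
      have h1 : Tendsto (fun ξ : ℝ => (s ξ).re) (𝓝[≠] 0) (𝓝 (s 0).re) :=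
        (Complex.continuous_re.continuousAt.comp hs0).tendsto.mono_left nhdsWithin_le_nhds
      refine le_of_tendsto h1 ?_
      filter_upwards [mem_nhdsWithin_of_mem_nhds hm.Ioo_mem_nhds_zero, self_mem_nhdsWithin]
        with ξ h2 h3
      exact hre ξ h2 h3
    · exact hre ξ hξ h0

end IsCriticalMode

end Critical

/-! ### The Bloch coefficients -/

section DivFrequency

/-- The sequence `1 / (2πj)`, with value zero at `j = 0`. -/
def freqInv (j : ℤ) : ℂ := (2 * Real.pi * j : ℂ)⁻¹

theorem norm_freqInv (j : ℤ) : ‖freqInv j‖ = (2 * Real.pi)⁻¹ * |(j : ℝ)|⁻¹ := by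
  rw [freqInv, norm_inv, norm_mul, norm_mul, Complex.norm_real, Complex.norm_intCast, mul_inv]
  simp [abs_of_pos Real.pi_pos]

theorem norm_freqInv_le (j : ℤ) : ‖freqInv j‖ ≤ (2 * Real.pi)⁻¹ := by
  rw [norm_freqInv]
  refine mul_le_of_le_one_right (by positivity) ?_
  by_cases hj : j = 0
  · simp [hj]
  · refine inv_le_one_of_one_le₀ ?_
    rw [← Int.cast_abs]
    exact_mod_cast Int.one_le_abs hj

theorem freqInv_bounded : ∃ B : ℝ, 0 ≤ B ∧ ∀ j, ‖freqInv j‖ ≤ B :=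
  ⟨(2 * Real.pi)⁻¹, by positivity, norm_freqInv_le⟩

theorem summable_freqInv : Summable fun j => ‖freqInv j‖ ^ (2 : ℝ) := by
  have h := (Real.summable_one_div_int_pow (p := 2)).2 (by norm_num)
  refine (h.mul_left ((2 * Real.pi)⁻¹ ^ 2)).congr fun j => ?_
  rw [norm_freqInv, Real.rpow_two, mul_pow, inv_pow |(j : ℝ)|, sq_abs, one_div]

/-- Division by `2πj` maps `ℓ²` into `ℓ¹`, by the Cauchy–Schwarz inequality. -/
theorem summable_and_tsum_mul_freqInv_le (a : lp (fun _ : ℤ × Fin 1 => ℂ) 2) :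
    (Summable fun j : ℤ => ‖a (j, 0)‖ * ‖freqInv j‖) ∧
      ∑' j : ℤ, ‖a (j, 0)‖ * ‖freqInv j‖
        ≤ ‖a‖ * (∑' j, ‖freqInv j‖ ^ (2 : ℝ)) ^ (1 / 2 : ℝ) := by
  have h2 : (2 : ENNReal).toReal = 2 := by norm_num
  have hsum : Summable fun k => ‖a k‖ ^ (2 : ℝ) := by
    have := (lp.hasSum_norm (by norm_num) a).summable
    rwa [h2] at this
  have hinj : Function.Injective fun j : ℤ => (j, (0 : Fin 1)) := fun j k h => (Prod.ext_iff.1 h).1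
  have h := Real.summable_and_inner_le_Lp_mul_Lq_tsum_of_nonneg Real.HolderConjugate.two_two
    (fun j : ℤ => norm_nonneg (a (j, 0))) (fun j => norm_nonneg (freqInv j))
    (hsum.comp_injective hinj) summable_freqInv
  refine ⟨h.1, h.2.trans ?_⟩
  refine mul_le_mul_of_nonneg_right ?_ (by positivity)
  rw [lp.norm_eq_tsum_rpow (by norm_num) a, h2]
  refine Real.rpow_le_rpow (tsum_nonneg fun j => by positivity) ?_ (by norm_num)
  exact tsum_comp_le_tsum_of_inj hsum (fun k => by positivity) hinj

/-- The map `a ↦ (conj aⱼ / (2πj))ⱼ` from `ℓ²` to `ℓ¹`, real-linear because of the conjugation. -/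
def conjDivFreq : lp (fun _ : ℤ × Fin 1 => ℂ) 2 →L[ℝ] lp (fun _ : ℤ => ℂ) 1 :=
  LinearMap.mkContinuous
    { toFun := fun a => ⟨fun j => (starRingEnd ℂ) (a (j, 0)) * freqInv j, by
        refine memℓp_gen ?_
        simpa using (summable_and_tsum_mul_freqInv_le a).1⟩
      map_add' := fun a b => by
        ext j
        change (starRingEnd ℂ) (a (j, 0) + b (j, 0)) * _ = _ * _ + _ * _
        rw [map_add, add_mul]
      map_smul' := fun c a => by
        ext j
        change (starRingEnd ℂ) (c • a (j, 0)) * _ = c • (_ * _)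
        rw [Complex.real_smul, Complex.real_smul, map_mul, Complex.conj_ofReal, mul_assoc] }
    ((∑' j, ‖freqInv j‖ ^ (2 : ℝ)) ^ (1 / 2 : ℝ)) fun a => by
      rw [mul_comm]
      refine le_of_eq_of_le ?_ (summable_and_tsum_mul_freqInv_le a).2
      rw [lp.norm_eq_tsum_rpow (by norm_num)]
      simp

/-- The multiplication by `2πj / (ξ + 2πj)` on `ℓ¹`, as the inverse of the multiplication by
`1 + ξ / (2πj)`.  It equals one at `j = 0`, by the convention for `freqInv`. -/
def freqShift (ξ : ℝ) : lp (fun _ : ℤ => ℂ) 1 →L[ℂ] lp (fun _ : ℤ => ℂ) 1 :=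
  Ring.inverse (1 + (ξ : ℂ) • diagMul 1 freqInv freqInv_bounded)

theorem isUnit_one_add_diagMul {ξ : ℝ} (hξ : |ξ| < Real.pi) :
    IsUnit (1 + (ξ : ℂ) • diagMul 1 freqInv freqInv_bounded) := by
  have h1 : ‖-((ξ : ℂ) • diagMul 1 freqInv freqInv_bounded)‖ < 1 := by
    rw [norm_neg, norm_smul, Complex.norm_real, Real.norm_eq_abs]
    calc |ξ| * ‖diagMul 1 freqInv freqInv_bounded‖ ≤ |ξ| * (2 * Real.pi)⁻¹ :=
          mul_le_mul_of_nonneg_left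
            (norm_diagMul_le _ _ (by positivity) norm_freqInv_le) (abs_nonneg _)
      _ < 1 := by
          rw [← div_eq_mul_inv, div_lt_one (by positivity)]
          linarith [Real.pi_pos]
  have h2 := (Units.oneSub _ h1).isUnit
  rwa [Units.val_oneSub, sub_neg_eq_add] at h2

theorem freqShift_apply {ξ : ℝ} (hξ : |ξ| < Real.pi) (a : lp (fun _ : ℤ => ℂ) 1) (j : ℤ) :
    (1 + ξ * freqInv j) * freqShift ξ a j = a j := by
  have h1 := congrArg (fun A : lp (fun _ : ℤ => ℂ) 1 →L[ℂ] lp (fun _ : ℤ => ℂ) 1 => A a j)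
    (Ring.mul_inverse_cancel _ (isUnit_one_add_diagMul hξ))
  have h2 : freqShift ξ a j + ξ * (freqInv j * freqShift ξ a j) = a j := h1
  rw [← h2]
  ring

theorem analyticAt_freqShift {ξ : ℝ} (hξ : |ξ| < Real.pi) : AnalyticAt ℝ freqShift ξ := by
  obtain ⟨U, hU⟩ := isUnit_one_add_diagMul hξ
  have h1 : AnalyticAt ℂ Ring.inverse (1 + (ξ : ℂ) • diagMul 1 freqInv freqInv_bounded) :=
    hU ▸ analyticAt_inverse (𝕜 := ℂ) U
  have h2 : AnalyticAt ℝ (fun ξ : ℝ => (ξ : ℂ) • diagMul 1 freqInv freqInv_bounded) ξ :=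
    (((ContinuousLinearMap.toSpanSingleton ℂ
      (diagMul 1 freqInv freqInv_bounded)).restrictScalars ℝ).analyticAt _).comp
      (Complex.ofRealCLM.analyticAt ξ)
  exact AnalyticAt.comp
    (f := fun ξ : ℝ => 1 + (ξ : ℂ) • diagMul 1 freqInv freqInv_bounded)
    (h1.restrictScalars (𝕜 := ℝ)) (analyticAt_const.add h2)

end DivFrequency

section Coefficients

variable {n : ℕ} {f : RVec n → RVec n} {c : ℝ} {u : ℝ → RVec n}

/-- The functional `⟨u'(x), ·⟩` on `ℂⁿ`, with values in `CVec 1` so that the Fourier basis of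
`L2Per 1` applies. -/
def innerProfile (u : ℝ → RVec n) (x : ℝ) : CVec n →L[ℂ] CVec 1 :=
  (ContinuousLinearMap.toSpanSingleton ℂ (EuclideanSpace.single (0 : Fin 1) (1 : ℂ))) ∘L
    innerSL ℂ (cvec (deriv u x))

theorem innerProfile_apply (u : ℝ → RVec n) (x : ℝ) (v : CVec n) :
    innerProfile u x v 0 = inner ℂ (cvec (deriv u x)) v := by
  simp [innerProfile]

namespace IsPeriodicProfile

theorem continuous_innerProfile (hu : IsPeriodicProfile f c u) : Continuous (innerProfile u) :=
  continuous_const.clm_comp ((innerSL ℂ (E := CVec n)).continuous.comp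
    (continuous_cvec.comp hu.contDiff_deriv.continuous))

theorem periodic_innerProfile (hu : IsPeriodicProfile f c u) :
    Function.Periodic (innerProfile u) 1 := fun x => by
  rw [innerProfile, innerProfile, hu.periodic_deriv x]

/-- The operator `w ↦ ⟨u'(·), w(·)⟩`. -/
def innerOp (hu : IsPeriodicProfile f c u) : L2Per n →L[ℂ] L2Per 1 :=
  mulOp (periodicMap hu.continuous_innerProfile hu.periodic_innerProfile)

theorem coeFn_innerOp (hu : IsPeriodicProfile f c u) (w : L2Per n) :
    ∀ᵐ x : ℝ, hu.innerOp w x 0 = inner ℂ (cvec (deriv u x)) (w x) := by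
  filter_upwards [ae_circle_iff.1 (coeFn_mulOp
    (periodicMap hu.continuous_innerProfile hu.periodic_innerProfile) w)] with x hx
  rw [periodicMap_coe] at hx
  rw [← innerProfile_apply, ← hx]
  rfl

/-- The Bloch coefficients are conjugate Fourier coefficients of `⟨u', qt ξ⟩`. -/
theorem modeCoeff_eq (hu : IsPeriodicProfile f c u) (qt : ℝ → L2Per n) (j : ℤ) (ξ : ℝ) :
    modeCoeff u qt j ξ
      = (starRingEnd ℂ) ((modeBasis 1).repr (hu.innerOp (qt ξ)) (j, 0)) := by
  rw [modeBasis_repr_apply, fourierCoeff_apply, fourierCoeff_eq_intervalIntegral _ _ 0, modeCoeff,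
    div_one, one_smul, zero_add, intervalIntegral.integral_of_le zero_le_one,
    intervalIntegral.integral_of_le zero_le_one, ← integral_conj]
  refine integral_congr_ae (ae_restrict_of_ae ?_)
  filter_upwards [hu.coeFn_innerOp (qt ξ)] with x hx
  rw [hx, inner_smul_right, smul_eq_mul, map_mul, inner_conj_symm, ← fourier_neg, neg_neg,
    fourier_coe_apply]
  simp

theorem modeCoeff_zero_eq (hu : IsPeriodicProfile f c u) (qt : ℝ → L2Per n) (ξ : ℝ) :
    modeCoeff u qt 0 ξ = inner ℂ (qt ξ) hu.derivLp := by
  rw [L2.inner_def, ← UnitAddCircle.intervalIntegral_preimage 0, zero_add, modeCoeff]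
  refine intervalIntegral.integral_congr_ae ?_
  filter_upwards [hu.coeFn_derivLp] with x hx _
  rw [hx]
  simp

/-- The sequence of Bloch coefficients divided by `2πj`, as an element of `ℓ¹`. -/
def divCoeff (hu : IsPeriodicProfile f c u) : L2Per n →L[ℝ] lp (fun _ : ℤ => ℂ) 1 :=
  conjDivFreq ∘L ((((modeBasis 1).repr.toContinuousLinearEquiv :
    L2Per 1 →L[ℂ] lp (fun _ : ℤ × Fin 1 => ℂ) 2) ∘L hu.innerOp).restrictScalars ℝ)

theorem divCoeff_apply (hu : IsPeriodicProfile f c u) (qt : ℝ → L2Per n) (j : ℤ) (ξ : ℝ) :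
    hu.divCoeff (qt ξ) j = modeCoeff u qt j ξ * freqInv j := by
  rw [hu.modeCoeff_eq]
  rfl

end IsPeriodicProfile

variable {ε₀ : ℝ} {lam : ℝ → ℂ} {q qt : ℝ → L2Per n} {α : ℝ → ℝ}

theorem IsCutoff.hasCompactSupport (hα : IsCutoff ε₀ α) : HasCompactSupport α :=
  HasCompactSupport.of_support_subset_isCompact isCompact_Icc
    ((subset_tsupport α).trans (hα.support.trans Set.Ioo_subset_Icc_self))

theorem IsCutoff.isAmplitude_smul {E : Type*} [NormedAddCommGroup E] [NormedSpace ℂ E] [CompleteSpace E]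
    {g : ℝ → E}
    (hα : IsCutoff ε₀ α) (hg : ∀ ξ ∈ Set.Ioo (-ε₀) ε₀, AnalyticAt ℝ g ξ) :
    IsAmplitude fun ξ => α ξ • g ξ :=
  ⟨contDiff_of_forall_tsupport fun ξ hξ => hα.contDiff.contDiffAt.smul
    (hg ξ (hα.support (tsupport_smul_subset_left α g hξ))).contDiffAt, hα.hasCompactSupport.smul_right⟩

/-- A second cutoff function, equal to one on the support of the first. -/
theorem IsCutoff.exists_bump (hα : IsCutoff ε₀ α) :
    ∃ β : ℝ → ℝ, ContDiff ℝ ∞ β ∧ tsupport β ⊆ Set.Ioo (-ε₀) ε₀ ∧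
      (∀ ξ, 0 ≤ β ξ ∧ β ξ ≤ 1) ∧ ∀ ξ, α ξ ≠ 0 → β ξ = 1 := by
  have hK : IsCompact (tsupport α) := hα.hasCompactSupport
  have h0 : (0 : ℝ) ∈ tsupport α :=
    subset_tsupport α (by rw [Function.mem_support, hα.eq_one.self_of_nhds]; exact one_ne_zero)
  obtain ⟨ξ₁, hξ₁, hmax⟩ := hK.exists_isMaxOn ⟨0, h0⟩ continuous_abs.continuousOn
  have hε : 0 < ε₀ := (hα.support h0).2
  have h1 : max |ξ₁| (ε₀ / 2) < ε₀ := max_lt (abs_lt.2 (hα.support hξ₁)) (half_lt_self hε)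
  obtain ⟨R, hR1, hR2⟩ := exists_between h1
  let B : ContDiffBump (0 : ℝ) :=
    ⟨max |ξ₁| (ε₀ / 2), R, lt_max_of_lt_right (half_pos hε), hR1⟩
  refine ⟨B, B.contDiff, ?_, fun ξ => ⟨B.nonneg, B.le_one⟩, fun ξ hξ => ?_⟩
  · rw [B.tsupport_eq, Real.closedBall_eq_Icc, zero_sub, zero_add]
    exact fun ξ hξ => ⟨by linarith [hξ.1], hξ.2.trans_lt hR2⟩
  · refine B.one_of_mem_closedBall ?_
    rw [mem_closedBall_zero_iff, Real.norm_eq_abs]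
    exact (hmax (subset_tsupport α hξ)).trans (le_max_left _ _)

/-- The data entering the kernel estimates.  The phase `m` is `s`, extended to all frequencies by the
constant `-b` outside the support of a second cutoff; being a convex combination of `s` and `-b`, it
keeps the bound `Re m ≤ -θ`.  For `j ≠ 0` the coefficient divided by `ξ + 2πj` is the product of the
shift `2πj / (ξ + 2πj)` and the `ℓ¹` sequence `divCoeff`, both analytic in `ξ`. -/
theorem IsCriticalMode.exists_isCriticalSymbol (hm : IsCriticalMode f c u ε₀ lam q qt)
    (hu : IsPeriodicProfile f c u) {θ a b : ℝ} (hθ : 0 < θ) {s : ℝ → ℂ}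
    (hs0 : s 0 = -b) (hlam : ∀ ξ, lam ξ = -Complex.I * a * ξ + (ξ : ℂ) ^ 2 * s ξ)
    (hs : ∀ ξ ∈ Set.Ioo (-ε₀) ε₀, AnalyticAt ℝ s ξ ∧ (s ξ).re ≤ -θ) (hα : IsCutoff ε₀ α) :
    ∃ m A₀ G, IsCriticalSymbol u lam qt α a b θ m A₀ G := by
  obtain ⟨β, hβc, hβs, hβ01, hβ1⟩ := hα.exists_bump
  have hθb : θ ≤ b := by
    have h1 := (hs 0 hm.zero_mem).2
    rw [hs0] at h1
    simpa using h1
  have hpi : ∀ ξ ∈ Set.Ioo (-ε₀) ε₀, |ξ| < Real.pi := fun ξ hξ =>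
    (abs_lt.2 hξ).trans_le hm.le_pi
  have hmem : ∀ ξ, α ξ ≠ 0 → ξ ∈ Set.Ioo (-ε₀) ε₀ := fun ξ hξ =>
    hα.support (subset_tsupport α hξ)
  refine ⟨fun ξ => -b + β ξ • (s ξ + b), fun ξ => α ξ • inner ℂ (qt ξ) hu.derivLp,
    fun ξ => α ξ • freqShift ξ (hu.divCoeff (qt ξ)), ?_⟩
  refine
    { phase := ⟨?_, hθ, fun ξ => ?_⟩
      pos := hθ.trans_le hθb
      phase_zero := ?_
      lam_eq := fun ξ hξ => ?_
      amplitude_zero := hα.isAmplitude_smul fun ξ hξ =>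
        analyticAt_inner_left (hm.analytic_qt ξ hξ) _
      zero_eq_one := ?_
      coeff_zero := fun ξ => ?_
      amplitude := hα.isAmplitude_smul fun ξ hξ => ?_
      coeff := fun ξ j hj => ?_ }
  · refine contDiff_const.add (contDiff_of_forall_tsupport fun ξ hξ => ?_)
    exact hβc.contDiffAt.smul ((hs ξ (hβs (tsupport_smul_subset_left β _ hξ))).1.contDiffAt.add
      contDiffAt_const)
  · by_cases hξ : β ξ = 0
    · rw [hξ, zero_smul, add_zero]
      simpa using hθb
    · have h1 := (hs ξ (hβs (subset_tsupport β hξ))).2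
      have h2 := hβ01 ξ
      rw [Complex.add_re, Complex.smul_re, Complex.add_re, Complex.neg_re, Complex.ofReal_re,
        smul_eq_mul]
      nlinarith
  · simp only [hs0, neg_add_cancel, smul_zero, add_zero]
  · simp only [hβ1 ξ hξ, one_smul]
    rw [hlam ξ]
    ring
  · have h1 : q 0 = hu.derivLp := by
      rw [← ae_circle_eq_iff]
      filter_upwards [hm.q_zero, hu.coeFn_derivLp] with x e1 e2
      rw [e1, e2]
    rw [hα.eq_one.self_of_nhds, one_smul, ← h1, hm.normalized 0 hm.zero_mem]
  · rw [hu.modeCoeff_zero_eq, Complex.real_smul]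
  · have h1 := ((ContinuousLinearMap.id ℂ
      (lp (fun _ : ℤ => ℂ) 1 →L[ℂ] lp (fun _ : ℤ => ℂ) 1)).bilinearRestrictScalars
      ℝ).analyticAt_bilinear (freqShift ξ, hu.divCoeff (qt ξ))
    exact AnalyticAt.comp (f := fun ξ => (freqShift ξ, hu.divCoeff (qt ξ))) h1
      ((analyticAt_freqShift (hpi ξ hξ)).prod
        ((hu.divCoeff.analyticAt _).comp (hm.analytic_qt ξ hξ)))
  · by_cases hξ : α ξ = 0
    · simp [hξ]
    · have h1 := freqShift_apply (hpi ξ (hmem ξ hξ)) (hu.divCoeff (qt ξ)) j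
      rw [hu.divCoeff_apply, freqInv] at h1
      have hj' : (2 * Real.pi * j : ℂ) ≠ 0 := by
        simp [hj, Real.pi_ne_zero]
      change (ξ + 2 * Real.pi * j) * (α ξ • freqShift ξ (hu.divCoeff (qt ξ)) j) = _
      rw [Complex.real_smul]
      field_simp at h1
      linear_combination (α ξ : ℂ) * h1

end Coefficients

theorem isBigO_of_expansion {lam s : ℝ → ℂ} {a b : ℝ} (hs0 : s 0 = -b)
    (hlam : ∀ ξ, lam ξ = -Complex.I * a * ξ + (ξ : ℂ) ^ 2 * s ξ) (hs : AnalyticAt ℝ s 0) :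
    (fun ξ : ℝ => lam ξ - (-Complex.I * a * ξ - b * ξ ^ 2)) =O[𝓝 (0 : ℝ)]
      (fun ξ : ℝ => |ξ| ^ 3) := by
  have h1 : (fun ξ : ℝ => s ξ - s 0) =O[𝓝 (0 : ℝ)] fun ξ : ℝ => ξ := by
    simpa using hs.differentiableAt.isBigO_sub
  have h2 : (fun ξ : ℝ => (ξ : ℂ) ^ 2) =O[𝓝 (0 : ℝ)] fun ξ : ℝ => ξ ^ 2 :=
    Asymptotics.IsBigO.of_bound 1 (Eventually.of_forall fun ξ => by simp)
  have h3 := h2.mul h1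
  refine (h3.congr (fun ξ => ?_) (fun ξ => ?_)).trans
    (Asymptotics.isBigO_refl (fun ξ : ℝ => ξ ^ 3) (𝓝 0) |>.norm_right.congr_right fun ξ => ?_)
  · rw [hlam ξ, hs0]; ring
  · exact (pow_succ ξ 2).symm
  · rw [Real.norm_eq_abs, abs_pow]

end PeriodicRD

end

theorem proposition3p3 {n : ℕ}
    (f : PeriodicRD.RVec n → PeriodicRD.RVec n) (hf : ContDiff ℝ 1 f)
    (c : ℝ) (u : ℝ → PeriodicRD.RVec n)
    (hu : PeriodicRD.IsPeriodicProfile f c u)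
    (hstab : PeriodicRD.DiffusivelyStable f c u) :
    (∃ (ε₀ : ℝ) (lam : ℝ → ℂ) (q qt : ℝ → PeriodicRD.L2Per n),
      PeriodicRD.IsCriticalMode f c u ε₀ lam q qt) ∧
    ∀ (ε₀ : ℝ) (lam : ℝ → ℂ) (q qt : ℝ → PeriodicRD.L2Per n),
      PeriodicRD.IsCriticalMode f c u ε₀ lam q qt →
      ∃ a b : ℝ, 0 < b ∧
        (fun ξ : ℝ => lam ξ - (-Complex.I * a * ξ - b * ξ ^ 2)) =O[𝓝 (0 : ℝ)]
          (fun ξ : ℝ => |ξ| ^ 3) ∧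
        ∀ α : ℝ → ℝ, PeriodicRD.IsCutoff ε₀ α →
        ∀ r : ℝ, 1 < r → ∀ C : ℝ, 0 < C →
        ∃ M M' K : ℝ, 0 < M ∧ M < M' ∧ 0 < K ∧
          ∀ (E₀ : ℝ) (h₀ : ℝ → ℝ), 0 < E₀ → Differentiable ℝ h₀ →
            (∀ x, |deriv h₀ x| ≤ E₀ * (1 + |x|) ^ (-r)) →
            ∀ t x : ℝ, 0 < t → |x| ≤ C * t →
              Summable (PeriodicRD.criticalTerm u lam qt α h₀ t x) ∧
              ‖PeriodicRD.sTildeOne u lam qt α a b h₀ t x‖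
                ≤ K * PeriodicRD.convolutionBound a M h₀ t x ∧
              ‖PeriodicRD.sTildeOne u lam qt α a b h₀ t x‖
                ≤ K * (E₀ * PeriodicRD.decayProfile a M' r t x) ∧
              (r ≤ 2 → PeriodicRD.convolutionBound a M h₀ t x
                ≤ K * (E₀ * PeriodicRD.decayProfile a M' r t x)) := by
  refine ⟨PeriodicRD.exists_isCriticalMode hu hf hstab.D2, fun ε₀ lam q qt hm => ?_⟩
  obtain ⟨θ, hθ, hD3⟩ := hstab.D3
  obtain ⟨a, b, s, hs0, hlam, hs⟩ := hm.exists_expansion hu hf hD3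
  have hb : 0 < b := by
    have h1 := (hs 0 hm.zero_mem).2
    rw [hs0, Complex.neg_re, Complex.ofReal_re] at h1
    linarith
  refine ⟨a, b, hb, PeriodicRD.isBigO_of_expansion hs0 hlam (hs 0 hm.zero_mem).1,
    fun α hα r hr C hC => ?_⟩
  obtain ⟨m, A₀, G, hsym⟩ := hm.exists_isCriticalSymbol hu hθ hs0 hlam hs hα
  exact hsym.estimate hr hC
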